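/- **Theorem A.** Every elliptic curve over $\mathbb{Q}$ is isomorphic to $E_{A,B}: y^2=x^3+Ax+B$ for a unique pair of integers $A,B$ with $4A^3+27B^2\neq 0$ that is *minimal*, i.e. such that no integer $d>1$ satisfies $d^4\mid A$ and $d^6\mid B$; its naive height is $\max(4|A|^3,27B^2)$. Let $n\ge 1$, let $G\le \mathrm{GL}_2(\mathbb{Z}/n\mathbb{Z})$ and let $a<b$ be divisors of $n$, with $c=\mathrm{lcm}(a,b)$ and $d=\gcd(a,b)$. Let $G_c$ be the image of $G$ in $\mathrm{GL}_2(\mathbb{Z}/c\mathbb{Z})$ and, for $m\mid c$, let $N_m$ be the kernel of reduction $G_c\to\mathrm{GL}_2(\mathbb{Z}/m\mathbb{Z})$. The group $G$ represents an $(a,b)$-entanglement of type $T$ if $\langle N_a,N_b\rangle\subsetneq N_d$ and $N_d/\langle N_a,N_b\rangle\cong T$. Let $\mathcal{T}_G$ be the set of all such $((a,b),T)$ (types up to isomorphism), with the relation $((a_1,b_1),T_1)\le((a_2,b_2),T_2)$ if either $T_1\cong T_2$ and $(a_2\mid a_1, b_2\mid b_1$ or $b_2\mid a_1, a_2\mid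 b_1)$, or $T_1$ is isomorphic to a quotient of $T_2$ and $(a_1\mid a_2, b_1\mid b_2$ or $b_1\mid a_2, a_1\mid b_2)$. The entanglement is primitive if $((a,b),T)$ is the unique maximal element of $\mathcal{T}_G$ and $n=\mathrm{lcm}(a,b)$; a primitive one is unexplained if $[(\mathbb{Z}/c\mathbb{Z})^\times:\det\langle N_a,N_b\rangle]\neq[G_c:\langle N_a,N_b\rangle]$. An elliptic curve $E/\mathbb{Q}$ has an unexplained $(a,b)$-entanglement of type $T$ if the image of $\mathrm{Gal}(\overline{\mathbb{Q}}/\mathbb{Q})$ on $E[n]\cong(\mathbb{Z}/n\mathbb{Z})^2$, $n=\mathrm{lcm}(a,b)$, does. Let $N_{((a,b),T)}(X)$ be the number of isomorphism classes of elliptic curves over $\mathbb{Q}$ of naive height at most $X$ having an unexplained $(a,b)$-entanglement of type $T$. Then, as $X\to\infty$: 1. $N_{((2,3),\mathbb{Z}/2\mathbb{Z})}(X)\gg X^{1/9}$; 2. $N_{((2,5),\mathbb{Z}/2\mathbb{Z})}(X)\gg X^{1/12}$. Moreover, for the following two pairs of binary forms $A=A_0C$, $B=B_0C$, - $\mathcal{F}_1$: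 $C=u^4+36u^2v^2+432v^4$, $A_0=-3u^2-36v^2$, $B_0=2u^5+72u^3v^2+864uv^4$, - $\mathcal{F}_2$: $C=u^4+22u^2v^2+125v^4$, $A_0=-3u^4-30u^2v^2-15v^4$, $B_0=2(u^4+4u^2v^2-v^4)(u^4+22u^2v^2+125v^4)$, let $\mathcal{F}_i(X)$ be the set of pairs of coprime integers $(a,b)$, $b>0$, such that $4A(a,b)^3+27B(a,b)^2\ne0$, the pair $(A(a,b),B(a,b))$ is minimal, and $E_{A(a,b),B(a,b)}$ has naive height at most $X$. Let $\mathcal{R}=\{(u,v)\in\mathbb{R}^2: v>0,\ 4|A(u,v)|^3\le1,\ 27|B(u,v)|^2\le 1\}$; for a prime $\ell$ let $\mathfrak{d}_\ell$ be the proportion of the pairs $(a,b)\in(\mathbb{Z}/\ell^6\mathbb{Z})^2$ for which $\ell$ does not divide both $a$ and $b$, and $\ell^4\nmid A(a,b)$ or $\ell^6\nmid B(a,b)$; and let $r_\ell$ be the number of roots of $C(t,1)$ in $\mathbb{Z}/\ell\mathbb{Z}$. In both cases $\mathcal{R}$ is bounded of positive area, the product $\prod_\ell\mathfrak{d}_\ell$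 over all primes converges to a positive number, and: 3. $\#\mathcal{F}_1(X)\sim\prod_\ell\mathfrak{d}_\ell\cdot\mathrm{Area}(\mathcal{R})\,X^{1/9}$, where $\mathfrak{d}_2=\tfrac12$, $\mathfrak{d}_3=\tfrac23$ and $\mathfrak{d}_\ell=1-\frac1{\ell^2}-\frac{r_\ell(\ell-1)}{\ell^5}$ for every prime $\ell\ne2,3$; 4. $\#\mathcal{F}_2(X)\sim\prod_\ell\mathfrak{d}_\ell\cdot\mathrm{Area}(\mathcal{R})\,X^{1/12}$, where $\mathfrak{d}_\ell=1-\frac1{\ell^2}-\frac{r_\ell(\ell-1)}{\ell^5}$ for every prime $\ell\ne2,3,5$. -/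

import Mathlib

open Filter Topology Asymptotics MeasureTheory

noncomputable section

namespace Entanglement

/-! ### Entanglements of subgroups of `GL₂(ℤ/nℤ)` -/

/-- Reduction `π_m : GL₂(ℤ/nℤ) → GL₂(ℤ/mℤ)` for a divisor `m` of `n`. -/
def red {n m : ℕ} (h : m ∣ n) :
    Matrix.GeneralLinearGroup (Fin 2) (ZMod n) →* Matrix.GeneralLinearGroup (Fin 2) (ZMod m) :=
  Matrix.GeneralLinearGroup.map (ZMod.castHom h (ZMod m))

/-- The image `G_c` of `G ≤ GL₂(ℤ/nℤ)` in `GL₂(ℤ/cℤ)`, for a divisor `c` of `n`. -/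
def levelImage {n c : ℕ} (G : Subgroup (Matrix.GeneralLinearGroup (Fin 2) (ZMod n)))
    (h : c ∣ n) : Subgroup (Matrix.GeneralLinearGroup (Fin 2) (ZMod c)) :=
  G.map (red h)

/-- `N_m = ker(π_m) ∩ Γ` for `Γ ≤ GL₂(ℤ/cℤ)` and `m ∣ c`, as a subgroup of `Γ`. -/
def kerRed {c m : ℕ} (Γ : Subgroup (Matrix.GeneralLinearGroup (Fin 2) (ZMod c)))
    (h : m ∣ c) : Subgroup Γ :=
  ((red h).comp Γ.subtype).ker

instance kerRed_normal {c m : ℕ} (Γ : Subgroup (Matrix.GeneralLinearGroup (Fin 2) (ZMod c)))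
    (h : m ∣ c) : (kerRed Γ h).Normal :=
  MonoidHom.normal_ker _

section

variable {n : ℕ} (G : Subgroup (Matrix.GeneralLinearGroup (Fin 2) (ZMod n)))
  {a b : ℕ} (ha : a ∣ n) (hb : b ∣ n)

/-- `G_c` with `c = lcm(a, b)`. -/
def lcmImage : Subgroup (Matrix.GeneralLinearGroup (Fin 2) (ZMod (Nat.lcm a b))) :=
  levelImage G (Nat.lcm_dvd ha hb)

/-- `N_{a,b}(G) = ⟨N_a, N_b⟩ ≤ G_c`, where `c = lcm(a, b)`. -/
def joinKer : Subgroup (lcmImage G ha hb) :=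
  kerRed (lcmImage G ha hb) (Nat.dvd_lcm_left a b) ⊔
    kerRed (lcmImage G ha hb) (Nat.dvd_lcm_right a b)

/-- `N_d ≤ G_c`, where `c = lcm(a, b)` and `d = gcd(a, b)`. -/
def gcdKer : Subgroup (lcmImage G ha hb) :=
  kerRed (lcmImage G ha hb) ((Nat.gcd_dvd_left a b).trans (Nat.dvd_lcm_left a b))

instance joinKer_normal : (joinKer G ha hb).Normal := by
  unfold joinKer; infer_instance

/-- The group `N_d / ⟨N_a, N_b⟩`. -/
abbrev entanglementGroup : Type :=
  gcdKer G ha hb ⧸ (joinKer G ha hb).subgroupOf (gcdKer G ha hb)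

end

/-- `G` represents an `(a, b)`-entanglement of type `T`, that is, `((a, b), T) ∈ 𝒯_G`:
`a < b` are divisors of `n`, `⟨N_a, N_b⟩ ⊊ N_d` and `N_d / ⟨N_a, N_b⟩ ≅ T`. -/
def Represents {n : ℕ} (G : Subgroup (Matrix.GeneralLinearGroup (Fin 2) (ZMod n)))
    (a b : ℕ) (T : Type) [Group T] : Prop :=
  ∃ (ha : a ∣ n) (hb : b ∣ n), a < b ∧ joinKer G ha hb < gcdKer G ha hb ∧
    Nonempty (entanglementGroup G ha hb ≃* T)

/-- The relation `((a₁, b₁), H₁) ≤ ((a₂, b₂), H₂)`. -/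
def EntLE (a₁ b₁ : ℕ) (H₁ : Type) [Group H₁] (a₂ b₂ : ℕ) (H₂ : Type) [Group H₂] : Prop :=
  (Nonempty (H₁ ≃* H₂) ∧ ((a₂ ∣ a₁ ∧ b₂ ∣ b₁) ∨ (b₂ ∣ a₁ ∧ a₂ ∣ b₁))) ∨
  ((∃ f : H₂ →* H₁, Function.Surjective f) ∧
    ((a₁ ∣ a₂ ∧ b₁ ∣ b₂) ∨ (b₁ ∣ a₂ ∧ a₁ ∣ b₂)))

/-- `((a, b), T)` is a maximal element of `𝒯_G`. -/
def IsMaximalEnt {n : ℕ} (G : Subgroup (Matrix.GeneralLinearGroup (Fin 2) (ZMod n)))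
    (a b : ℕ) (T : Type) [Group T] : Prop :=
  Represents G a b T ∧ ∀ (a' b' : ℕ) (T' : Type) [Group T'],
    Represents G a' b' T' → EntLE a b T a' b' T' → EntLE a' b' T' a b T

/-- `G ≤ GL₂(ℤ/nℤ)` represents a primitive `(a, b)`-entanglement of type `T`: `((a, b), T)` is
the unique maximal element of `𝒯_G` (types being taken up to isomorphism) and
`n = lcm(a, b)`. -/
def IsPrimitive {n : ℕ} (G : Subgroup (Matrix.GeneralLinearGroup (Fin 2) (ZMod n)))
    (a b : ℕ) (T : Type) [Group T] : Prop :=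
  IsMaximalEnt G a b T ∧
  (∀ (a' b' : ℕ) (T' : Type) [Group T'],
    IsMaximalEnt G a' b' T' → a' = a ∧ b' = b ∧ Nonempty (T' ≃* T)) ∧
  n = Nat.lcm a b

/-- `G` exhibits an unexplained `(a, b)`-entanglement of type `T`: it represents a primitive one
and, with `c = lcm(a, b)`, `[(ℤ/cℤ)ˣ : det N_{a,b}(G)] ≠ [G_c : N_{a,b}(G)]`. -/
def IsUnexplained {n : ℕ} (G : Subgroup (Matrix.GeneralLinearGroup (Fin 2) (ZMod n)))
    (a b : ℕ) (T : Type) [Group T] : Prop :=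
  IsPrimitive G a b T ∧ ∃ (ha : a ∣ n) (hb : b ∣ n),
    ((joinKer G ha hb).map
      (Matrix.GeneralLinearGroup.det.comp (lcmImage G ha hb).subtype)).index ≠
    (joinKer G ha hb).index

/-! ### Galois images of elliptic curves over `ℚ` -/

/-- The Weierstrass curve `E_{A,B} : y² = x³ + A x + B` over `ℚ`. -/
def shortCurve (A B : ℤ) : WeierstrassCurve ℚ := ⟨0, 0, 0, A, B⟩

/-- The group `E(ℚ̄)`. -/
abbrev GeomPoint (E : WeierstrassCurve ℚ) : Type :=
  (E.baseChange (AlgebraicClosure ℚ)).toAffine.Point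

open Classical in
/-- `G ≤ GL₂(ℤ/nℤ)` is the image of `ρ_{E,n} : Gal(ℚ̄/ℚ) → Aut(E[n]) ≅ GL₂(ℤ/nℤ)` for some
choice of a basis `e : (ℤ/nℤ)² ≅ E[n]`. (So `G` is determined by `E` up to conjugacy.) -/
def IsGaloisImage (E : WeierstrassCurve ℚ) (n : ℕ)
    (G : Subgroup (Matrix.GeneralLinearGroup (Fin 2) (ZMod n))) : Prop :=
  ∃ e : (Fin 2 → ZMod n) ≃+ AddSubgroup.torsionBy (GeomPoint E) (n : ℤ),
    ∀ g : Matrix.GeneralLinearGroup (Fin 2) (ZMod n),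
      g ∈ G ↔ ∃ σ : AlgebraicClosure ℚ ≃ₐ[ℚ] AlgebraicClosure ℚ,
        ∀ v : Fin 2 → ZMod n,
          WeierstrassCurve.Affine.Point.map (W' := E) σ.toAlgHom (e v : GeomPoint E) =
            (e (Matrix.mulVec (g : Matrix (Fin 2) (Fin 2) (ZMod n)) v) : GeomPoint E)

/-- `E` exhibits an unexplained `(a, b)`-entanglement of type `T`: the image of `ρ_{E,n}`,
`n = lcm(a, b)`, does. (Whether it does is independent of the basis.) -/
def HasUnexplained (E : WeierstrassCurve ℚ) (a b : ℕ) (T : Type) [Group T] : Prop :=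
  ∃ G : Subgroup (Matrix.GeneralLinearGroup (Fin 2) (ZMod (Nat.lcm a b))),
    IsGaloisImage E (Nat.lcm a b) G ∧ IsUnexplained G a b T

/-! ### Counting by naive height -/

/-- `H(A, B) = max(4|A|³, 27 B²)`. -/
def height (A B : ℤ) : ℤ := max (4 * |A| ^ 3) (27 * B ^ 2)

/-- The minimality defect of `(A, B)` is `1`: only `d = 1` satisfies `d⁴ ∣ A` and `d⁶ ∣ B`. -/
def IsMinimal (A B : ℤ) : Prop :=
  ∀ d : ℕ, (d : ℤ) ^ 4 ∣ A → (d : ℤ) ^ 6 ∣ B → d = 1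

/-- `N_𝔗(X)` for `𝔗 = ((a, b), T)`: the number of isomorphism classes of elliptic curves over `ℚ`
with naive height at most `X` exhibiting an unexplained `(a, b)`-entanglement of type `T`. Each
isomorphism class contains exactly one `E_{A,B}` with `A, B ∈ ℤ` and `(A, B)` minimal, and its
naive height is `H(A, B)`. -/
def entanglementCount (a b : ℕ) (T : Type) [Group T] (X : ℝ) : ℕ :=
  Set.ncard {p : ℤ × ℤ | 4 * p.1 ^ 3 + 27 * p.2 ^ 2 ≠ 0 ∧ IsMinimal p.1 p.2 ∧
    (height p.1 p.2 : ℝ) ≤ X ∧ HasUnexplained (shortCurve p.1 p.2) a b T}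

/-! ### Families given by two binary forms -/

/-- The value `F(u, v)` of `F ∈ ℤ[u, v]` in a commutative ring. -/
def val {R : Type} [CommRing R] (F : MvPolynomial (Fin 2) ℤ) (u v : R) : R :=
  MvPolynomial.aeval ![u, v] F

/-- `#𝒞(X)`: the number of pairs `(a, b)` of coprime integers with `b > 0` for which
`E_{A(a,b), B(a,b)}` is an elliptic curve, given by a minimal equation, of height at most `X`. -/
def familyCount (A B : MvPolynomial (Fin 2) ℤ) (X : ℝ) : ℕ :=
  Set.ncard {p : ℤ × ℤ | 0 < p.2 ∧ Int.gcd p.1 p.2 = 1 ∧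
    4 * val A p.1 p.2 ^ 3 + 27 * val B p.1 p.2 ^ 2 ≠ 0 ∧
    IsMinimal (val A p.1 p.2) (val B p.1 p.2) ∧
    (height (val A p.1 p.2) (val B p.1 p.2) : ℝ) ≤ X}

/-- `ℛ = {(u, v) ∈ ℝ² : v > 0, 4|A(u,v)|³ ≤ 1, 27|B(u,v)|² ≤ 1}`. -/
def region (A B : MvPolynomial (Fin 2) ℤ) : Set (ℝ × ℝ) :=
  {p | 0 < p.2 ∧ 4 * |val A p.1 p.2| ^ 3 ≤ 1 ∧ 27 * |val B p.1 p.2| ^ 2 ≤ 1}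

/-- `𝔡_ℓ`: the proportion of the classes `(a, b)` modulo `ℓ⁶` for which `ℓ` does not divide both
`a` and `b`, and `ℓ⁴ ∤ A(a,b)` or `ℓ⁶ ∤ B(a,b)`. -/
def localDensity (A B : MvPolynomial (Fin 2) ℤ) (l : ℕ) : ℝ :=
  (Set.ncard {p : ZMod (l ^ 6) × ZMod (l ^ 6) |
      (¬ (l : ZMod (l ^ 6)) ∣ p.1 ∨ ¬ (l : ZMod (l ^ 6)) ∣ p.2) ∧
      (¬ (l : ZMod (l ^ 6)) ^ 4 ∣ val A p.1 p.2 ∨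
        ¬ (l : ZMod (l ^ 6)) ^ 6 ∣ val B p.1 p.2)} : ℝ) / (l : ℝ) ^ 12

/-- `r_ℓ`: the number of roots in `ℤ/ℓℤ` of `C(t, 1)`. -/
def rootCount (C : MvPolynomial (Fin 2) ℤ) (l : ℕ) : ℕ :=
  Set.ncard {t : ZMod l | val C t 1 = 0}

/-- The variable `u` of `ℤ[u, v]`. -/
abbrev uu : MvPolynomial (Fin 2) ℤ := MvPolynomial.X 0

/-- The variable `v` of `ℤ[u, v]`. -/
abbrev vv : MvPolynomial (Fin 2) ℤ := MvPolynomial.X 1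

/-- `C(u,v)` for the family `𝓕₁`. -/
def C₁ : MvPolynomial (Fin 2) ℤ := uu ^ 4 + 36 * uu ^ 2 * vv ^ 2 + 432 * vv ^ 4

/-- `A(u,v)` for the family `𝓕₁`. -/
def A₁ : MvPolynomial (Fin 2) ℤ := (-3 * uu ^ 2 - 36 * vv ^ 2) * C₁

/-- `B(u,v)` for the family `𝓕₁`. -/
def B₁ : MvPolynomial (Fin 2) ℤ :=
  (2 * uu ^ 5 + 72 * uu ^ 3 * vv ^ 2 + 864 * uu * vv ^ 4) * C₁

/-- `C(u,v)` for the family `𝓕₂`. -/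
def C₂ : MvPolynomial (Fin 2) ℤ := uu ^ 4 + 22 * uu ^ 2 * vv ^ 2 + 125 * vv ^ 4

/-- `A(u,v)` for the family `𝓕₂`. -/
def A₂ : MvPolynomial (Fin 2) ℤ := (-3 * uu ^ 4 - 30 * uu ^ 2 * vv ^ 2 - 15 * vv ^ 4) * C₂

/-- `B(u,v)` for the family `𝓕₂`. -/
def B₂ : MvPolynomial (Fin 2) ℤ :=
  2 * (uu ^ 4 + 4 * uu ^ 2 * vv ^ 2 - vv ^ 4) *
    (uu ^ 4 + 22 * uu ^ 2 * vv ^ 2 + 125 * vv ^ 4) * C₂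

/-- `#𝒞(X) ~ (∏_ℓ 𝔡_ℓ) Area(ℛ) X^e`, where `ℛ` is bounded of positive area and the product over
all primes converges to a positive real number. -/
def HasEulerAsymptotic (A B : MvPolynomial (Fin 2) ℤ) (e : ℝ) : Prop :=
  Bornology.IsBounded (region A B) ∧ 0 < volume (region A B) ∧
  Multipliable (fun l : Nat.Primes => localDensity A B l) ∧
  0 < ∏' l : Nat.Primes, localDensity A B l ∧
  (fun X : ℝ => (familyCount A B X : ℝ)) ~[atTop]
    (fun X : ℝ => (∏' l : Nat.Primes, localDensity A B l) *
      (volume (region A B)).toReal * X ^ e)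

end Entanglement

end

open Filter Topology Asymptotics MeasureTheory

noncomputable section

namespace Entanglement

/-! ### Counting lattice points -/

/-! In both families `A = f·C` and `B = g·C²`, where `C = u⁴ + m u²v² + n v⁴` is positive for `v ≠
0`, and `-(4A³ + 27B²)` is a square times `C³`. Everything rests on these shapes.

The asymptotics. With `k` the common degree of `A³` and `B²` (18 or 24) and `Y = X^(1/k)`, height at
most `X` means that `(a/Y, b/Y)` lies in the fixed bounded region, while coprimality and minimality
are conditions modulo `ℓ⁶` for every prime `ℓ`. For finitely many primes the Chinese remainder
theorem and the comparison of lattice points with area give the main term. For the other primes a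
violated condition means that `ℓ` divides both coordinates, or that `ℓ ∤ b` and `ℓ⁴ ∣ C(a,b)`. Roots
of `C` modulo `ℓ` are simple, so in a box of side `N` this costs `O(N²/ℓ²) + O(N)`. As `C` has
degree four, `ℓ⁴ ∣ C(a,b)` forces `ℓ = O(N)`, and the primes up to `O(N)` number only `o(N)`; hence
the tail is negligible (`tail_bound`, `tendsto_sieve`). Pairs of discriminant zero form a finite
set. The same Hensel argument evaluates the local densities (`density_eq_of_bad_iff`).

The entanglements. Let `c = √C` and `p = 3` or `5`. The discriminant identity puts `c` in `ℚ(E[2])`;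
explicit `p`-torsion abscissas put it in `ℚ(E[p])`. The sign character `ψ` of `ℚ(c)` is therefore
trivial on `N₂` and on `N_p`. Conversely, if `σ` fixes `c`, then `σ³` is trivial on `E[2]`, and some
`σ^(3k+1)` is trivial on `E[p]`, so `σ = (σ^(3k))⁻¹ σ^(3k+1)` lies in `⟨N₂, N_p⟩`. Thus `⟨N₂, N_p⟩`
corresponds to `ker ψ`, of index two. Some `σ` fixes `c` and negates `√-3` (respectively `√5`); its
determinant generates `(ℤ/2p)ˣ`, so determinants of `⟨N₂, N_p⟩` fill the whole group, and index 1
differs from index 2. Primitivity is automatic, since `(2, p)` is the only pair of divisors of `2p`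
with the first smaller than the second and not dividing it (`isUnexplained_of_character`,
`hasUnexplained_of_torsion`).

The lower bounds. A congruence modulo 5 (respectively 11) makes `C` (and `5C`) a nonsquare and keeps
a positive proportion of the pairs in the sieve. Boundedly many pairs give the same curve, because
`A³/(4A³ + 27B²)` is a nonconstant rational function of `a/b` (`exists_lower_bound`). -/

theorem exists_mem_segment_frontier {E : Type*} [AddCommGroup E] [Module ℝ E] [TopologicalSpace E]
    [IsTopologicalAddGroup E] [ContinuousSMul ℝ E] {s : Set E} {x y : E} (hx : x ∈ s)
    (hy : y ∉ s) : ∃ z ∈ segment ℝ x y, z ∈ frontier s := by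
  by_contra! h
  have hpre : IsPreconnected (segment ℝ x y) := (convex_segment x y).isPreconnected
  have hsub : segment ℝ x y ⊆ interior s ∪ interior sᶜ := by
    intro z hz
    have := h z hz
    rw [frontier, Set.mem_sdiff, not_and, not_not] at this
    by_cases hzc : z ∈ closure s
    · exact Or.inl (this hzc)
    · right
      rw [interior_compl]; exact hzc
  have hdisj : Disjoint (interior s) (interior sᶜ) :=
    Set.disjoint_of_subset interior_subset interior_subset disjoint_compl_right
  rcases hpre.subset_or_subset isOpen_interior isOpen_interior hdisj hsub with h1 | h1
  · exact hy (interior_subset (h1 (right_mem_segment ℝ x y)))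
  · exact (interior_subset (h1 (left_mem_segment ℝ x y))) hx

/-- The half-open square of side `h` in the grid with origin `o` indexed by `k`. -/
def gridSquare (o : ℝ × ℝ) (h : ℝ) (k : ℤ × ℤ) : Set (ℝ × ℝ) :=
  Set.Ico (o.1 + h * k.1) (o.1 + h * k.1 + h) ×ˢ Set.Ico (o.2 + h * k.2) (o.2 + h * k.2 + h)

/-- The grid points lying in `R`. -/
def gridPoints (R : Set (ℝ × ℝ)) (o : ℝ × ℝ) (h : ℝ) : Set (ℤ × ℤ) :=
  {k | (o.1 + h * k.1, o.2 + h * k.2) ∈ R}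

theorem gridSquare_measurable (o : ℝ × ℝ) (h : ℝ) (k : ℤ × ℤ) :
    MeasurableSet (gridSquare o h k) := measurableSet_Ico.prod measurableSet_Ico

theorem volume_gridSquare (o : ℝ × ℝ) {h : ℝ} (k : ℤ × ℤ) :
    volume (gridSquare o h k) = ENNReal.ofReal h * ENNReal.ofReal h := by
  rw [gridSquare, Measure.volume_eq_prod, Measure.prod_prod, Real.volume_Ico, Real.volume_Ico]
  simp

theorem eq_of_mem_Ico_grid {o h x : ℝ} (hh : 0 < h) {k l : ℤ}
    (hk : x ∈ Set.Ico (o + h * k) (o + h * k + h)) (hl : x ∈ Set.Ico (o + h * l) (o + h * l + h)) :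
    k = l := by
  obtain ⟨h1, h2⟩ := hk
  obtain ⟨h3, h4⟩ := hl
  have e1 : (k : ℝ) < l + 1 := by
    by_contra! hc
    nlinarith
  have e2 : (l : ℝ) < k + 1 := by
    by_contra! hc
    nlinarith
  have e3 : k < l + 1 := by exact_mod_cast e1
  have e4 : l < k + 1 := by exact_mod_cast e2
  omega

theorem gridSquare_disjoint (o : ℝ × ℝ) {h : ℝ} (hh : 0 < h) {k l : ℤ × ℤ} (hkl : k ≠ l) :
    Disjoint (gridSquare o h k) (gridSquare o h l) := by
  rw [Set.disjoint_left]
  rintro x ⟨hx1, hx2⟩ ⟨hy1, hy2⟩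
  exact hkl (Prod.ext (eq_of_mem_Ico_grid hh hx1 hy1) (eq_of_mem_Ico_grid hh hx2 hy2))

theorem exists_mem_gridSquare (o : ℝ × ℝ) {h : ℝ} (hh : 0 < h) (x : ℝ × ℝ) :
    ∃ k, x ∈ gridSquare o h k := by
  have key : ∀ a b : ℝ, b ∈ Set.Ico (a + h * ⌊(b - a) / h⌋) (a + h * ⌊(b - a) / h⌋ + h) := by
    intro a b
    have h1 := Int.floor_le ((b - a) / h)
    have h2 := Int.lt_floor_add_one ((b - a) / h)
    rw [le_div_iff₀ hh] at h1
    rw [div_lt_iff₀ hh] at h2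
    constructor <;> nlinarith
  exact ⟨(⌊(x.1 - o.1) / h⌋, ⌊(x.2 - o.2) / h⌋), key _ _, key _ _⟩

theorem dist_le_of_mem_gridSquare {o : ℝ × ℝ} {h : ℝ} {k : ℤ × ℤ} {x : ℝ × ℝ}
    (hx : x ∈ gridSquare o h k) : dist x (o.1 + h * k.1, o.2 + h * k.2) ≤ h := by
  obtain ⟨⟨h1, h2⟩, h3, h4⟩ := hx
  rw [Prod.dist_eq, Real.dist_eq, Real.dist_eq]
  apply max_le <;> rw [abs_le] <;> constructor <;> dsimp only <;> linarith

theorem mem_cthickening_frontier {R : Set (ℝ × ℝ)} {x y : ℝ × ℝ} {h : ℝ} (hxy : dist x y ≤ h)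
    (hx : x ∈ R) (hy : y ∉ R) :
    x ∈ Metric.cthickening h (frontier R) ∧ y ∈ Metric.cthickening h (frontier R) := by
  obtain ⟨z, hz, hzf⟩ := exists_mem_segment_frontier hx hy
  have h3 : dist x z + dist z y = dist x y := dist_add_dist_of_mem_segment hz
  have p1 : 0 ≤ dist x z := dist_nonneg
  have p2 : 0 ≤ dist z y := dist_nonneg
  exact ⟨Metric.mem_cthickening_of_dist_le _ z _ _ hzf (by linarith),
    Metric.mem_cthickening_of_dist_le _ z _ _ hzf (by rw [dist_comm]; linarith)⟩

theorem gridPoints_finite {R : Set (ℝ × ℝ)} (hR : Bornology.IsBounded R) (o : ℝ × ℝ) {h : ℝ}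
    (hh : 0 < h) : (gridPoints R o h).Finite := by
  obtain ⟨K, hK⟩ := hR.subset_closedBall o
  apply Set.Finite.subset ((Set.finite_Icc (-⌈K / h⌉) ⌈K / h⌉).prod
    (Set.finite_Icc (-⌈K / h⌉) ⌈K / h⌉))
  intro k hk
  have h1 := hK hk
  rw [Metric.mem_closedBall, Prod.dist_eq, Real.dist_eq, Real.dist_eq] at h1
  have key : ∀ (a : ℝ) (n : ℤ), |a + h * n - a| ≤ K → n ∈ Set.Icc (-⌈K / h⌉) ⌈K / h⌉ := by
    intro a n hn
    rw [add_sub_cancel_left, abs_le] at hn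
    have c := Int.le_ceil (K / h)
    rw [div_le_iff₀ hh] at c
    constructor
    · have : (-⌈K / h⌉ : ℝ) ≤ n := by
        by_contra! hc
        nlinarith
      exact_mod_cast this
    · have : (n : ℝ) ≤ ⌈K / h⌉ := by
        by_contra! hc
        nlinarith
      exact_mod_cast this
  exact ⟨key _ _ ((le_max_left _ _).trans h1), key _ _ ((le_max_right _ _).trans h1)⟩

/-- Attach to each grid point of `R` the square of which it is the lower left corner. The union of
these squares differs from `R` only within sup-distance `h` of the frontier. The bound does not
involve the origin `o`, which matters because the origin will move with the scale. -/
theorem abs_gridPoints_sub_volume_le {R : Set (ℝ × ℝ)} (hR : Bornology.IsBounded R) (o : ℝ × ℝ)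
    {h : ℝ} (hh : 0 < h) :
    |(gridPoints R o h).ncard * h ^ 2 - volume.real R| ≤
      volume.real (Metric.cthickening h (frontier R)) := by
  have hfin := gridPoints_finite hR o hh
  set T := Metric.cthickening h (frontier R) with hT
  set U := ⋃ k ∈ hfin.toFinset, gridSquare o h k with hU
  have hTb : Bornology.IsBounded T :=
    (hR.closure.subset frontier_subset_closure).cthickening
  have hUvol : volume.real U = (gridPoints R o h).ncard * h ^ 2 := by
    rw [hU, measureReal_def, measure_biUnion_finset]
    · simp only [volume_gridSquare, Finset.sum_const, nsmul_eq_mul]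
      rw [Set.ncard_eq_toFinset_card _ hfin, ENNReal.toReal_mul, ENNReal.toReal_mul,
        ENNReal.toReal_ofReal hh.le]
      simp [pow_two]
    · intro k _ l _ hkl
      exact gridSquare_disjoint o hh hkl
    · exact fun k _ => gridSquare_measurable o h k
  have hUR : U ⊆ R ∪ T := by
    intro x hx
    simp only [hU, Set.mem_iUnion, Set.Finite.mem_toFinset] at hx
    obtain ⟨k, hk, hxk⟩ := hx
    by_cases hxR : x ∈ R
    · exact Or.inl hxR
    · right
      have := dist_le_of_mem_gridSquare hxk
      rw [dist_comm] at this
      exact (mem_cthickening_frontier this hk hxR).2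
  have hRU : R ⊆ U ∪ T := by
    intro x hx
    obtain ⟨k, hk⟩ := exists_mem_gridSquare o hh x
    by_cases hkR : k ∈ gridPoints R o h
    · left
      simp only [hU, Set.mem_iUnion, Set.Finite.mem_toFinset]
      exact ⟨k, hkR, hk⟩
    · right
      exact (mem_cthickening_frontier (dist_le_of_mem_gridSquare hk) hx hkR).1
  have hTfin : volume T ≠ ⊤ := hTb.measure_lt_top.ne
  have hRfin : volume R ≠ ⊤ := hR.measure_lt_top.ne
  have hUfin : volume U ≠ ⊤ :=
    (lt_of_le_of_lt (measure_mono hUR) (hR.union hTb).measure_lt_top).ne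
  have i1 : volume.real U ≤ volume.real R + volume.real T :=
    (measureReal_mono hUR (hR.union hTb).measure_lt_top.ne).trans (measureReal_union_le _ _)
  have i2 : volume.real R ≤ volume.real U + volume.real T :=
    (measureReal_mono hRU (by
      exact (lt_of_le_of_lt (measure_union_le _ _)
        (ENNReal.add_lt_top.2 ⟨hUfin.lt_top, hTfin.lt_top⟩)).ne)).trans (measureReal_union_le _ _)
  rw [← hUvol, abs_le]
  constructor <;> linarith

/-- The pairs of integers satisfying `P` whose rescaling by `Y` lies in `R`. -/
def scaledPoints (R : Set (ℝ × ℝ)) (P : ℤ × ℤ → Prop) (Y : ℝ) : Set (ℤ × ℤ) :=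
  {p | P p ∧ ((p.1 : ℝ) / Y, (p.2 : ℝ) / Y) ∈ R}

theorem scaledPoints_finite {R : Set (ℝ × ℝ)} (hR : Bornology.IsBounded R) (P : ℤ × ℤ → Prop)
    {Y : ℝ} (hY : 0 < Y) : (scaledPoints R P Y).Finite := by
  apply (gridPoints_finite hR (0, 0) (h := Y⁻¹) (by positivity)).subset
  intro p hp
  have := hp.2
  simp only [gridPoints, Set.mem_ofPred_eq, zero_add]
  rwa [mul_comm, mul_comm Y⁻¹, ← div_eq_mul_inv, ← div_eq_mul_inv]

theorem tendsto_cthickening_frontier {R : Set (ℝ × ℝ)} (hR : Bornology.IsBounded R)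
    (hfr : volume (frontier R) = 0) {ι : Type*} {l : Filter ι} {h : ι → ℝ}
    (hh : Tendsto h l (𝓝 0)) :
    Tendsto (fun i => volume.real (Metric.cthickening (h i) (frontier R))) l (𝓝 0) := by
  have hb : Bornology.IsBounded (frontier R) := hR.closure.subset frontier_subset_closure
  have h1 := tendsto_measure_cthickening_of_isClosed (μ := (volume : Measure (ℝ × ℝ)))
    (s := frontier R) ⟨1, one_pos, hb.cthickening.measure_lt_top.ne⟩ isClosed_frontier
  rw [hfr] at h1
  have h2 := (ENNReal.tendsto_toReal ENNReal.zero_ne_top).comp (h1.comp hh)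
  simpa [measureReal_def, Function.comp_def] using h2

/-- Rescaled by `1/Y`, a residue class modulo `M` is a grid of mesh `M/Y` with origin `r/Y`; the
frontier has measure zero, so the error over the thickened frontier tends to zero with the mesh. -/
theorem tendsto_card_residue {R : Set (ℝ × ℝ)} (hR : Bornology.IsBounded R)
    (hfr : volume (frontier R) = 0) {M : ℕ} (hM : 0 < M) (r : ZMod M × ZMod M) :
    Tendsto (fun Y : ℝ => ((scaledPoints R (fun p => ((p.1 : ZMod M), (p.2 : ZMod M)) = r) Y).ncard
      : ℝ) / Y ^ 2) atTop (𝓝 (volume.real R / M ^ 2)) := by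
  have : NeZero M := ⟨hM.ne'⟩
  have hM' : (0 : ℝ) < M := by exact_mod_cast hM
  obtain ⟨r1, hr1⟩ := ZMod.intCast_surjective r.1
  obtain ⟨r2, hr2⟩ := ZMod.intCast_surjective r.2
  have hcard : ∀ Y : ℝ, 0 < Y →
      (scaledPoints R (fun p => ((p.1 : ZMod M), (p.2 : ZMod M)) = r) Y).ncard =
      (gridPoints R (r1 / Y, r2 / Y) (M / Y)).ncard := by
    intro Y hY
    have hinj : Function.Injective (fun k : ℤ × ℤ => (r1 + M * k.1, r2 + M * k.2)) := by
      rintro ⟨a, b⟩ ⟨c, d⟩ h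
      have hMz : (M : ℤ) ≠ 0 := by exact_mod_cast hM.ne'
      have hM0 : M ≠ 0 := hM.ne'
      simpa [hM0] using h
    rw [← Set.ncard_image_of_injective (gridPoints R (r1 / Y, r2 / Y) (M / Y)) hinj]
    congr 1
    ext ⟨a, b⟩
    constructor
    · rintro ⟨hab, hR⟩
      have h1 := congrArg Prod.fst hab
      have h2 := congrArg Prod.snd hab
      simp only at h1 h2
      rw [← hr1, eq_comm, ZMod.intCast_eq_intCast_iff_dvd_sub] at h1
      rw [← hr2, eq_comm, ZMod.intCast_eq_intCast_iff_dvd_sub] at h2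
      obtain ⟨k, hk⟩ := h1
      obtain ⟨l, hl⟩ := h2
      have e1 : a = r1 + M * k := by linarith
      have e2 : b = r2 + M * l := by linarith
      refine ⟨(k, l), ?_, Prod.ext e1.symm e2.symm⟩
      simp only [e1, e2] at hR
      push_cast at hR
      simp only [gridPoints, Set.mem_ofPred_eq]
      convert hR using 2 <;> ring
    · rintro ⟨⟨k, l⟩, hR, h⟩
      simp only [gridPoints, Set.mem_ofPred_eq] at hR
      obtain ⟨rfl, rfl⟩ := Prod.ext_iff.1 h
      refine ⟨?_, ?_⟩
      · apply Prod.ext <;> simp [hr1, hr2]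
      · push_cast
        convert hR using 2 <;> ring
  have hlim : Tendsto (fun Y : ℝ => (M : ℝ) / Y) atTop (𝓝 0) := tendsto_const_nhds.div_atTop tendsto_id
  have h0 := tendsto_cthickening_frontier hR hfr hlim
  have h1 : Tendsto (fun Y : ℝ => ((gridPoints R (r1 / Y, r2 / Y) (M / Y)).ncard : ℝ) *
      (M / Y) ^ 2) atTop (𝓝 (volume.real R)) := by
    rw [tendsto_iff_norm_sub_tendsto_zero]
    refine squeeze_zero' (Eventually.of_forall fun _ => norm_nonneg _) ?_ h0
    filter_upwards [eventually_gt_atTop 0] with Y hY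
    exact abs_gridPoints_sub_volume_le hR _ (by positivity)
  refine (h1.div_const ((M : ℝ) ^ 2)).congr' ?_
  filter_upwards [eventually_gt_atTop 0] with Y hY
  rw [hcard Y hY]
  field_simp

theorem tendsto_card_residues {R : Set (ℝ × ℝ)} (hR : Bornology.IsBounded R)
    (hfr : volume (frontier R) = 0) {M : ℕ} (hM : 0 < M) (D : Set (ZMod M × ZMod M)) :
    Tendsto (fun Y : ℝ => ((scaledPoints R (fun p => ((p.1 : ZMod M), (p.2 : ZMod M)) ∈ D) Y).ncard
      : ℝ) / Y ^ 2) atTop (𝓝 (volume.real R * (D.ncard / M ^ 2))) := by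
  classical
  have : NeZero M := ⟨hM.ne'⟩
  have hD := D.toFinite
  have h1 := tendsto_finsetSum hD.toFinset (fun r _ => tendsto_card_residue hR hfr hM r)
  have h2 : ∑ i ∈ hD.toFinset, volume.real R / (M : ℝ) ^ 2 =
      volume.real R * (D.ncard / M ^ 2) := by
    rw [Finset.sum_const, ← Set.ncard_eq_toFinset_card D hD, nsmul_eq_mul]; ring
  rw [h2] at h1
  refine h1.congr' ?_
  filter_upwards [eventually_gt_atTop 0] with Y hY
  rw [← Finset.sum_div]
  congr 1
  have hfin := scaledPoints_finite hR (fun p => ((p.1 : ZMod M), (p.2 : ZMod M)) ∈ D) hY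
  rw [Set.ncard_eq_toFinset_card _ hfin, Finset.card_eq_sum_card_fiberwise
    (f := fun p : ℤ × ℤ => ((p.1 : ZMod M), (p.2 : ZMod M))) (t := hD.toFinset)]
  · push_cast
    refine Finset.sum_congr rfl fun r hr => ?_
    rw [← Set.ncard_coe_finset]
    congr 2
    ext p
    rw [Set.Finite.mem_toFinset] at hr
    simp only [scaledPoints, Finset.coe_filter, Set.Finite.mem_toFinset, Set.mem_ofPred_eq]
    constructor
    · rintro ⟨rfl, h⟩
      exact ⟨⟨hr, h⟩, rfl⟩
    · rintro ⟨⟨_, h⟩, h'⟩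
      exact ⟨h', h⟩
  · intro p hp
    simp only [scaledPoints, Set.Finite.coe_toFinset, Set.mem_ofPred_eq] at hp ⊢
    exact hp.1


/-! ### A sieve for residue conditions modulo sixth powers of primes -/

/-- The class of `p` modulo `m`. -/
def residue (m : ℕ) (p : ℤ × ℤ) : ZMod m × ZMod m := (p.1, p.2)

/-- The density of a set of residue classes modulo `ℓ⁶`. -/
def density (D : ∀ l : ℕ, Set (ZMod (l ^ 6) × ZMod (l ^ 6))) (l : ℕ) : ℝ :=
  ((D l).ncard : ℝ) / (l : ℝ) ^ 12

theorem ncard_coprime_conditions {m n : ℕ} (h : m.Coprime n) (E : Set (ZMod m × ZMod m))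
    (F : Set (ZMod n × ZMod n)) :
    ∃ G : Set (ZMod (m * n) × ZMod (m * n)), G.ncard = E.ncard * F.ncard ∧
      ∀ p, residue (m * n) p ∈ G ↔ residue m p ∈ E ∧ residue n p ∈ F := by
  let e := ZMod.chineseRemainder h
  let f : (ZMod m × ZMod m) × (ZMod n × ZMod n) ≃ ZMod (m * n) × ZMod (m * n) :=
    (Equiv.prodProdProdComm _ _ _ _).trans (e.symm.toEquiv.prodCongr e.symm.toEquiv)
  refine ⟨f '' (E ×ˢ F), ?_, fun p => ?_⟩
  · rw [Set.ncard_image_of_injective _ f.injective, Set.ncard_prod]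
  · have : residue (m * n) p = f (residue m p, residue n p) := by
      have key : ∀ a : ℤ, (a : ZMod (m * n)) = e.symm ((a : ZMod m), (a : ZMod n)) := by
        intro a
        rw [RingEquiv.eq_symm_apply, map_intCast]
        rfl
      exact Prod.ext (key _) (key _)
    rw [this, f.injective.mem_set_image]
    rfl

/-- By the Chinese remainder theorem, finitely many local conditions are one condition modulo a
single `M`, and their densities multiply. -/
theorem exists_combined_conditions (D : ∀ l : ℕ, Set (ZMod (l ^ 6) × ZMod (l ^ 6)))
    (s : Finset Nat.Primes) :
    ∃ (M : ℕ) (_ : 0 < M) (E : Set (ZMod M × ZMod M)),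
      (E.ncard : ℝ) / (M : ℝ) ^ 2 = ∏ l ∈ s, density D l ∧
      ∀ p, residue M p ∈ E ↔ ∀ l ∈ s, residue ((l : ℕ) ^ 6) p ∈ D l := by
  suffices ∃ (E : Set (ZMod (∏ l ∈ s, (l : ℕ) ^ 6) × ZMod (∏ l ∈ s, (l : ℕ) ^ 6))),
      (E.ncard : ℝ) / ((∏ l ∈ s, (l : ℕ) ^ 6 : ℕ) : ℝ) ^ 2 = ∏ l ∈ s, density D l ∧
      ∀ p, residue _ p ∈ E ↔ ∀ l ∈ s, residue ((l : ℕ) ^ 6) p ∈ D l from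
    ⟨_, Finset.prod_pos fun l _ => pow_pos l.2.pos 6, this⟩
  induction s using Finset.cons_induction with
  | empty =>
    refine ⟨Set.univ, ?_, fun p => ⟨fun _ l hl => absurd hl (Finset.notMem_empty l),
      fun _ => Set.mem_univ _⟩⟩
    simp [Set.ncard_univ]
  | cons a s ha ih =>
    obtain ⟨E, hE, hE'⟩ := ih
    have hcop : Nat.Coprime ((a : ℕ) ^ 6) (∏ l ∈ s, (l : ℕ) ^ 6) := by
      refine Nat.Coprime.prod_right fun l hl => Nat.Coprime.pow _ _ ?_
      rw [Nat.coprime_primes a.2 l.2]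
      intro h
      exact ha (Subtype.ext h ▸ hl)
    obtain ⟨G, hG, hG'⟩ := ncard_coprime_conditions hcop (D a) E
    rw [Finset.prod_cons]
    refine ⟨G, ?_, fun p => ?_⟩
    · rw [hG, Finset.prod_cons, ← hE, density]
      push_cast
      rw [mul_pow, ← pow_mul, mul_div_mul_comm]
    · rw [hG', hE', Finset.forall_mem_cons]

/-- The count with all conditions lies between the count with the conditions at a finite set `s` and
that count minus the tail. The set `s` is taken large enough both for the partial product to be
close to the infinite one and for the tail to be at most `ε/3 · Y²`. -/
theorem tendsto_sieve {R : Set (ℝ × ℝ)} (hR : Bornology.IsBounded R)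
    (hfr : volume (frontier R) = 0) (D : ∀ l : ℕ, Set (ZMod (l ^ 6) × ZMod (l ^ 6)))
    (hmul : Multipliable fun l : Nat.Primes => density D l)
    (htail : ∀ ε > 0, ∃ s : Finset Nat.Primes, ∀ᶠ Y : ℝ in atTop,
      ((scaledPoints R (fun p => ∃ l : Nat.Primes, l ∉ s ∧ residue ((l : ℕ) ^ 6) p ∉ D l) Y).ncard
        : ℝ) ≤ ε * Y ^ 2) :
    Tendsto (fun Y : ℝ => ((scaledPoints R
      (fun p => ∀ l : Nat.Primes, residue ((l : ℕ) ^ 6) p ∈ D l) Y).ncard : ℝ) / Y ^ 2) atTop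
      (𝓝 (volume.real R * ∏' l : Nat.Primes, density D l)) := by
  classical
  rw [Metric.tendsto_nhds]
  intro ε hε
  obtain ⟨s0, hs0⟩ := htail (ε / 3) (by positivity)
  have hprod : Tendsto (fun s : Finset Nat.Primes => volume.real R * ∏ l ∈ s, density D l) atTop
      (𝓝 (volume.real R * ∏' l : Nat.Primes, density D l)) := hmul.hasProd.const_mul _
  obtain ⟨s, hs, hs'⟩ := ((Metric.tendsto_nhds.1 hprod (ε / 3) (by positivity)).and
    (eventually_ge_atTop s0)).exists
  obtain ⟨M, hM, E, hE, hE'⟩ := exists_combined_conditions D s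
  have hlim := tendsto_card_residues hR hfr hM E
  rw [hE] at hlim
  filter_upwards [Metric.tendsto_nhds.1 hlim (ε / 3) (by positivity), hs0, eventually_gt_atTop 0]
    with Y h1 h2 hY
  set N := (scaledPoints R (fun p => ∀ l : Nat.Primes, residue ((l : ℕ) ^ 6) p ∈ D l) Y).ncard
  set N' := (scaledPoints R (fun p => ((p.1 : ZMod M), (p.2 : ZMod M)) ∈ E) Y).ncard
  set T := (scaledPoints R (fun p => ∃ l : Nat.Primes, l ∉ s0 ∧ residue ((l : ℕ) ^ 6) p ∉ D l)
    Y).ncard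
  have i1 : N ≤ N' := Set.ncard_le_ncard
    (fun p hp => ⟨(hE' p).2 fun l _ => hp.1 l, hp.2⟩) (scaledPoints_finite hR _ hY)
  have i2 : N' ≤ N + T := by
    refine (Set.ncard_le_ncard (fun p hp => ?_) ((scaledPoints_finite hR _ hY).union
      (scaledPoints_finite hR _ hY))).trans (Set.ncard_union_le _ _)
    by_cases h : ∀ l : Nat.Primes, residue ((l : ℕ) ^ 6) p ∈ D l
    · exact Or.inl ⟨h, hp.2⟩
    · push Not at h
      obtain ⟨l, hl⟩ := h
      exact Or.inr ⟨⟨l, fun hl' => hl ((hE' p).1 hp.1 l (hs' hl')), hl⟩, hp.2⟩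
  have j1 : (N : ℝ) / Y ^ 2 ≤ N' / Y ^ 2 := by
    gcongr
  have j2 : (N' : ℝ) / Y ^ 2 ≤ N / Y ^ 2 + ε / 3 := by
    have i3 : (N' : ℝ) ≤ N + T := by exact_mod_cast i2
    have hY2 : 0 < Y ^ 2 := by positivity
    rw [div_add' _ _ _ hY2.ne', div_le_div_iff_of_pos_right hY2]
    linarith
  rw [Real.dist_eq, abs_lt] at *
  constructor <;> linarith [h1.1, h1.2, hs.1, hs.2]

theorem multipliable_and_tprod_pos {ι : Type*} {f : ι → ℝ} (hpos : ∀ i, 0 < f i)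
    (hsum : Summable fun i => f i - 1) : Multipliable f ∧ 0 < ∏' i, f i := by
  have h1 : Summable fun i => Real.log (f i) := by
    have := Real.summable_log_one_add_of_summable hsum
    simpa using this
  refine ⟨Real.multipliable_of_summable_log hpos h1, ?_⟩
  rw [← Real.rexp_tsum_eq_tprod hpos h1]
  exact Real.exp_pos _


/-! ### Biquadratic forms: bounding the contribution of large primes -/

/-- The form `a⁴ + m a² b² + n b⁴`. -/
def biquad {R : Type*} [CommRing R] (m n a b : R) : R := a ^ 4 + m * a ^ 2 * b ^ 2 + n * b ^ 4

/-- The derivative of the form in `a` is `2a(2a² + mb²)`. A common zero with the form is excluded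
because `C ≡ nb⁴` modulo `a`, and `4C = (2a² + mb²)² - (m² - 4n)b⁴`: the roots modulo a good prime
are simple. -/
theorem prime_not_dvd_biquad_slope {l m n a b : ℤ} (hl : Prime l)
    (hgood : ¬ l ∣ 2 * n * (m ^ 2 - 4 * n)) (hb : ¬ l ∣ b) (hC : l ∣ biquad m n a b) :
    ¬ l ∣ 2 * a ∧ ¬ l ∣ 2 * a ^ 2 + m * b ^ 2 := by
  have h2 : ¬ l ∣ 2 := fun h => hgood ((h.mul_right _).mul_right _)
  have hn : ¬ l ∣ n := fun h => hgood ((h.mul_left _).mul_right _)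
  have hd : ¬ l ∣ m ^ 2 - 4 * n := fun h => hgood (h.mul_left _)
  have hb4 : ¬ l ∣ b ^ 4 := fun h => hb (hl.dvd_of_dvd_pow h)
  constructor
  · intro h
    rcases hl.dvd_or_dvd h with h | h
    · exact h2 h
    · have : l ∣ n * b ^ 4 := by
        have e : n * b ^ 4 = biquad m n a b - a * (a ^ 3 + m * a * b ^ 2) := by
          unfold biquad; ring
        rw [e]
        exact dvd_sub hC (h.mul_right _)
      exact (hl.dvd_or_dvd this).elim hn hb4
  · intro h
    have : l ∣ (m ^ 2 - 4 * n) * b ^ 4 := by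
      have e : (m ^ 2 - 4 * n) * b ^ 4 =
          (2 * a ^ 2 + m * b ^ 2) * (2 * a ^ 2 + m * b ^ 2) - 4 * biquad m n a b := by
        unfold biquad; ring
      rw [e]
      exact dvd_sub (h.mul_right _) (hC.mul_left _)
    exact (hl.dvd_or_dvd this).elim hd hb4

/-- Uniqueness in Hensel's lemma: `C(a) - C(a')` is `a - a'` times a cofactor congruent modulo `ℓ`
to the derivative, hence prime to `ℓ`. -/
theorem dvd_sub_of_dvd_biquad {l m n a a' b : ℤ} (hl : Prime l)
    (hgood : ¬ l ∣ 2 * n * (m ^ 2 - 4 * n)) (hb : ¬ l ∣ b) {k : ℕ} (hk : k ≠ 0)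
    (h : l ^ k ∣ biquad m n a b) (h' : l ^ k ∣ biquad m n a' b) (haa : l ∣ a - a') :
    l ^ k ∣ a - a' := by
  obtain ⟨g1, g2⟩ := prime_not_dvd_biquad_slope hl hgood hb ((dvd_pow_self l hk).trans h)
  have e : biquad m n a b - biquad m n a' b =
      (a - a') * ((a + a') * (a ^ 2 + a' ^ 2 + m * b ^ 2)) := by unfold biquad; ring
  have h3 : ¬ l ∣ (a + a') * (a ^ 2 + a' ^ 2 + m * b ^ 2) := by
    intro h
    rcases hl.dvd_or_dvd h with h | h
    · apply g1
      have : 2 * a = (a + a') + (a - a') := by ring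
      rw [this]; exact dvd_add h haa
    · apply g2
      have : 2 * a ^ 2 + m * b ^ 2 = (a ^ 2 + a' ^ 2 + m * b ^ 2) + (a - a') * (a + a') := by ring
      rw [this]; exact dvd_add h (haa.mul_right _)
  have h4 := dvd_sub h h'
  rw [e] at h4
  exact (IsCoprime.pow_left ((hl.irreducible.coprime_iff_not_dvd).2 h3)).dvd_of_dvd_mul_right h4

theorem card_filter_dvd_sub_le (N : ℕ) {r : ℕ} (hr : 0 < r) (v : ℤ) :
    ((((Finset.Icc (-N : ℤ) N).filter fun a => (r : ℤ) ∣ a - v).card : ℕ) : ℝ) ≤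
      2 * N / r + 1 := by
  have hr' : (0 : ℤ) < r := by exact_mod_cast hr
  have hr'' : (0 : ℝ) < r := by exact_mod_cast hr
  have h1 := Int.Ioc_filter_modEq_card (-N - 1 : ℤ) N hr' v
  have h2 : ((Finset.Icc (-N : ℤ) N).filter fun a => (r : ℤ) ∣ a - v) =
      (Finset.Ioc (-N - 1 : ℤ) N).filter fun a => a ≡ v [ZMOD r] := by
    ext a
    simp only [Finset.mem_filter, Finset.mem_Icc, Finset.mem_Ioc]
    rw [Int.modEq_comm, Int.modEq_iff_dvd]
    constructor <;> rintro ⟨⟨_, _⟩, h⟩ <;> exact ⟨⟨by omega, by omega⟩, h⟩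
  rw [h2]
  have h3 : ((((Finset.Ioc (-N - 1 : ℤ) N).filter fun a => a ≡ v [ZMOD r]).card : ℤ) : ℝ) ≤
      2 * N / r + 1 := by
    rw [h1]
    have key : ⌊((N : ℤ) - v : ℚ) / r⌋ - ⌊((-N - 1 : ℤ) - v : ℚ) / (r : ℤ)⌋ ≤
        (2 * N / r + 1 : ℝ) := by
      have hN : (((N : ℤ) - v) / (r : ℤ) - ((-N - 1 : ℤ) - v) / (r : ℤ) : ℤ) ≤
          (2 * N / r + 1 : ℝ) := by
        have e1 := Int.mul_ediv_add_emod ((N : ℤ) - v) r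
        have e2 := Int.mul_ediv_add_emod ((-N - 1 : ℤ) - v) r
        have m1 := Int.emod_nonneg ((N : ℤ) - v) hr'.ne'
        have m2 := Int.emod_lt_of_pos ((-N - 1 : ℤ) - v) hr'
        rw [div_add_one hr''.ne', le_div_iff₀ hr'']
        have : (((N : ℤ) - v) / r - ((-N - 1 : ℤ) - v) / r) * r ≤ 2 * N + (r : ℤ) := by
          rw [sub_mul]; nlinarith
        exact_mod_cast this
      have f1 : ⌊((N : ℤ) - v : ℚ) / r⌋ = ((N : ℤ) - v : ℤ) / (r : ℤ) := by
        have := Rat.floor_intCast_div_natCast ((N : ℤ) - v) r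
        push_cast at this ⊢
        exact this
      have f2 : ⌊((-N - 1 : ℤ) - v : ℚ) / (r : ℤ)⌋ = ((-N - 1 : ℤ) - v : ℤ) / (r : ℤ) := by
        have := Rat.floor_intCast_div_natCast ((-N - 1 : ℤ) - v) r
        push_cast at this ⊢
        exact this
      rw [f1, f2, ← Int.cast_sub]; exact hN
    rw [Int.cast_max]
    refine max_le ?_ (by push_cast; positivity)
    push_cast at key ⊢
    exact key
  exact_mod_cast h3

/-- There are at most four roots modulo `ℓ`, and the solutions modulo `ℓ⁴` above each of them form
at most one class. -/
theorem card_biquad_roots_le (m n b : ℤ) {l : ℕ} (hl : l.Prime) (N : ℕ)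
    (hgood : ¬ (l : ℤ) ∣ 2 * n * (m ^ 2 - 4 * n)) (hb : ¬ (l : ℤ) ∣ b) :
    ((((Finset.Icc (-N : ℤ) N).filter fun a => (l : ℤ) ^ 4 ∣ biquad m n a b).card : ℕ) : ℝ) ≤
      4 * (2 * N / (l : ℝ) ^ 4 + 1) := by
  classical
  have : Fact l.Prime := ⟨hl⟩
  set T := (Finset.Icc (-N : ℤ) N).filter fun a => (l : ℤ) ^ 4 ∣ biquad m n a b with hT
  have hl4 : 0 < l ^ 4 := pow_pos hl.pos 4
  let P : Polynomial (ZMod l) := Polynomial.X ^ 4 + Polynomial.C ((m * b ^ 2 : ℤ) : ZMod l) *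
    Polynomial.X ^ 2 + Polynomial.C ((n * b ^ 4 : ℤ) : ZMod l)
  have hPdeg : P.natDegree = 4 := by
    simp only [P]; compute_degree!
  have hP0 : P ≠ 0 := by
    intro h; rw [h] at hPdeg; simp at hPdeg
  have himg : (T.image fun a : ℤ => (a : ZMod l)) ⊆ P.roots.toFinset := by
    intro x hx
    obtain ⟨a, ha, rfl⟩ := Finset.mem_image.1 hx
    rw [Multiset.mem_toFinset, Polynomial.mem_roots hP0, Polynomial.IsRoot]
    have h1 : (l : ℤ) ∣ biquad m n a b :=
      (dvd_pow_self _ four_ne_zero).trans (Finset.mem_filter.1 ha).2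
    rw [← ZMod.intCast_zmod_eq_zero_iff_dvd] at h1
    simp only [P, biquad] at h1 ⊢
    push_cast at h1
    simp
    rw [← h1]; ring
  have hcard : (T.image fun a : ℤ => (a : ZMod l)).card ≤ 4 := by
    calc _ ≤ P.roots.toFinset.card := Finset.card_le_card himg
      _ ≤ P.roots.card := Multiset.toFinset_card_le _
      _ ≤ P.natDegree := P.card_roots'
      _ = 4 := hPdeg
  have hfib : ∀ x ∈ T.image fun a : ℤ => (a : ZMod l),
      (((T.filter fun a : ℤ => (a : ZMod l) = x).card : ℕ) : ℝ) ≤ 2 * N / (l : ℝ) ^ 4 + 1 := by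
    intro x hx
    obtain ⟨v, hv, rfl⟩ := Finset.mem_image.1 hx
    have h1 := card_filter_dvd_sub_le N hl4 v
    push_cast at h1
    refine le_trans ?_ h1
    norm_cast
    refine Finset.card_le_card fun a ha => ?_
    obtain ⟨ha1, ha2⟩ := Finset.mem_filter.1 ha
    obtain ⟨ha3, ha4⟩ := Finset.mem_filter.1 ha1
    refine Finset.mem_filter.2 ⟨ha3, ?_⟩
    push_cast
    refine dvd_sub_of_dvd_biquad (Nat.prime_iff_prime_int.1 hl) hgood hb four_ne_zero ha4
      (Finset.mem_filter.1 hv).2 ?_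
    rw [eq_comm, ZMod.intCast_eq_intCast_iff_dvd_sub] at ha2
    exact ha2
  rw [Finset.card_eq_sum_card_image (fun a : ℤ => (a : ZMod l)) T]
  push_cast
  refine (Finset.sum_le_sum hfib).trans ?_
  rw [Finset.sum_const, nsmul_eq_mul]
  have : ((T.image fun a : ℤ => (a : ZMod l)).card : ℝ) ≤ 4 := by exact_mod_cast hcard
  gcongr


/-! ### The tail estimate over large primes. -/

theorem eventually_primeCounting_le_mul {η : ℝ} (hη : 0 < η) :
    ∀ᶠ x : ℝ in atTop, (Nat.primeCounting ⌊x⌋₊ : ℝ) ≤ η * x := by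
  filter_upwards [Chebyshev.eventually_primeCounting_le one_pos,
    Real.tendsto_log_atTop.eventually_ge_atTop ((Real.log 4 + 1) / η), eventually_gt_atTop 1]
    with x h1 h2 h3
  refine h1.trans ?_
  have hlog : 0 < Real.log x := Real.log_pos h3
  rw [div_le_iff₀ hη] at h2
  rw [div_le_iff₀ hlog]
  nlinarith

/-- The pairs `(a, b)` with `|a| ≤ N` and `1 ≤ b ≤ N`. -/
def box (N : ℕ) : Finset (ℤ × ℤ) := Finset.Icc (-N : ℤ) N ×ˢ Finset.Icc (1 : ℤ) N

-- The summand `9N` does not decay with `ℓ`; it is the rounding error of one progression for each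
-- `b`, and is affordable only because few primes occur.
open Classical in
theorem card_bad_at_prime_le (m n : ℤ) {l : ℕ} (hl : l.Prime) {N : ℕ} (hN : 0 < N)
    (hgood : ¬ (l : ℤ) ∣ 2 * n * (m ^ 2 - 4 * n)) :
    ((((box N).filter fun p => ((l : ℤ) ∣ p.1 ∧ (l : ℤ) ∣ p.2) ∨
      (¬ (l : ℤ) ∣ p.2 ∧ (l : ℤ) ^ 4 ∣ biquad m n p.1 p.2)).card : ℕ) : ℝ) ≤
      12 * N ^ 2 * (1 / (l : ℝ) ^ 2) + 9 * N := by
  have hN1 : (1 : ℝ) ≤ N := by exact_mod_cast hN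
  have hl1 : (1 : ℝ) ≤ l := by exact_mod_cast hl.one_lt.le
  have h1 : ((((box N).filter fun p => (l : ℤ) ∣ p.1 ∧ (l : ℤ) ∣ p.2).card : ℕ) : ℝ) ≤
      (2 * N / l + 1) * (2 * N / l + 1) := by
    have e := card_filter_dvd_sub_le N hl.pos 0
    simp only [sub_zero] at e
    refine le_trans ?_ (mul_le_mul e e (by positivity) (by positivity))
    rw [← Nat.cast_mul, ← Finset.card_product]
    norm_cast
    refine Finset.card_le_card fun p hp => ?_
    simp only [box, Finset.mem_filter, Finset.mem_product, Finset.mem_Icc] at hp ⊢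
    exact ⟨⟨hp.1.1, hp.2.1⟩, ⟨by omega, by omega⟩, hp.2.2⟩
  have h2 : ((((box N).filter fun p => ¬ (l : ℤ) ∣ p.2 ∧
      (l : ℤ) ^ 4 ∣ biquad m n p.1 p.2).card : ℕ) : ℝ) ≤ N * (4 * (2 * N / (l : ℝ) ^ 4 + 1)) := by
    rw [Finset.card_eq_sum_card_fiberwise (f := Prod.snd) (t := Finset.Icc (1 : ℤ) N)]
    · push_cast
      have hc : ((Finset.Icc (1 : ℤ) N).card : ℝ) = N := by simp
      rw [← hc, ← nsmul_eq_mul, ← Finset.sum_const]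
      rw [hc]
      refine Finset.sum_le_sum fun b _ => ?_
      by_cases hb : (l : ℤ) ∣ b
      · rw [Finset.card_eq_zero.2]
        · push_cast; positivity
        · rw [Finset.filter_eq_empty_iff]
          rintro p hp rfl
          exact (Finset.mem_filter.1 hp).2.1 hb
      · refine le_trans ?_ (card_biquad_roots_le m n b hl N hgood hb)
        norm_cast
        refine Finset.card_le_card_of_injOn Prod.fst ?_ ?_
        · intro p hp
          simp only [box, Finset.coe_filter, Finset.mem_filter, Finset.mem_product,
            Set.mem_ofPred_eq] at hp ⊢
          obtain ⟨⟨hp1, hp2⟩, rfl⟩ := hp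
          exact ⟨hp1.1, by exact_mod_cast hp2.2⟩
        · intro p hp q hq h
          have hp' := (Finset.mem_filter.1 (Finset.mem_coe.1 hp)).2
          have hq' := (Finset.mem_filter.1 (Finset.mem_coe.1 hq)).2
          exact Prod.ext h (hp'.trans hq'.symm)
    · intro p hp
      simp only [box, Finset.coe_filter, Finset.mem_product, Set.mem_ofPred_eq] at hp
      exact hp.1.2
  rw [Finset.filter_or]
  have h3 : (((box N).filter fun p => (l : ℤ) ∣ p.1 ∧ (l : ℤ) ∣ p.2).card +
      ((box N).filter fun p => ¬ (l : ℤ) ∣ p.2 ∧ (l : ℤ) ^ 4 ∣ biquad m n p.1 p.2).card : ℝ) ≤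
      12 * N ^ 2 * (1 / (l : ℝ) ^ 2) + 9 * N := by
    refine (add_le_add h1 h2).trans ?_
    have e1 : (N : ℝ) / l ≤ N := div_le_self (by positivity) hl1
    have e2 : (N : ℝ) * N / (l : ℝ) ^ 4 ≤ N * N / (l : ℝ) ^ 2 := by
      gcongr
      all_goals first | exact hl1 | norm_num
    have e3 : (2 * N / l + 1 : ℝ) * (2 * N / l + 1) =
        4 * (N * N / (l : ℝ) ^ 2) + 4 * (N / l) + 1 := by
      field_simp; ring
    have e4 : (N : ℝ) * (4 * (2 * N / (l : ℝ) ^ 4 + 1)) = 8 * (N * N / (l : ℝ) ^ 4) + 4 * N := by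
      ring
    have e5 : 12 * N ^ 2 * (1 / (l : ℝ) ^ 2) = 12 * (N * N / (l : ℝ) ^ 2) := by ring
    rw [e3, e4, e5]
    linarith
  refine le_trans ?_ h3
  exact_mod_cast Finset.card_union_le _ _

/-- The value of the form is positive, of size at most `((1 + m + n)N)⁴`, and divisible by `ℓ⁴`. The
equality of the degree of the form with the exponent of `ℓ` is what keeps `ℓ` linear in `N`. -/
theorem le_of_bad {m n : ℤ} (hm : 0 ≤ m) (hn : 0 < n) {l N : ℕ} {p : ℤ × ℤ}
    (hp : p ∈ box N) (h : ((l : ℤ) ∣ p.1 ∧ (l : ℤ) ∣ p.2) ∨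
      (¬ (l : ℤ) ∣ p.2 ∧ (l : ℤ) ^ 4 ∣ biquad m n p.1 p.2)) :
    (l : ℤ) ≤ (1 + m + n) * N := by
  simp only [box, Finset.mem_product, Finset.mem_Icc] at hp
  obtain ⟨⟨h1, h2⟩, h3, h4⟩ := hp
  have hN : (0 : ℤ) ≤ N := by positivity
  rcases h with ⟨_, h⟩ | ⟨_, h⟩
  · have := Int.le_of_dvd (by omega) h
    nlinarith
  · have a2 : p.1 ^ 2 ≤ (N : ℤ) ^ 2 := sq_le_sq' h1 h2
    have b2 : p.2 ^ 2 ≤ (N : ℤ) ^ 2 := sq_le_sq' (by omega) h4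
    have b0 : 0 < p.2 ^ 2 := by positivity
    have hpos : 0 < biquad m n p.1 p.2 := by
      have : 0 < n * p.2 ^ 4 := by positivity
      unfold biquad; positivity
    have hle : biquad m n p.1 p.2 ≤ ((1 + m + n) * N) ^ 4 := by
      have c1 : p.1 ^ 2 * p.1 ^ 2 ≤ (N : ℤ) ^ 2 * N ^ 2 := by gcongr
      have c2 : p.1 ^ 2 * p.2 ^ 2 ≤ (N : ℤ) ^ 2 * N ^ 2 := by gcongr
      have c3 : p.2 ^ 2 * p.2 ^ 2 ≤ (N : ℤ) ^ 2 * N ^ 2 := by gcongr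
      have hW : (1 + m + n) ≤ (1 + m + n) ^ 4 := le_self_pow₀ (by omega) (by norm_num)
      calc biquad m n p.1 p.2 = p.1 ^ 2 * p.1 ^ 2 + m * (p.1 ^ 2 * p.2 ^ 2) +
            n * (p.2 ^ 2 * p.2 ^ 2) := by unfold biquad; ring
        _ ≤ (N : ℤ) ^ 2 * N ^ 2 + m * ((N : ℤ) ^ 2 * N ^ 2) + n * ((N : ℤ) ^ 2 * N ^ 2) := by
            gcongr
        _ = (1 + m + n) * N ^ 4 := by ring
        _ ≤ (1 + m + n) ^ 4 * N ^ 4 := by gcongr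
        _ = _ := by ring
    have h5 := (Int.le_of_dvd hpos h).trans hle
    exact le_of_pow_le_pow_left₀ four_ne_zero (by positivity) h5

theorem summable_one_div_prime_sq : Summable fun l : Nat.Primes => 1 / ((l : ℕ) : ℝ) ^ 2 := by
  have := (Real.summable_one_div_nat_pow (p := 2)).2 (by norm_num)
  exact this.comp_injective Nat.Primes.coe_nat_injective

/-- The primes up to `X`. -/
def primesUpTo (X : ℕ) : Finset Nat.Primes := Finset.subtype Nat.Prime (Finset.range (X + 1))

theorem mem_primesUpTo {X : ℕ} {l : Nat.Primes} : l ∈ primesUpTo X ↔ (l : ℕ) ≤ X :=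
  Finset.mem_subtype.trans (Finset.mem_range.trans Nat.lt_succ_iff)

theorem card_primesUpTo (X : ℕ) : (primesUpTo X).card = Nat.primeCounting X := by
  refine (Finset.card_subtype Nat.Prime (Finset.range (X + 1))).trans ?_
  rw [Nat.primeCounting, Nat.primeCounting', Nat.count_eq_card_filter_range]

theorem tail_bound {m n : ℤ} (hm : 0 ≤ m) (hn : 0 < n) {R : Set (ℝ × ℝ)}
    (hR : Bornology.IsBounded R) (hRpos : ∀ p ∈ R, 0 < p.2)
    (D : ∀ l : ℕ, Set (ZMod (l ^ 6) × ZMod (l ^ 6))) (s0 : Finset Nat.Primes)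
    (hgood : ∀ l : Nat.Primes, l ∉ s0 → ¬ ((l : ℕ) : ℤ) ∣ 2 * n * (m ^ 2 - 4 * n))
    (hbad : ∀ l : Nat.Primes, l ∉ s0 → ∀ p : ℤ × ℤ, residue ((l : ℕ) ^ 6) p ∉ D l →
      (((l : ℕ) : ℤ) ∣ p.1 ∧ ((l : ℕ) : ℤ) ∣ p.2) ∨
      (¬ ((l : ℕ) : ℤ) ∣ p.2 ∧ ((l : ℕ) : ℤ) ^ 4 ∣ biquad m n p.1 p.2)) :
    ∀ ε > 0, ∃ s : Finset Nat.Primes, ∀ᶠ Y : ℝ in atTop,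
      ((scaledPoints R (fun p => ∃ l : Nat.Primes, l ∉ s ∧ residue ((l : ℕ) ^ 6) p ∉ D l) Y).ncard
        : ℝ) ≤ ε * Y ^ 2 := by
  classical
  intro ε hε
  obtain ⟨K, hK1, hK⟩ : ∃ K : ℝ, 1 ≤ K ∧ ∀ p ∈ R, |p.1| ≤ K ∧ |p.2| ≤ K := by
    obtain ⟨K, hK⟩ := hR.subset_closedBall 0
    refine ⟨max K 1, le_max_right _ _, fun p hp => ?_⟩
    have := hK hp
    rw [Metric.mem_closedBall, Prod.dist_eq, Real.dist_eq, Real.dist_eq] at this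
    simp only [Prod.fst_zero, sub_zero, Prod.snd_zero] at this
    exact ⟨((le_max_left _ _).trans this).trans (le_max_left _ _),
      ((le_max_right _ _).trans this).trans (le_max_left _ _)⟩
  obtain ⟨W, hW⟩ := Int.eq_ofNat_of_zero_le (show 0 ≤ 1 + m + n by omega)
  have hW1 : (1 : ℝ) ≤ W := by
    have : (1 : ℤ) ≤ W := by omega
    exact_mod_cast this
  -- The constants 24 here and 18 below make the two parts of the bound, `12 N² Σ ℓ⁻²` and `9N`
  -- times the number of primes, each at most `ε Y²/2` when `N ≤ KY`.
  obtain ⟨s1, hs1⟩ := summable_iff_vanishing_norm.1 summable_one_div_prime_sq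
    (ε / (24 * K ^ 2)) (by positivity)
  refine ⟨s0 ∪ s1, ?_⟩
  have hpi := (eventually_primeCounting_le_mul (η := ε / (18 * K ^ 2 * W)) (by positivity))
  have hpi' := (tendsto_id.const_mul_atTop (show 0 < W * K by positivity)).eventually hpi
  filter_upwards [hpi', eventually_ge_atTop 1] with Y hpiY hY
  have hY0 : 0 < Y := by linarith
  have hKY : 1 ≤ K * Y := by nlinarith
  set N := ⌊K * Y⌋₊ with hNdef
  have hN0 : 0 < N := Nat.floor_pos.2 hKY
  have hNle : (N : ℝ) ≤ K * Y := Nat.floor_le (by linarith)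
  set X := W * N with hX
  let I : Finset Nat.Primes := primesUpTo X \ (s0 ∪ s1)
  have hIcard : (I.card : ℝ) ≤ Nat.primeCounting X := by
    norm_cast
    exact (Finset.card_le_card Finset.sdiff_subset).trans (card_primesUpTo X).le
  let bad : Nat.Primes → Finset (ℤ × ℤ) := fun l =>
    (box N).filter fun p => (((l : ℕ) : ℤ) ∣ p.1 ∧ ((l : ℕ) : ℤ) ∣ p.2) ∨
      (¬ ((l : ℕ) : ℤ) ∣ p.2 ∧ ((l : ℕ) : ℤ) ^ 4 ∣ biquad m n p.1 p.2)
  have hcover : scaledPoints R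
      (fun p => ∃ l : Nat.Primes, l ∉ s0 ∪ s1 ∧ residue ((l : ℕ) ^ 6) p ∉ D l) Y ⊆
      (I.biUnion bad : Finset (ℤ × ℤ)) := by
    rintro p ⟨⟨l, hl, hlD⟩, hpR⟩
    have hbox : p ∈ box N := by
      have hk := hK _ hpR
      have hp := hRpos _ hpR
      simp only at hk hp
      have hp2 : 0 < (p.2 : ℝ) := by
        by_contra! h
        exact absurd hp (not_lt.2 (div_nonpos_of_nonpos_of_nonneg h hY0.le))
      have key : ∀ z : ℤ, |(z : ℝ) / Y| ≤ K → |z| ≤ (N : ℤ) := by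
        intro z hz
        rw [abs_div, abs_of_pos hY0, div_le_iff₀ hY0] at hz
        have hz' : ((z.natAbs : ℕ) : ℝ) ≤ K * Y := by
          rw [Nat.cast_natAbs]; push_cast; exact hz
        have := Nat.le_floor hz'
        rw [Int.abs_eq_natAbs]
        exact_mod_cast this
      have k1 := abs_le.1 (key _ hk.1)
      have k2 := abs_le.1 (key _ hk.2)
      have k3 : 0 < p.2 := by exact_mod_cast hp2
      simp only [box, Finset.mem_product, Finset.mem_Icc]
      exact ⟨k1, by omega, k2.2⟩
    have hb := hbad l (fun h => hl (Finset.mem_union_left _ h)) p hlD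
    have hle := le_of_bad hm hn hbox hb
    rw [hW] at hle
    rw [Finset.mem_coe, Finset.mem_biUnion]
    refine ⟨l, ?_, Finset.mem_filter.2 ⟨hbox, hb⟩⟩
    exact Finset.mem_sdiff.2 ⟨mem_primesUpTo.2 (by exact_mod_cast hle), hl⟩
  have hsum : ∑ l ∈ I, 1 / ((l : ℕ) : ℝ) ^ 2 ≤ ε / (24 * K ^ 2) := by
    have := hs1 I (Finset.disjoint_left.2 fun l hl hl' =>
      (Finset.mem_sdiff.1 hl).2 (Finset.mem_union_right _ hl'))
    exact (le_abs_self _).trans this.le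
  calc ((scaledPoints R (fun p => ∃ l : Nat.Primes, l ∉ s0 ∪ s1 ∧
        residue ((l : ℕ) ^ 6) p ∉ D l) Y).ncard : ℝ)
      ≤ ((I.biUnion bad).card : ℝ) := by
        rw [← Set.ncard_coe_finset]
        exact_mod_cast Set.ncard_le_ncard hcover (Finset.finite_toSet _)
    _ ≤ ∑ l ∈ I, ((bad l).card : ℝ) := by exact_mod_cast Finset.card_biUnion_le
    _ ≤ ∑ l ∈ I, (12 * N ^ 2 * (1 / ((l : ℕ) : ℝ) ^ 2) + 9 * N) := by
        refine Finset.sum_le_sum fun l hl => card_bad_at_prime_le m n l.2 hN0 (hgood l fun h => ?_)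
        exact (Finset.mem_sdiff.1 hl).2 (Finset.mem_union_left _ h)
    _ = 12 * N ^ 2 * ∑ l ∈ I, 1 / ((l : ℕ) : ℝ) ^ 2 + 9 * N * I.card := by
        rw [Finset.sum_add_distrib, ← Finset.mul_sum, Finset.sum_const, nsmul_eq_mul]; ring
    _ ≤ 12 * (K * Y) ^ 2 * (ε / (24 * K ^ 2)) +
        9 * (K * Y) * (ε / (18 * K ^ 2 * W) * (W * K * Y)) := by
        have hpiX : (I.card : ℝ) ≤ ε / (18 * K ^ 2 * W) * (W * K * Y) := by
          refine hIcard.trans (le_trans ?_ hpiY)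
          norm_cast
          refine Nat.monotone_primeCounting (Nat.le_floor ?_)
          rw [hX]; push_cast
          simp only [id]
          rw [mul_assoc]
          gcongr
        gcongr
    _ = ε * Y ^ 2 := by
        field_simp; ring


/-! ### Local densities -/

/-- The case `k = j` is included: there `ℓ^j` is zero in the ring and divisibility means vanishing.
It is needed for the condition `ℓ⁶ ∣ B`. -/
theorem pow_dvd_intCast_zmod {l k j : ℕ} (hk : k ≤ j) (x : ℤ) :
    ((l : ZMod (l ^ j)) ^ k ∣ (x : ZMod (l ^ j))) ↔ (l : ℤ) ^ k ∣ x := by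
  constructor
  · rintro ⟨y, hy⟩
    obtain ⟨y, rfl⟩ := ZMod.intCast_surjective y
    have h1 : ((l : ℤ) ^ k * y : ℤ) = (x : ZMod (l ^ j)) := by push_cast; exact hy.symm
    rw [ZMod.intCast_eq_intCast_iff_dvd_sub] at h1
    push_cast at h1
    have h2 := (pow_dvd_pow (l : ℤ) hk).trans h1
    exact (dvd_sub_left (dvd_mul_right _ _)).1 h2
  · rintro ⟨y, rfl⟩
    push_cast
    exact dvd_mul_right _ _

theorem dvd_intCast_zmod {l j : ℕ} (hj : 1 ≤ j) (x : ℤ) :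
    ((l : ZMod (l ^ j)) ∣ (x : ZMod (l ^ j))) ↔ (l : ℤ) ∣ x := by
  simpa using pow_dvd_intCast_zmod (l := l) hj x

theorem intCast_biquad {R : Type*} [CommRing R] (m n a b : ℤ) :
    ((biquad m n a b : ℤ) : R) = biquad (m : R) n a b := by
  unfold biquad; push_cast; rfl

theorem isUnit_zmod_prime_pow {l j : ℕ} (hl : l.Prime) (hj : 1 ≤ j) (b : ZMod (l ^ j)) :
    IsUnit b ↔ ¬ (l : ZMod (l ^ j)) ∣ b := by
  have : NeZero (l ^ j) := ⟨(pow_pos hl.pos j).ne'⟩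
  obtain ⟨b, rfl⟩ := ZMod.natCast_zmod_surjective b
  rw [ZMod.isUnit_iff_coprime, Nat.coprime_pow_right_iff (by omega), Nat.coprime_comm,
    hl.coprime_iff_not_dvd]
  have := dvd_intCast_zmod (l := l) hj b
  rw [Int.cast_natCast] at this
  rw [this, Int.natCast_dvd_natCast]

/-- All fibres of the reduction map are translates of one another, so each has `n` elements. -/
theorem ncard_preimage_zmod {m n : ℕ} (hn : 0 < n) (hm : 0 < m) (S : Set (ZMod m)) :
    (ZMod.castHom (dvd_mul_right m n) (ZMod m) ⁻¹' S).ncard = n * S.ncard := by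
  classical
  have : NeZero m := ⟨hm.ne'⟩
  have : NeZero (m * n) := ⟨(Nat.mul_pos hm hn).ne'⟩
  set f := ZMod.castHom (dvd_mul_right m n) (ZMod m) with hf
  have hsurj : Function.Surjective f := ZMod.castHom_surjective _
  have hfib : ∀ x y, (Finset.univ.filter fun a => f a = x).card =
      (Finset.univ.filter fun a => f a = y).card := by
    intro x y
    obtain ⟨c, hc⟩ := hsurj (y - x)
    refine Finset.card_bij (fun a _ => a + c) ?_ ?_ ?_
    · intro a ha
      simp only [Finset.mem_filter, Finset.mem_univ, true_and] at ha ⊢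
      rw [map_add, ha, hc]; ring
    · intro a _ b _ h
      exact add_right_cancel h
    · intro b hb
      simp only [Finset.mem_filter, Finset.mem_univ, true_and] at hb
      refine ⟨b - c, ?_, by ring⟩
      simp only [Finset.mem_filter, Finset.mem_univ, true_and]
      rw [map_sub, hb, hc]; ring
  have htot : m * n = ∑ x : ZMod m, (Finset.univ.filter fun a => f a = x).card := by
    rw [← Finset.card_eq_sum_card_fiberwise (fun _ _ => by simp), Finset.card_univ, ZMod.card]
  have hconst : ∀ x, (Finset.univ.filter fun a => f a = x).card = n := by
    intro x
    rw [Finset.sum_congr rfl fun y _ => hfib y x, Finset.sum_const, Finset.card_univ, ZMod.card,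
      smul_eq_mul] at htot
    exact (Nat.eq_of_mul_eq_mul_left hm htot).symm
  have hfin : (f ⁻¹' S).Finite := Set.toFinite _
  rw [Set.ncard_eq_toFinset_card _ hfin, Finset.card_eq_sum_card_fiberwise (f := f)
    (t := S.toFinite.toFinset)]
  · rw [Finset.sum_congr rfl (g := fun _ => n), Finset.sum_const, smul_eq_mul,
      ← Set.ncard_eq_toFinset_card, mul_comm]
    intro x hx
    refine (congrArg Finset.card ?_).trans (hconst x)
    ext a
    rw [Set.Finite.mem_toFinset] at hx
    simp only [Finset.mem_filter, Set.Finite.mem_toFinset, Finset.mem_univ, true_and,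
      Set.mem_preimage, and_iff_right_iff_imp]
    rintro rfl
    exact hx
  · intro a ha
    simpa using ha

theorem ncard_preimage_zmod_pow {l k : ℕ} (hl : 0 < l) (hk : k ≤ 6) (S : Set (ZMod (l ^ k))) :
    {x : ZMod (l ^ 6) | (ZMod.cast x : ZMod (l ^ k)) ∈ S}.ncard = l ^ (6 - k) * S.ncard := by
  have h6 : l ^ 6 = l ^ k * l ^ (6 - k) := by rw [← pow_add]; congr 1; omega
  have := ncard_preimage_zmod (m := l ^ k) (n := l ^ (6 - k)) (pow_pos hl _) (pow_pos hl _) S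
  rw [← this, h6]
  rfl

theorem exists_lift_biquad_root {l m n t : ℤ} (hl : Prime l)
    (hgood : ¬ l ∣ 2 * n * (m ^ 2 - 4 * n)) (h : l ∣ biquad m n t 1) (k : ℕ) :
    ∃ s, l ∣ s - t ∧ l ^ (k + 1) ∣ biquad m n s 1 := by
  induction k with
  | zero => exact ⟨t, by simp, by simpa using h⟩
  | succ k ih =>
    obtain ⟨s, hs, c, hc⟩ := ih
    obtain ⟨g1, g2⟩ := prime_not_dvd_biquad_slope hl hgood (b := 1)
      (fun h => hl.not_isUnit (isUnit_of_dvd_one h)) ((dvd_pow_self l (Nat.succ_ne_zero k)).trans ⟨c, hc⟩)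
    have g3 : ¬ l ∣ 2 * s * (2 * s ^ 2 + m * 1 ^ 2) := fun h =>
      (hl.dvd_or_dvd h).elim g1 g2
    obtain ⟨u, w, huw⟩ := (hl.irreducible.coprime_iff_not_dvd).2 g3
    -- A Newton step: `w` inverts the derivative modulo `ℓ` and `c` is the value of the form at `s`
    -- divided by `ℓ^(k+1)`.
    refine ⟨s - l ^ (k + 1) * (w * c), ?_, ?_⟩
    · have : s - l ^ (k + 1) * (w * c) - t = (s - t) - l * (l ^ k * (w * c)) := by ring
      rw [this]
      exact dvd_sub hs (dvd_mul_right _ _)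
    · set x := w * c with hx
      set L := l ^ (k + 1) with hL
      have e1 : biquad m n (s - L * x) 1 = biquad m n s 1 - L * x * (2 * s * (2 * s ^ 2 + m * 1 ^ 2))
          + L * L * (x ^ 2 * (6 * s ^ 2 + m) - 4 * s * x ^ 3 * L + x ^ 4 * L ^ 2) := by
        unfold biquad; ring
      have e2 : biquad m n s 1 - L * x * (2 * s * (2 * s ^ 2 + m * 1 ^ 2)) = L * l * (u * c) := by
        rw [hc]
        linear_combination (-L * c) * huw
      have e3 : l ^ (k + 1 + 1) = L * l := by rw [hL]; ring
      rw [e1, e2, e3]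
      refine dvd_add (dvd_mul_right _ _) (Dvd.dvd.mul_right ?_ _)
      exact mul_dvd_mul_left _ (dvd_pow_self l (Nat.succ_ne_zero k))

theorem ncard_biquad_roots_prime_pow {l : ℕ} (hl : l.Prime) {m n : ℤ}
    (hgood : ¬ (l : ℤ) ∣ 2 * n * (m ^ 2 - 4 * n)) :
    {t : ZMod (l ^ 4) | biquad (m : ZMod (l ^ 4)) n t 1 = 0}.ncard =
      {t : ZMod l | biquad (m : ZMod l) n t 1 = 0}.ncard := by
  have hlz : Prime (l : ℤ) := Nat.prime_iff_prime_int.1 hl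
  have : NeZero l := ⟨hl.ne_zero⟩
  have : NeZero (l ^ 4) := ⟨pow_ne_zero 4 hl.ne_zero⟩
  have hzero4 : ∀ a : ℤ, biquad (m : ZMod (l ^ 4)) n (a : ZMod (l ^ 4)) 1 = 0 ↔
      (l : ℤ) ^ 4 ∣ biquad m n a 1 := by
    intro a
    have := ZMod.intCast_zmod_eq_zero_iff_dvd (biquad m n a 1) (l ^ 4)
    rw [intCast_biquad] at this
    push_cast at this
    exact this
  have hzero1 : ∀ a : ℤ, biquad (m : ZMod l) n (a : ZMod l) 1 = 0 ↔ (l : ℤ) ∣ biquad m n a 1 := by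
    intro a
    have := ZMod.intCast_zmod_eq_zero_iff_dvd (biquad m n a 1) l
    rw [intCast_biquad] at this
    push_cast at this
    exact this
  have hb1 : ¬ (l : ℤ) ∣ 1 := fun h => hlz.not_isUnit (isUnit_of_dvd_one h)
  let f := ZMod.castHom (dvd_pow_self l four_ne_zero) (ZMod l)
  refine Set.ncard_congr (fun t _ => f t) ?_ ?_ ?_
  · intro t ht
    obtain ⟨a, rfl⟩ := ZMod.intCast_surjective t
    rw [Set.mem_ofPred_eq, hzero4] at ht
    rw [Set.mem_ofPred_eq, map_intCast, hzero1]
    exact (dvd_pow_self _ four_ne_zero).trans ht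
  · intro s t hs ht hst
    obtain ⟨a, rfl⟩ := ZMod.intCast_surjective s
    obtain ⟨b, rfl⟩ := ZMod.intCast_surjective t
    rw [Set.mem_ofPred_eq, hzero4] at hs ht
    rw [map_intCast, map_intCast, eq_comm, ZMod.intCast_eq_intCast_iff_dvd_sub] at hst
    rw [eq_comm, ZMod.intCast_eq_intCast_iff_dvd_sub]
    push_cast
    exact dvd_sub_of_dvd_biquad hlz hgood hb1 four_ne_zero hs ht hst
  · intro t ht
    obtain ⟨a, rfl⟩ := ZMod.intCast_surjective t
    rw [Set.mem_ofPred_eq, hzero1] at ht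
    obtain ⟨s, hs, hs'⟩ := exists_lift_biquad_root hlz hgood ht 3
    refine ⟨s, (hzero4 s).2 hs', ?_⟩
    rw [map_intCast, eq_comm, ZMod.intCast_eq_intCast_iff_dvd_sub]
    exact hs

theorem ncard_multiples {l : ℕ} (hl : l.Prime) :
    {a : ZMod (l ^ 6) | (l : ZMod (l ^ 6)) ∣ a}.ncard = l ^ 5 := by
  have := ncard_preimage_zmod_pow (k := 1) hl.pos (by norm_num) {0}
  rw [Set.ncard_singleton, mul_one] at this
  rw [← this]
  congr 1
  ext a
  obtain ⟨a, rfl⟩ := ZMod.intCast_surjective a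
  rw [Set.mem_ofPred_eq, Set.mem_ofPred_eq, Set.mem_singleton_iff, dvd_intCast_zmod (by norm_num),
    ZMod.cast_intCast (pow_dvd_pow l (by norm_num)), ZMod.intCast_zmod_eq_zero_iff_dvd, pow_one]

theorem ncard_not_multiples {l : ℕ} (hl : l.Prime) :
    {a : ZMod (l ^ 6) | ¬ (l : ZMod (l ^ 6)) ∣ a}.ncard = l ^ 6 - l ^ 5 := by
  have : NeZero (l ^ 6) := ⟨pow_ne_zero 6 hl.ne_zero⟩
  have h := Set.ncard_compl {a : ZMod (l ^ 6) | (l : ZMod (l ^ 6)) ∣ a}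
  rw [ncard_multiples hl, Nat.card_zmod] at h
  exact h

/-- When `b` is a unit, homogeneity turns `(a, b)` into `(tb, b)` with `t` a root modulo `ℓ⁴`. Each
root modulo `ℓ` has one lift modulo `ℓ⁴` and then `ℓ²` lifts modulo `ℓ⁶`. -/
theorem ncard_biquad_divisible {l : ℕ} (hl : l.Prime) {m n : ℤ}
    (hgood : ¬ (l : ℤ) ∣ 2 * n * (m ^ 2 - 4 * n)) :
    {p : ZMod (l ^ 6) × ZMod (l ^ 6) | ¬ (l : ZMod (l ^ 6)) ∣ p.2 ∧
      (l : ZMod (l ^ 6)) ^ 4 ∣ biquad (m : ZMod (l ^ 6)) n p.1 p.2}.ncard =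
    (l ^ 6 - l ^ 5) * (l ^ 2 * {t : ZMod l | biquad (m : ZMod l) n t 1 = 0}.ncard) := by
  have hT : {t : ZMod (l ^ 6) | (l : ZMod (l ^ 6)) ^ 4 ∣ biquad (m : ZMod (l ^ 6)) n t 1}.ncard =
      l ^ 2 * {t : ZMod l | biquad (m : ZMod l) n t 1 = 0}.ncard := by
    rw [← ncard_biquad_roots_prime_pow hl hgood]
    rw [← ncard_preimage_zmod_pow (k := 4) hl.pos (by norm_num)]
    congr 1
    ext a
    obtain ⟨a, rfl⟩ := ZMod.intCast_surjective a
    have h1 : biquad (m : ZMod (l ^ 6)) n a 1 = ((biquad m n a 1 : ℤ) : ZMod (l ^ 6)) := by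
      rw [intCast_biquad]; push_cast; rfl
    have h2 : biquad (m : ZMod (l ^ 4)) n a 1 = ((biquad m n a 1 : ℤ) : ZMod (l ^ 4)) := by
      rw [intCast_biquad]; push_cast; rfl
    rw [Set.mem_ofPred_eq, Set.mem_ofPred_eq, Set.mem_ofPred_eq,
      ZMod.cast_intCast (pow_dvd_pow l (by norm_num)), h1, h2, pow_dvd_intCast_zmod (by norm_num),
      ZMod.intCast_zmod_eq_zero_iff_dvd]
    push_cast
    rfl
  rw [← ncard_not_multiples hl, ← hT, ← Set.ncard_prod]
  symm
  have hmul : ∀ t b : ZMod (l ^ 6), biquad (m : ZMod (l ^ 6)) n (t * b) b =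
      b ^ 4 * biquad (m : ZMod (l ^ 6)) n t 1 := by
    intro t b; unfold biquad; ring
  refine Set.ncard_congr (fun q _ => (q.2 * q.1, q.1)) ?_ ?_ ?_
  · rintro ⟨b, t⟩ ⟨hb, ht⟩
    refine ⟨hb, ?_⟩
    simp only [Set.mem_ofPred_eq] at hb ht ⊢
    rw [hmul]
    exact ht.mul_left _
  · rintro ⟨b, t⟩ ⟨b', t'⟩ ⟨hb, _⟩ _ h
    obtain ⟨h1, rfl⟩ := Prod.ext_iff.1 h
    have hu := (isUnit_zmod_prime_pow hl (by norm_num) b).2 hb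
    exact Prod.ext rfl (hu.mul_right_cancel h1)
  · rintro ⟨a, b⟩ ⟨hb, hab⟩
    have hu := (isUnit_zmod_prime_pow hl (by norm_num) b).2 hb
    obtain ⟨u, rfl⟩ := hu
    refine ⟨(u, a * (u⁻¹ : (ZMod (l ^ 6))ˣ)), ⟨hb, ?_⟩, ?_⟩
    · have := hmul (a * (u⁻¹ : (ZMod (l ^ 6))ˣ)) u
      simp only [Set.mem_ofPred_eq] at hab ⊢
      rw [Units.inv_mul_cancel_right] at this
      rw [this] at hab
      exact ((u.isUnit.pow 4).dvd_mul_left).1 hab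
    · simp

/-- The excluded classes are `ℓ¹⁰` pairs of multiples of `ℓ` and, disjointly from these, `(ℓ⁶ -
ℓ⁵)ℓ² r` pairs with `b` a unit. -/
theorem density_eq_of_bad_iff {l : ℕ} (hl : l.Prime) {m n : ℤ}
    (hgood : ¬ (l : ℤ) ∣ 2 * n * (m ^ 2 - 4 * n))
    (D : ∀ l : ℕ, Set (ZMod (l ^ 6) × ZMod (l ^ 6)))
    (hD : ∀ p : ℤ × ℤ, residue (l ^ 6) p ∉ D l ↔ ((l : ℤ) ∣ p.1 ∧ (l : ℤ) ∣ p.2) ∨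
      (¬ (l : ℤ) ∣ p.2 ∧ (l : ℤ) ^ 4 ∣ biquad m n p.1 p.2)) :
    density D l = 1 - 1 / (l : ℝ) ^ 2 -
      ({t : ZMod l | biquad (m : ZMod l) n t 1 = 0}.ncard : ℝ) * ((l : ℝ) - 1) / (l : ℝ) ^ 5 := by
  have : NeZero (l ^ 6) := ⟨pow_ne_zero 6 hl.ne_zero⟩
  have hcompl : (D l)ᶜ = ({a : ZMod (l ^ 6) | (l : ZMod (l ^ 6)) ∣ a} ×ˢ
      {a : ZMod (l ^ 6) | (l : ZMod (l ^ 6)) ∣ a}) ∪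
      {p : ZMod (l ^ 6) × ZMod (l ^ 6) | ¬ (l : ZMod (l ^ 6)) ∣ p.2 ∧
        (l : ZMod (l ^ 6)) ^ 4 ∣ biquad (m : ZMod (l ^ 6)) n p.1 p.2} := by
    ext ⟨a, b⟩
    obtain ⟨a, rfl⟩ := ZMod.intCast_surjective a
    obtain ⟨b, rfl⟩ := ZMod.intCast_surjective b
    have := hD (a, b)
    simp only [residue] at this
    rw [Set.mem_compl_iff, this]
    simp only [Set.mem_union, Set.mem_prod, Set.mem_ofPred_eq]
    rw [← intCast_biquad, dvd_intCast_zmod (by norm_num), dvd_intCast_zmod (by norm_num),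
      pow_dvd_intCast_zmod (by norm_num)]
  have hdisj : Disjoint ({a : ZMod (l ^ 6) | (l : ZMod (l ^ 6)) ∣ a} ×ˢ
      {a : ZMod (l ^ 6) | (l : ZMod (l ^ 6)) ∣ a})
      {p : ZMod (l ^ 6) × ZMod (l ^ 6) | ¬ (l : ZMod (l ^ 6)) ∣ p.2 ∧
        (l : ZMod (l ^ 6)) ^ 4 ∣ biquad (m : ZMod (l ^ 6)) n p.1 p.2} := by
    rw [Set.disjoint_left]
    rintro p ⟨_, h⟩ ⟨h', _⟩
    exact h' h
  have hcard := Set.ncard_add_ncard_compl (D l)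
  rw [hcompl, Set.ncard_union_eq hdisj, Set.ncard_prod, ncard_multiples hl,
    ncard_biquad_divisible hl hgood, Nat.card_prod, Nat.card_zmod] at hcard
  have hle : l ^ 5 ≤ l ^ 6 := Nat.pow_le_pow_right hl.pos (by norm_num)
  have hcardR := congrArg (Nat.cast : ℕ → ℝ) hcard
  push_cast [Nat.cast_sub hle] at hcardR
  have hl0 : (l : ℝ) ≠ 0 := by exact_mod_cast hl.ne_zero
  rw [density]
  rw [← eq_sub_iff_add_eq] at hcardR
  rw [hcardR]
  field_simp
  ring

/-- The crude bound `r ≤ ℓ` on the number of roots already gives a summable deviation from 1. -/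
theorem density_sub_one_abs_le {l : ℕ} (hl : l.Prime) {m n : ℤ}
    (hgood : ¬ (l : ℤ) ∣ 2 * n * (m ^ 2 - 4 * n))
    (D : ∀ l : ℕ, Set (ZMod (l ^ 6) × ZMod (l ^ 6)))
    (hD : ∀ p : ℤ × ℤ, residue (l ^ 6) p ∉ D l ↔ ((l : ℤ) ∣ p.1 ∧ (l : ℤ) ∣ p.2) ∨
      (¬ (l : ℤ) ∣ p.2 ∧ (l : ℤ) ^ 4 ∣ biquad m n p.1 p.2)) :
    ‖density D l - 1‖ ≤ 2 * (1 / (l : ℝ) ^ 2) := by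
  have : NeZero l := ⟨hl.ne_zero⟩
  rw [density_eq_of_bad_iff hl hgood D hD]
  set r := {t : ZMod l | biquad (m : ZMod l) n t 1 = 0}.ncard
  have hr : r ≤ l := by
    have := Set.ncard_le_card {t : ZMod l | biquad (m : ZMod l) n t 1 = 0}
    rwa [Nat.card_zmod] at this
  have hr' : (r : ℝ) ≤ l := by exact_mod_cast hr
  have hl1 : (1 : ℝ) ≤ l := by exact_mod_cast hl.one_lt.le
  have h1 : (r : ℝ) * ((l : ℝ) - 1) / (l : ℝ) ^ 5 ≤ 1 / (l : ℝ) ^ 2 := by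
    rw [div_le_div_iff₀ (by positivity) (by positivity)]
    have : (r : ℝ) * (l - 1) ≤ l * l := mul_le_mul hr' (by linarith) (by linarith) (by linarith)
    calc (r : ℝ) * (l - 1) * (l : ℝ) ^ 2 ≤ l * l * (l : ℝ) ^ 2 := by gcongr
      _ = 1 * (l : ℝ) ^ 4 := by ring
      _ ≤ 1 * (l : ℝ) ^ 5 := by gcongr; all_goals first | exact hl1 | norm_num
  have h2 : 0 ≤ (r : ℝ) * ((l : ℝ) - 1) / (l : ℝ) ^ 5 :=
    div_nonneg (mul_nonneg (by positivity) (by linarith)) (by positivity)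
  have h3 : 0 ≤ 1 / (l : ℝ) ^ 2 := by positivity
  rw [Real.norm_eq_abs, abs_le]
  constructor <;> linarith


/-! ### Asymptotics for families given by a pair of binary forms -/

open scoped Pointwise

/-- The part of the upper half plane on which `g ≤ 1`. -/
def sublevel (g : ℝ × ℝ → ℝ) : Set (ℝ × ℝ) := {p | 0 < p.2 ∧ g p ≤ 1}

theorem sublevel_smul {g : ℝ × ℝ → ℝ} {k : ℕ}
    (hg : ∀ t : ℝ, 0 < t → ∀ p, g (t • p) = t ^ k * g p) {t : ℝ} (ht : 0 < t) :
    t • sublevel g = {p | 0 < p.2 ∧ g p ≤ t ^ k} := by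
  ext p
  rw [Set.mem_smul_set_iff_inv_smul_mem₀ ht.ne']
  simp only [sublevel, Set.mem_ofPred_eq, Prod.smul_snd, smul_eq_mul]
  rw [hg _ (by positivity), inv_pow, inv_mul_le_iff₀ (by positivity), mul_one]
  refine and_congr_left fun _ => ?_
  rw [mul_pos_iff_of_pos_left (by positivity)]

/-- The frontier lies in the axis `v = 0` together with the level set `g = 1`. By homogeneity the
level set lies in `S \ tS` for every `0 < t < 1`, a set of area `(1 - t²)` times that of `S`; let
`t` tend to 1. -/
theorem volume_frontier_sublevel {g : ℝ × ℝ → ℝ} (hc : Continuous g) {k : ℕ} (hk : k ≠ 0)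
    (hg : ∀ t : ℝ, 0 < t → ∀ p, g (t • p) = t ^ k * g p)
    (hb : Bornology.IsBounded (sublevel g)) : volume (frontier (sublevel g)) = 0 := by
  have hmeas : ∀ c, MeasurableSet {p : ℝ × ℝ | 0 < p.2 ∧ g p ≤ c} := fun c =>
    (measurableSet_lt measurable_const measurable_snd).inter
      (measurableSet_le hc.measurable measurable_const)
  have hsub : frontier (sublevel g) ⊆
      (Set.univ ×ˢ {(0 : ℝ)}) ∪ {p | 0 < p.2 ∧ g p = 1} := by
    intro p hp
    have h1 : p ∈ {p : ℝ × ℝ | 0 ≤ p.2 ∧ g p ≤ 1} := by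
      have hcl : IsClosed {p : ℝ × ℝ | 0 ≤ p.2 ∧ g p ≤ 1} :=
        (isClosed_le continuous_const continuous_snd).inter (isClosed_le hc continuous_const)
      have hs : sublevel g ⊆ {p : ℝ × ℝ | 0 ≤ p.2 ∧ g p ≤ 1} := fun q hq => ⟨hq.1.le, hq.2⟩
      exact closure_minimal hs hcl (frontier_subset_closure hp)
    have h2 : ¬ (0 < p.2 ∧ g p < 1) := by
      intro h
      have hop : IsOpen {p : ℝ × ℝ | 0 < p.2 ∧ g p < 1} :=
        (isOpen_lt continuous_const continuous_snd).inter (isOpen_lt hc continuous_const)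
      have hs : {p : ℝ × ℝ | 0 < p.2 ∧ g p < 1} ⊆ sublevel g := fun q hq => ⟨hq.1, hq.2.le⟩
      exact hp.2 (interior_maximal hs hop h)
    rcases h1.1.eq_or_lt with h | h
    · exact Or.inl ⟨Set.mem_univ _, h.symm⟩
    · exact Or.inr ⟨h, le_antisymm h1.2 (not_lt.1 fun h' => h2 ⟨h, h'⟩)⟩
  have hline : volume (Set.univ ×ˢ {(0 : ℝ)} : Set (ℝ × ℝ)) = 0 := by
    rw [Measure.volume_eq_prod, Measure.prod_prod]; simp
  have hfin : volume (sublevel g) ≠ ⊤ := hb.measure_lt_top.ne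
  have hlevel : volume {p : ℝ × ℝ | 0 < p.2 ∧ g p = 1} = 0 := by
    have hle : ∀ t : ℝ, 0 < t → t < 1 → volume {p : ℝ × ℝ | 0 < p.2 ∧ g p = 1} ≤
        ENNReal.ofReal ((1 - t ^ 2) * volume.real (sublevel g)) := by
      intro t ht ht1
      have hs := sublevel_smul hg ht
      have hvol : volume (t • sublevel g) = ENNReal.ofReal (t ^ 2) * volume (sublevel g) := by
        rw [Measure.addHaar_smul_of_nonneg _ ht.le]; simp
      have hss : t • sublevel g ⊆ sublevel g := by
        rw [hs]
        exact fun p hp => ⟨hp.1, hp.2.trans (pow_le_one₀ ht.le ht1.le)⟩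
      have hsub' : {p : ℝ × ℝ | 0 < p.2 ∧ g p = 1} ⊆ sublevel g \ (t • sublevel g) := by
        rintro p ⟨hp, hp1⟩
        refine ⟨⟨hp, hp1.le⟩, fun h => ?_⟩
        rw [hs] at h
        have := h.2
        rw [hp1] at this
        exact absurd this (not_le.2 (pow_lt_one₀ ht.le ht1 hk))
      refine (measure_mono hsub').trans ?_
      rw [measure_sdiff hss (by rw [hs]; exact (hmeas _).nullMeasurableSet)
        ((measure_mono hss).trans_lt hfin.lt_top).ne, hvol, sub_mul, one_mul,
        ENNReal.ofReal_sub _ (by positivity), ENNReal.ofReal_mul (by positivity)]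
      rw [measureReal_def, ENNReal.ofReal_toReal hfin]
    have hlim : Tendsto (fun t : ℝ => ENNReal.ofReal ((1 - t ^ 2) * volume.real (sublevel g)))
        (𝓝[<] 1) (𝓝 0) := by
      have h1 : Continuous fun t : ℝ => (1 - t ^ 2) * volume.real (sublevel g) := by fun_prop
      have h2 := (ENNReal.continuous_ofReal.comp h1).tendsto 1
      simp only [Function.comp_apply, one_pow, sub_self, zero_mul, ENNReal.ofReal_zero] at h2
      exact h2.mono_left nhdsWithin_le_nhds
    refine le_antisymm (ge_of_tendsto hlim ?_) zero_le
    filter_upwards [Ioo_mem_nhdsLT (show (0 : ℝ) < 1 by norm_num)] with t ht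
    exact hle t ht.1 ht.2
  exact measure_mono_null hsub (measure_union_null hline hlevel)

theorem volume_sublevel_pos {g : ℝ × ℝ → ℝ} (hc : Continuous g) {k : ℕ} (hk : k ≠ 0)
    (hg : ∀ t : ℝ, 0 < t → ∀ p, g (t • p) = t ^ k * g p) : 0 < volume (sublevel g) := by
  have hop : IsOpen {p : ℝ × ℝ | 0 < p.2 ∧ g p < 1} :=
    (isOpen_lt continuous_const continuous_snd).inter (isOpen_lt hc continuous_const)
  have hne : {p : ℝ × ℝ | 0 < p.2 ∧ g p < 1}.Nonempty := by
    have h1 : Continuous fun t : ℝ => t ^ k * g (0, 1) := by fun_prop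
    have h2 := h1.tendsto 0
    simp only [zero_pow hk, zero_mul] at h2
    have h3 := (h2.mono_left (nhdsWithin_le_nhds (s := Set.Ioi (0 : ℝ)))).eventually (gt_mem_nhds one_pos)
    obtain ⟨t, ht, ht'⟩ := (h3.and (self_mem_nhdsWithin (s := Set.Ioi (0 : ℝ)))).exists
    refine ⟨t • (0, 1), ?_, ?_⟩
    · simpa using ht'
    · rw [hg t ht']; exact ht
  exact (hop.measure_pos _ hne).trans_le (measure_mono fun p hp => ⟨hp.1, hp.2.le⟩)

theorem density_pos {D : ∀ l : ℕ, Set (ZMod (l ^ 6) × ZMod (l ^ 6))} {l : ℕ} (hl : l.Prime)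
    (hne : (D l).Nonempty) : 0 < density D l := by
  have : NeZero (l ^ 6) := ⟨pow_ne_zero 6 hl.ne_zero⟩
  have h1 : 0 < (D l).ncard := (Set.ncard_pos (Set.toFinite _)).2 hne
  have h2 : (0 : ℝ) < l := by exact_mod_cast hl.pos
  unfold density
  positivity

/-- Outside the finite set `s`, the classes excluded by `D` are those divisible by the prime `ℓ`
and those at which `biquad m n` is divisible by `ℓ⁴`. -/
structure IsBiquadSieve (m n : ℤ) (s : Finset Nat.Primes)
    (D : ∀ l : ℕ, Set (ZMod (l ^ 6) × ZMod (l ^ 6))) : Prop where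
  not_dvd : ∀ l : Nat.Primes, l ∉ s → ¬ ((l : ℕ) : ℤ) ∣ 2 * n * (m ^ 2 - 4 * n)
  bad_iff : ∀ l : Nat.Primes, l ∉ s → ∀ p : ℤ × ℤ, residue ((l : ℕ) ^ 6) p ∉ D l ↔
    (((l : ℕ) : ℤ) ∣ p.1 ∧ ((l : ℕ) : ℤ) ∣ p.2) ∨
    (¬ ((l : ℕ) : ℤ) ∣ p.2 ∧ ((l : ℕ) : ℤ) ^ 4 ∣ biquad m n p.1 p.2)
  nonempty : ∀ l : Nat.Primes, (D l).Nonempty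

theorem IsBiquadSieve.multipliable_and_pos {m n : ℤ} {s : Finset Nat.Primes}
    {D : ∀ l : ℕ, Set (ZMod (l ^ 6) × ZMod (l ^ 6))} (h : IsBiquadSieve m n s D) :
    (Multipliable fun l : Nat.Primes => density D l) ∧ 0 < ∏' l : Nat.Primes, density D l := by
  refine multipliable_and_tprod_pos (fun l => density_pos l.2 (h.nonempty l)) ?_
  refine Summable.of_norm_bounded_eventually (summable_one_div_prime_sq.mul_left 2) ?_
  rw [Filter.eventually_cofinite]
  refine s.finite_toSet.subset fun l hl => ?_
  by_contra hls
  exact hl (density_sub_one_abs_le l.2 (h.not_dvd l hls) D (h.bad_iff l hls))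

theorem IsBiquadSieve.tendsto {m n : ℤ} (hm : 0 ≤ m) (hn : 0 < n) {s : Finset Nat.Primes}
    {D : ∀ l : ℕ, Set (ZMod (l ^ 6) × ZMod (l ^ 6))} (h : IsBiquadSieve m n s D)
    {R : Set (ℝ × ℝ)} (hR : Bornology.IsBounded R) (hfr : volume (frontier R) = 0)
    (hRpos : ∀ p ∈ R, 0 < p.2) :
    Tendsto (fun Y : ℝ => ((scaledPoints R
      (fun p => ∀ l : Nat.Primes, residue ((l : ℕ) ^ 6) p ∈ D l) Y).ncard : ℝ) / Y ^ 2) atTop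
      (𝓝 (volume.real R * ∏' l : Nat.Primes, density D l)) :=
  tendsto_sieve hR hfr D h.multipliable_and_pos.1
    (tail_bound hm hn hR hRpos D s h.not_dvd fun l hl p hp => (h.bad_iff l hl p).1 hp)

/-! ### Coprimality, minimality and height as sieve conditions. -/

/-- The classes modulo `ℓ⁶` counted by `localDensity`. -/
def familyClasses (A B : MvPolynomial (Fin 2) ℤ) (l : ℕ) : Set (ZMod (l ^ 6) × ZMod (l ^ 6)) :=
  {p | (¬ (l : ZMod (l ^ 6)) ∣ p.1 ∨ ¬ (l : ZMod (l ^ 6)) ∣ p.2) ∧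
      (¬ (l : ZMod (l ^ 6)) ^ 4 ∣ val A p.1 p.2 ∨
        ¬ (l : ZMod (l ^ 6)) ^ 6 ∣ val B p.1 p.2)}

theorem localDensity_eq (A B : MvPolynomial (Fin 2) ℤ) (l : ℕ) :
    localDensity A B l = density (familyClasses A B) l := rfl

theorem map_val {R S : Type} [CommRing R] [CommRing S] (f : R →+* S)
    (F : MvPolynomial (Fin 2) ℤ) (u v : R) : f (val F u v) = val F (f u) (f v) := by
  unfold val
  rw [MvPolynomial.aeval_def, MvPolynomial.aeval_def, ← MvPolynomial.coe_eval₂Hom,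
    ← MvPolynomial.coe_eval₂Hom, MvPolynomial.map_eval₂Hom]
  congr 2
  · exact Subsingleton.elim _ _
  · ext i; fin_cases i <;> rfl

theorem intCast_val {R : Type} [CommRing R] (F : MvPolynomial (Fin 2) ℤ) (u v : ℤ) :
    ((val F u v : ℤ) : R) = val F (u : R) v := map_val (Int.castRingHom R) F u v

theorem residue_mem_familyClasses (A B : MvPolynomial (Fin 2) ℤ) (l : ℕ) (p : ℤ × ℤ) :
    residue (l ^ 6) p ∈ familyClasses A B l ↔
      (¬ (l : ℤ) ∣ p.1 ∨ ¬ (l : ℤ) ∣ p.2) ∧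
      (¬ (l : ℤ) ^ 4 ∣ val A p.1 p.2 ∨ ¬ (l : ℤ) ^ 6 ∣ val B p.1 p.2) := by
  simp only [familyClasses, residue, Set.mem_ofPred_eq]
  rw [← intCast_val, ← intCast_val, dvd_intCast_zmod (by norm_num), dvd_intCast_zmod (by norm_num),
    pow_dvd_intCast_zmod (by norm_num), pow_dvd_intCast_zmod (by norm_num)]

theorem forall_residue_mem_familyClasses (A B : MvPolynomial (Fin 2) ℤ) (p : ℤ × ℤ) :
    (∀ l : Nat.Primes, residue ((l : ℕ) ^ 6) p ∈ familyClasses A B l) ↔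
      Int.gcd p.1 p.2 = 1 ∧ IsMinimal (val A p.1 p.2) (val B p.1 p.2) := by
  simp only [residue_mem_familyClasses]
  constructor
  · intro h
    constructor
    · by_contra hg
      obtain ⟨l, hl, hlg⟩ := Nat.exists_prime_and_dvd hg
      have hlg' : (l : ℤ) ∣ Int.gcd p.1 p.2 := by exact_mod_cast hlg
      rcases (h ⟨l, hl⟩).1 with h1 | h1
      · exact h1 (hlg'.trans (Int.gcd_dvd_left _ _))
      · exact h1 (hlg'.trans (Int.gcd_dvd_right _ _))
    · intro d hA hB
      by_contra hd
      obtain ⟨l, hl, hld⟩ := Nat.exists_prime_and_dvd hd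
      have hld' : (l : ℤ) ∣ d := by exact_mod_cast hld
      rcases (h ⟨l, hl⟩).2 with h1 | h1
      · exact h1 ((pow_dvd_pow_of_dvd hld' 4).trans hA)
      · exact h1 ((pow_dvd_pow_of_dvd hld' 6).trans hB)
  · rintro ⟨hg, hmin⟩ l
    constructor
    · by_contra! h
      have := Int.dvd_coe_gcd h.1 h.2
      rw [hg] at this
      have h2 : (l : ℕ) ∣ 1 := by exact_mod_cast this
      exact l.2.one_lt.ne' (Nat.dvd_one.1 h2)
    · by_contra! h
      exact l.2.one_lt.ne' (hmin l h.1 h.2)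

/-- The height of `(A(u, v), B(u, v))` at a real point. -/
def realHeight (A B : MvPolynomial (Fin 2) ℤ) (p : ℝ × ℝ) : ℝ :=
  max (4 * |val A p.1 p.2| ^ 3) (27 * |val B p.1 p.2| ^ 2)

theorem region_eq_sublevel (A B : MvPolynomial (Fin 2) ℤ) :
    region A B = sublevel (realHeight A B) := by
  ext p
  simp [region, sublevel, realHeight]

theorem realHeight_intCast (A B : MvPolynomial (Fin 2) ℤ) (p : ℤ × ℤ) :
    realHeight A B ((p.1 : ℝ), (p.2 : ℝ)) = (height (val A p.1 p.2) (val B p.1 p.2) : ℝ) := by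
  simp only [realHeight, height]
  push_cast
  rw [intCast_val, intCast_val, sq_abs]

/-- `A` and `B` are binary forms with `A³` and `B²` of degree `k`, positive enough for the region
of bounded height to be bounded. -/
structure IsHeightPair (A B : MvPolynomial (Fin 2) ℤ) (k : ℕ) : Prop where
  ne_zero : k ≠ 0
  continuous : Continuous (realHeight A B)
  homogeneous : ∀ t : ℝ, 0 < t → ∀ p, realHeight A B (t • p) = t ^ k * realHeight A B p
  bounded : Bornology.IsBounded (region A B)

theorem IsHeightPair.volume_frontier {A B : MvPolynomial (Fin 2) ℤ} {k : ℕ}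
    (h : IsHeightPair A B k) : volume (frontier (region A B)) = 0 := by
  rw [region_eq_sublevel]
  exact volume_frontier_sublevel h.continuous h.ne_zero h.homogeneous
    (by rw [← region_eq_sublevel]; exact h.bounded)

theorem IsHeightPair.volume_pos {A B : MvPolynomial (Fin 2) ℤ} {k : ℕ}
    (h : IsHeightPair A B k) : 0 < volume (region A B) := by
  rw [region_eq_sublevel]
  exact volume_sublevel_pos h.continuous h.ne_zero h.homogeneous

theorem IsHeightPair.volumeReal_pos {A B : MvPolynomial (Fin 2) ℤ} {k : ℕ}
    (h : IsHeightPair A B k) : 0 < volume.real (region A B) :=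
  ENNReal.toReal_pos h.volume_pos.ne' h.bounded.measure_lt_top.ne

theorem IsHeightPair.mem_region_iff {A B : MvPolynomial (Fin 2) ℤ} {k : ℕ}
    (h : IsHeightPair A B k) {X : ℝ} (hX : 0 < X) (p : ℤ × ℤ) :
    ((p.1 : ℝ) / X ^ (1 / k : ℝ), (p.2 : ℝ) / X ^ (1 / k : ℝ)) ∈ region A B ↔
      0 < p.2 ∧ (height (val A p.1 p.2) (val B p.1 p.2) : ℝ) ≤ X := by
  have hk : (k : ℝ) ≠ 0 := by exact_mod_cast h.ne_zero
  set Y := X ^ (1 / k : ℝ) with hY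
  have hY0 : 0 < Y := Real.rpow_pos_of_pos hX _
  have hYk : Y ^ k = X := by
    rw [hY, ← Real.rpow_natCast, ← Real.rpow_mul hX.le, one_div_mul_cancel hk, Real.rpow_one]
  have e : ((p.1 : ℝ) / Y, (p.2 : ℝ) / Y) = Y⁻¹ • ((p.1 : ℝ), (p.2 : ℝ)) := by
    simp [div_eq_inv_mul]
  rw [region_eq_sublevel, sublevel, Set.mem_ofPred_eq, e, h.homogeneous _ (by positivity),
    realHeight_intCast, inv_pow, hYk, inv_mul_le_iff₀ hX, mul_one]
  simp only [Prod.smul_snd, smul_eq_mul]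
  rw [mul_pos_iff_of_pos_left (by positivity)]
  norm_cast

theorem IsHeightPair.tendsto_sieve {A B : MvPolynomial (Fin 2) ℤ} {k : ℕ}
    (h : IsHeightPair A B k) {m n : ℤ} (hm : 0 ≤ m) (hn : 0 < n) {s : Finset Nat.Primes}
    {D : ∀ l : ℕ, Set (ZMod (l ^ 6) × ZMod (l ^ 6))} (hD : IsBiquadSieve m n s D) :
    Tendsto (fun X : ℝ => ((scaledPoints (region A B)
      (fun p => ∀ l : Nat.Primes, residue ((l : ℕ) ^ 6) p ∈ D l) (X ^ (1 / k : ℝ))).ncard : ℝ) /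
        X ^ (2 / k : ℝ)) atTop
      (𝓝 (volume.real (region A B) * ∏' l : Nat.Primes, density D l)) := by
  have hk : (0 : ℝ) < k := by exact_mod_cast Nat.pos_of_ne_zero h.ne_zero
  have h1 := (hD.tendsto hm hn h.bounded h.volume_frontier (fun p hp => hp.1)).comp
    (tendsto_rpow_atTop (show (0 : ℝ) < 1 / k by positivity))
  refine h1.congr' ?_
  filter_upwards [eventually_gt_atTop 0] with X hX
  simp only [Function.comp_apply]
  congr 1
  rw [← Real.rpow_natCast, ← Real.rpow_mul hX.le]
  congr 1
  push_cast; ring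

/-- The sieve counts exactly the family together with the pairs of discriminant zero. Those lie in
the finite set `E`, whose contribution vanishes after division by `X^(2/k)`. -/
theorem IsHeightPair.hasEulerAsymptotic {A B : MvPolynomial (Fin 2) ℤ} {k : ℕ}
    (h : IsHeightPair A B k) {m n : ℤ} (hm : 0 ≤ m) (hn : 0 < n) {s : Finset Nat.Primes}
    (hD : IsBiquadSieve m n s (familyClasses A B)) {E : Set (ℤ × ℤ)} (hE : E.Finite)
    (hdisc : ∀ p : ℤ × ℤ, 0 < p.2 → Int.gcd p.1 p.2 = 1 →
      4 * val A p.1 p.2 ^ 3 + 27 * val B p.1 p.2 ^ 2 = 0 → p ∈ E) :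
    HasEulerAsymptotic A B (2 / k) := by
  obtain ⟨hmul, hpos⟩ := hD.multipliable_and_pos
  refine ⟨h.bounded, h.volume_pos, hmul, hpos, ?_⟩
  have hk : (0 : ℝ) < k := by exact_mod_cast Nat.pos_of_ne_zero h.ne_zero
  have hV := h.volumeReal_pos
  set L := volume.real (region A B) * ∏' l : Nat.Primes, density (familyClasses A B) l with hL
  have hL0 : 0 < L := mul_pos hV hpos
  have h1 := h.tendsto_sieve hm hn hD
  have hup : ∀ X : ℝ, 0 < X → familyCount A B X ≤ (scaledPoints (region A B)
      (fun p => ∀ l : Nat.Primes, residue ((l : ℕ) ^ 6) p ∈ familyClasses A B l)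
      (X ^ (1 / k : ℝ))).ncard := by
    intro X hX
    refine Set.ncard_le_ncard ?_ (scaledPoints_finite h.bounded _ (Real.rpow_pos_of_pos hX _))
    rintro p ⟨hp2, hg, _, hmin, hht⟩
    exact ⟨(forall_residue_mem_familyClasses A B p).2 ⟨hg, hmin⟩,
      (h.mem_region_iff hX p).2 ⟨hp2, hht⟩⟩
  have hlow : ∀ X : ℝ, 0 < X → (scaledPoints (region A B)
      (fun p => ∀ l : Nat.Primes, residue ((l : ℕ) ^ 6) p ∈ familyClasses A B l)
      (X ^ (1 / k : ℝ))).ncard ≤ familyCount A B X + E.ncard := by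
    intro X hX
    have hfin := scaledPoints_finite h.bounded
      (fun p => ∀ l : Nat.Primes, residue ((l : ℕ) ^ 6) p ∈ familyClasses A B l)
      (Real.rpow_pos_of_pos hX (1 / k : ℝ))
    refine le_trans ?_ (Set.ncard_union_le _ _)
    refine Set.ncard_le_ncard ?_ (Set.Finite.union (hfin.subset ?_) hE)
    · rintro p ⟨hp, hpR⟩
      obtain ⟨hg, hmin⟩ := (forall_residue_mem_familyClasses A B p).1 hp
      obtain ⟨hp2, hht⟩ := (h.mem_region_iff hX p).1 hpR
      by_cases hd : 4 * val A p.1 p.2 ^ 3 + 27 * val B p.1 p.2 ^ 2 = 0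
      · exact Or.inr (hdisc p hp2 hg hd)
      · exact Or.inl ⟨hp2, hg, hd, hmin, hht⟩
    · rintro p ⟨hp2, hg, _, hmin, hht⟩
      exact ⟨(forall_residue_mem_familyClasses A B p).2 ⟨hg, hmin⟩,
        (h.mem_region_iff hX p).2 ⟨hp2, hht⟩⟩
  have hpow : Tendsto (fun X : ℝ => X ^ (2 / k : ℝ)) atTop atTop :=
    tendsto_rpow_atTop (by positivity)
  have h2 : Tendsto (fun X : ℝ => (familyCount A B X : ℝ) / X ^ (2 / k : ℝ)) atTop (𝓝 L) := by
    have hlow' : Tendsto (fun X : ℝ => ((scaledPoints (region A B)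
        (fun p => ∀ l : Nat.Primes, residue ((l : ℕ) ^ 6) p ∈ familyClasses A B l)
        (X ^ (1 / k : ℝ))).ncard : ℝ) / X ^ (2 / k : ℝ) - E.ncard / X ^ (2 / k : ℝ)) atTop
        (𝓝 L) := by
      have := h1.sub (tendsto_const_nhds (x := (E.ncard : ℝ)).div_atTop hpow)
      rwa [sub_zero] at this
    refine tendsto_of_tendsto_of_tendsto_of_le_of_le' hlow' h1 ?_ ?_
    · filter_upwards [eventually_gt_atTop 0] with X hX
      have hX' : 0 < X ^ (2 / k : ℝ) := Real.rpow_pos_of_pos hX _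
      rw [← sub_div, div_le_div_iff_of_pos_right hX', sub_le_iff_le_add]
      exact_mod_cast hlow X hX
    · filter_upwards [eventually_gt_atTop 0] with X hX
      have hX' : 0 < X ^ (2 / k : ℝ) := Real.rpow_pos_of_pos hX _
      rw [div_le_div_iff_of_pos_right hX']
      exact_mod_cast hup X hX
  rw [isEquivalent_iff_tendsto_one]
  · have h3 := h2.div_const L
    rw [div_self hL0.ne'] at h3
    refine h3.congr' ?_
    filter_upwards [eventually_gt_atTop 0] with X hX
    have hX' : 0 < X ^ (2 / k : ℝ) := Real.rpow_pos_of_pos hX _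
    simp only [Pi.div_apply, localDensity_eq]
    rw [hL, measureReal_def, div_div]
    congr 1
    ring
  · filter_upwards [eventually_gt_atTop 0] with X hX
    have hX' : 0 < X ^ (2 / k : ℝ) := Real.rpow_pos_of_pos hX _
    rw [measureReal_def] at hV
    exact (mul_pos (mul_pos hpos hV) hX').ne'

/-! ### Imposing a congruence at one further prime. -/

/-- The conditions `D`, together with the congruence `p ≡ r` modulo the prime `q`. -/
def withCongruence (D : ∀ l : ℕ, Set (ZMod (l ^ 6) × ZMod (l ^ 6))) (q : ℕ) (r : ℤ × ℤ) (l : ℕ) :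
    Set (ZMod (l ^ 6) × ZMod (l ^ 6)) :=
  {x | x ∈ D l ∧ (l = q → ∃ p : ℤ × ℤ, residue (l ^ 6) p = x ∧
    (q : ℤ) ∣ p.1 - r.1 ∧ (q : ℤ) ∣ p.2 - r.2)}

theorem residue_mem_withCongruence (D : ∀ l : ℕ, Set (ZMod (l ^ 6) × ZMod (l ^ 6))) (q : ℕ)
    (r : ℤ × ℤ) (l : ℕ) (p : ℤ × ℤ) : residue (l ^ 6) p ∈ withCongruence D q r l ↔
      residue (l ^ 6) p ∈ D l ∧ (l = q → (q : ℤ) ∣ p.1 - r.1 ∧ (q : ℤ) ∣ p.2 - r.2) := by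
  refine and_congr_right fun _ => ⟨?_, fun h hl => ⟨p, rfl, h hl⟩⟩
  rintro h rfl
  obtain ⟨p', hp', h1, h2⟩ := h rfl
  have key : ∀ a b c : ℤ, (a : ZMod (l ^ 6)) = b → (l : ℤ) ∣ a - c → (l : ℤ) ∣ b - c := by
    intro a b c hab hac
    rw [ZMod.intCast_eq_intCast_iff_dvd_sub] at hab
    push_cast at hab
    have := dvd_add ((dvd_pow_self (l : ℤ) (by norm_num)).trans hab) hac
    simpa using this
  exact ⟨key _ _ _ (congrArg Prod.fst hp') h1, key _ _ _ (congrArg Prod.snd hp') h2⟩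

/-- Only the conditions at `q` change, so `q` joins the exceptional primes; the class of `r` itself
keeps the set at `q` nonempty, which is all that positivity of the product requires. -/
theorem IsBiquadSieve.withCongruence {m n : ℤ} {s : Finset Nat.Primes}
    {D : ∀ l : ℕ, Set (ZMod (l ^ 6) × ZMod (l ^ 6))} (h : IsBiquadSieve m n s D) {q : ℕ}
    (hq : q.Prime) (r : ℤ × ℤ) (hr : residue (q ^ 6) r ∈ D q) :
    IsBiquadSieve m n (s ∪ {⟨q, hq⟩}) (withCongruence D q r) where
  not_dvd l hl := h.not_dvd l fun h' => hl (Finset.mem_union_left _ h')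
  bad_iff l hl p := by
    rw [← h.bad_iff l (fun h' => hl (Finset.mem_union_left _ h')), residue_mem_withCongruence,
      not_iff_not, and_iff_left_iff_imp]
    intro _ hlq
    exact absurd (Finset.mem_union_right _ (Finset.mem_singleton.2 (Subtype.ext hlq))) hl
  nonempty l := by
    by_cases hlq : (l : ℕ) = q
    · refine ⟨residue ((l : ℕ) ^ 6) r, (residue_mem_withCongruence D q r l r).2 ⟨?_, by simp⟩⟩
      rw [hlq]; exact hr
    · obtain ⟨x, hx⟩ := h.nonempty l
      exact ⟨x, hx, fun h' => absurd h' hlq⟩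


/-! ### The two families -/

section Values

variable {R : Type} [CommRing R] (u v : R)

theorem val_C₁ : val C₁ u v = biquad 36 432 u v := by
  simp [val, C₁, biquad]

theorem val_A₁ : val A₁ u v = -3 * (u ^ 2 + 12 * v ^ 2) * biquad 36 432 u v := by
  simp [val, A₁, C₁, biquad]; ring

theorem val_B₁ : val B₁ u v = 2 * u * biquad 36 432 u v ^ 2 := by
  simp [val, B₁, C₁, biquad]; ring

theorem val_C₂ : val C₂ u v = biquad 22 125 u v := by
  simp [val, C₂, biquad]

theorem val_A₂ : val A₂ u v =
    -3 * (u ^ 4 + 10 * u ^ 2 * v ^ 2 + 5 * v ^ 4) * biquad 22 125 u v := by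
  simp [val, A₂, C₂, biquad]; ring

theorem val_B₂ : val B₂ u v =
    2 * (u ^ 4 + 4 * u ^ 2 * v ^ 2 - v ^ 4) * biquad 22 125 u v ^ 2 := by
  simp [val, B₂, C₂, biquad]; ring

theorem discriminant₁ : 4 * val A₁ u v ^ 3 + 27 * val B₁ u v ^ 2 =
    -186624 * v ^ 6 * biquad 36 432 u v ^ 3 := by
  rw [val_A₁, val_B₁]; unfold biquad; ring

theorem discriminant₂ : 4 * val A₂ u v ^ 3 + 27 * val B₂ u v ^ 2 =
    -186624 * u ^ 2 * v ^ 10 * biquad 22 125 u v ^ 3 := by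
  rw [val_A₂, val_B₂]; unfold biquad; ring

end Values

theorem biquad_pos {R : Type*} [CommRing R] [LinearOrder R] [IsStrictOrderedRing R] {m n u v : R}
    (hm : 0 ≤ m) (hn : 0 < n) (hv : v ≠ 0) : 0 < biquad m n u v := by
  have h1 : 0 < n * v ^ 4 := by positivity
  have h2 : 0 ≤ u ^ 4 + m * u ^ 2 * v ^ 2 := by positivity
  exact add_pos_of_nonneg_of_pos h2 h1

theorem bounded_region_of_pow_le {A B : MvPolynomial (Fin 2) ℤ} {k : ℕ} (hk : k ≠ 0)
    (hu : ∀ u v : ℝ, |u| ^ k ≤ |val A u v|) (hv : ∀ u v : ℝ, |v| ^ k ≤ |val A u v|) :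
    Bornology.IsBounded (region A B) := by
  refine (Metric.isBounded_closedBall (x := (0 : ℝ × ℝ)) (r := 1)).subset ?_
  rintro ⟨u, v⟩ ⟨_, h, _⟩
  simp only at h
  have hA : |val A u v| ≤ 1 := by
    by_contra! hc
    have : 1 < |val A u v| ^ 3 := one_lt_pow₀ hc (by norm_num)
    linarith
  have key : ∀ x : ℝ, |x| ^ k ≤ |val A u v| → |x| ≤ 1 := fun x hx =>
    (pow_le_one_iff_of_nonneg (abs_nonneg x) hk).1 (hx.trans hA)
  rw [Metric.mem_closedBall, Prod.dist_eq, Real.dist_eq, Real.dist_eq]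
  simpa using ⟨key u (hu u v), key v (hv u v)⟩

theorem continuous_val (F : MvPolynomial (Fin 2) ℤ) :
    Continuous fun p : ℝ × ℝ => val F p.1 p.2 := by
  unfold val
  simp only [MvPolynomial.aeval_def]
  induction F using MvPolynomial.induction_on with
  | C a => simp only [MvPolynomial.eval₂_C]; exact continuous_const
  | add p q hp hq => simp only [MvPolynomial.eval₂_add]; exact hp.add hq
  | mul_X p i hp =>
    simp only [MvPolynomial.eval₂_mul, MvPolynomial.eval₂_X]
    refine hp.mul ?_
    fin_cases i
    · exact continuous_fst
    · exact continuous_snd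

theorem isHeightPair_of_homogeneous {A B : MvPolynomial (Fin 2) ℤ} {d e k : ℕ} (hk : k ≠ 0)
    (hA : ∀ t u v : ℝ, val A (t * u) (t * v) = t ^ d * val A u v)
    (hB : ∀ t u v : ℝ, val B (t * u) (t * v) = t ^ e * val B u v)
    (hd : d * 3 = k) (he : e * 2 = k) (hb : Bornology.IsBounded (region A B)) :
    IsHeightPair A B k where
  ne_zero := hk
  continuous := (((continuous_val A).abs.pow 3).const_mul 4).max
    (((continuous_val B).abs.pow 2).const_mul 27)
  homogeneous t ht p := by
    simp only [realHeight, Prod.smul_fst, Prod.smul_snd, smul_eq_mul]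
    rw [hA, hB, mul_max_of_nonneg _ _ (by positivity), abs_mul, abs_mul, mul_pow, mul_pow,
      abs_of_pos (pow_pos ht d), abs_of_pos (pow_pos ht e), ← pow_mul, ← pow_mul, hd, he]
    congr 1 <;> ring
  bounded := hb

theorem isHeightPair₁ : IsHeightPair A₁ B₁ 18 := by
  have key : ∀ x : ℝ, |x| ^ 6 = x ^ 6 := fun x => (Even.pow_abs (by decide) x)
  refine isHeightPair_of_homogeneous (d := 6) (e := 9) (by norm_num) ?_ ?_ rfl rfl
    (bounded_region_of_pow_le (k := 6) (by norm_num) ?_ ?_)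
  · intro t u v; rw [val_A₁, val_A₁]; unfold biquad; ring
  · intro t u v; rw [val_B₁, val_B₁]; unfold biquad; ring
  all_goals
    intro u v
    -- Every coefficient of `-A` is nonnegative and every exponent even, so `|A|` dominates both
    -- `u⁶` and `v⁶`.
    have e : -(val A₁ u v) = 3 * u ^ 6 + 15552 * v ^ 6 + (144 * u ^ 4 * v ^ 2 +
        2592 * u ^ 2 * v ^ 4) := by rw [val_A₁]; unfold biquad; ring
    have h1 : 0 ≤ u ^ 6 := by positivity
    have h2 : 0 ≤ v ^ 6 := by positivity
    have h3 : 0 ≤ 144 * u ^ 4 * v ^ 2 + 2592 * u ^ 2 * v ^ 4 := by positivity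
    rw [key]
    linarith [neg_le_abs (val A₁ u v)]

theorem isHeightPair₂ : IsHeightPair A₂ B₂ 24 := by
  have key : ∀ x : ℝ, |x| ^ 8 = x ^ 8 := fun x => (Even.pow_abs (by decide) x)
  refine isHeightPair_of_homogeneous (d := 8) (e := 12) (by norm_num) ?_ ?_ rfl rfl
    (bounded_region_of_pow_le (k := 8) (by norm_num) ?_ ?_)
  · intro t u v; rw [val_A₂, val_A₂]; unfold biquad; ring
  · intro t u v; rw [val_B₂, val_B₂]; unfold biquad; ring
  all_goals
    intro u v
    have e : -(val A₂ u v) = 3 * u ^ 8 + 1875 * v ^ 8 + (96 * u ^ 6 * v ^ 2 +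
        1050 * u ^ 4 * v ^ 4 + 4080 * u ^ 2 * v ^ 6) := by rw [val_A₂]; unfold biquad; ring
    have h1 : 0 ≤ u ^ 8 := by positivity
    have h2 : 0 ≤ v ^ 8 := by positivity
    have h3 : 0 ≤ 96 * u ^ 6 * v ^ 2 + 1050 * u ^ 4 * v ^ 4 + 4080 * u ^ 2 * v ^ 6 := by
      positivity
    rw [key]
    linarith [neg_le_abs (val A₂ u v)]

theorem prime_not_dvd_ofNat {l : ℕ} (hl : l.Prime) (a b c : ℕ) (h2 : l ≠ 2) (h3 : l ≠ 3)
    (h5 : l ≠ 5 ∨ c = 0) : ¬ (l : ℤ) ∣ 2 ^ a * 3 ^ b * 5 ^ c := by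
  have hlz := Nat.prime_iff_prime_int.1 hl
  have key : ∀ q k : ℕ, q.Prime → l ≠ q ∨ k = 0 → ¬ (l : ℤ) ∣ (q : ℤ) ^ k := by
    rintro q k hq (h | rfl) hd
    · exact h ((Nat.prime_dvd_prime_iff_eq hl hq).1
        (Int.natCast_dvd_natCast.1 (hlz.dvd_of_dvd_pow hd)))
    · rw [pow_zero] at hd
      exact hlz.not_isUnit (isUnit_of_dvd_one hd)
  intro h
  rcases hlz.dvd_or_dvd h with h | h
  · rcases hlz.dvd_or_dvd h with h | h
    · exact key 2 a Nat.prime_two (Or.inl h2) h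
    · exact key 3 b Nat.prime_three (Or.inl h3) h
  · exact key 5 c Nat.prime_five h5 h

/-- If `ℓ ∣ C` with `ℓ ∤ b`, then `f` is prime to `ℓ`, so `ℓ⁴ ∣ fC` amounts to `ℓ⁴ ∣ C`, and then
`ℓ⁸ ∣ C²` settles the condition on `B`. If `ℓ ∤ C`, then `ℓ` divides `f` and `g`, which vanish
together only at the origin modulo `ℓ`. -/
theorem bad_iff_of_coprime {l m n f g a b : ℤ} (hl : Prime l)
    (h0 : l ∣ biquad m n a b → ¬ l ∣ b → ¬ l ∣ f)
    (h1 : l ∣ f → l ∣ g → l ∣ a ∧ l ∣ b) :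
    ¬ ((¬ l ∣ a ∨ ¬ l ∣ b) ∧ (¬ l ^ 4 ∣ f * biquad m n a b ∨ ¬ l ^ 6 ∣ g * biquad m n a b ^ 2)) ↔
      (l ∣ a ∧ l ∣ b) ∨ (¬ l ∣ b ∧ l ^ 4 ∣ biquad m n a b) := by
  have hab : l ∣ biquad m n a b → l ∣ b → l ∣ a := by
    intro h hb
    have : l ∣ a ^ 4 := by
      have e : a ^ 4 = biquad m n a b - b * (m * a ^ 2 * b + n * b ^ 3) := by unfold biquad; ring
      rw [e]
      exact dvd_sub h (hb.mul_right _)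
    exact hl.dvd_of_dvd_pow this
  constructor
  · intro h
    by_cases hboth : l ∣ a ∧ l ∣ b
    · exact Or.inl hboth
    right
    have h' : l ^ 4 ∣ f * biquad m n a b ∧ l ^ 6 ∣ g * biquad m n a b ^ 2 := by
      by_contra hc
      exact h ⟨not_and_or.1 hboth, not_and_or.1 hc⟩
    by_cases hC : l ∣ biquad m n a b
    · have hb : ¬ l ∣ b := fun hb => hboth ⟨hab hC hb, hb⟩
      refine ⟨hb, ?_⟩
      exact (IsCoprime.pow_left ((hl.irreducible.coprime_iff_not_dvd).2
        (h0 hC hb))).dvd_of_dvd_mul_left h'.1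
    · exact absurd (h1
        ((hl.dvd_or_dvd ((dvd_pow_self l four_ne_zero).trans h'.1)).resolve_right hC)
        ((hl.dvd_or_dvd ((dvd_pow_self l (by norm_num)).trans h'.2)).resolve_right
          fun h => hC (hl.dvd_of_dvd_pow h))) hboth
  · rintro (h | ⟨hb, h⟩) ⟨h2, h3⟩
    · exact h2.elim (· h.1) (· h.2)
    · refine h3.elim (· (h.mul_left _)) (· (Dvd.dvd.mul_left ?_ _))
      have := pow_dvd_pow_of_dvd h 2
      rw [← pow_mul] at this
      exact (pow_dvd_pow l (by norm_num)).trans this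

theorem bad_iff₁ {l : ℕ} (hl : l.Prime) (h2 : l ≠ 2) (h3 : l ≠ 3) (p : ℤ × ℤ) :
    residue (l ^ 6) p ∉ familyClasses A₁ B₁ l ↔ ((l : ℤ) ∣ p.1 ∧ (l : ℤ) ∣ p.2) ∨
      (¬ (l : ℤ) ∣ p.2 ∧ (l : ℤ) ^ 4 ∣ biquad 36 432 p.1 p.2) := by
  have hlz := Nat.prime_iff_prime_int.1 hl
  have hnd : ∀ a b : ℕ, ¬ (l : ℤ) ∣ 2 ^ a * 3 ^ b := fun a b => by
    simpa using prime_not_dvd_ofNat hl a b 0 h2 h3 (Or.inr rfl)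
  rw [residue_mem_familyClasses, val_A₁, val_B₁]
  refine bad_iff_of_coprime hlz ?_ ?_
  · intro hC hb hf
    have h : (l : ℤ) ∣ p.1 ^ 2 + 12 * p.2 ^ 2 :=
      (hlz.dvd_or_dvd hf).resolve_left fun h => hnd 0 1 (by simpa using h)
    have h' : (l : ℤ) ∣ 2 ^ 4 * 3 ^ 2 * p.2 ^ 4 := by
      have e : 2 ^ 4 * 3 ^ 2 * p.2 ^ 4 = biquad 36 432 p.1 p.2 -
          (p.1 ^ 2 + 12 * p.2 ^ 2) * (p.1 ^ 2 + 24 * p.2 ^ 2) := by unfold biquad; ring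
      rw [e]
      exact dvd_sub hC (h.mul_right _)
    exact (hlz.dvd_or_dvd h').elim (hnd 4 2) fun h => hb (hlz.dvd_of_dvd_pow h)
  · intro hf hg
    have h : (l : ℤ) ∣ p.1 ^ 2 + 12 * p.2 ^ 2 :=
      (hlz.dvd_or_dvd hf).resolve_left fun h => hnd 0 1 (by simpa using h)
    have ha : (l : ℤ) ∣ p.1 :=
      (hlz.dvd_or_dvd hg).resolve_left fun h => hnd 1 0 (by simpa using h)
    refine ⟨ha, ?_⟩
    have h' : (l : ℤ) ∣ 2 ^ 2 * 3 ^ 1 * p.2 ^ 2 := by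
      have e : 2 ^ 2 * 3 ^ 1 * p.2 ^ 2 = (p.1 ^ 2 + 12 * p.2 ^ 2) - p.1 * p.1 := by ring
      rw [e]
      exact dvd_sub h (ha.mul_right _)
    exact hlz.dvd_of_dvd_pow ((hlz.dvd_or_dvd h').resolve_left (hnd 2 1))

theorem bad_iff₂ {l : ℕ} (hl : l.Prime) (h2 : l ≠ 2) (h3 : l ≠ 3) (h5 : l ≠ 5) (p : ℤ × ℤ) :
    residue (l ^ 6) p ∉ familyClasses A₂ B₂ l ↔ ((l : ℤ) ∣ p.1 ∧ (l : ℤ) ∣ p.2) ∨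
      (¬ (l : ℤ) ∣ p.2 ∧ (l : ℤ) ^ 4 ∣ biquad 22 125 p.1 p.2) := by
  have hlz := Nat.prime_iff_prime_int.1 hl
  have hnd : ∀ a b c : ℕ, ¬ (l : ℤ) ∣ 2 ^ a * 3 ^ b * 5 ^ c := fun a b c =>
    prime_not_dvd_ofNat hl a b c h2 h3 (Or.inl h5)
  rw [residue_mem_familyClasses, val_A₂, val_B₂]
  refine bad_iff_of_coprime hlz ?_ ?_
  · intro hC hb hf
    have h : (l : ℤ) ∣ p.1 ^ 4 + 10 * p.1 ^ 2 * p.2 ^ 2 + 5 * p.2 ^ 4 :=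
      (hlz.dvd_or_dvd hf).resolve_left fun h => hnd 0 1 0 (by simpa using h)
    have h' : (l : ℤ) ∣ 2 ^ 2 * 3 ^ 1 * 5 ^ 0 * (p.2 ^ 2 * (p.1 ^ 2 + 10 * p.2 ^ 2)) := by
      have e : 2 ^ 2 * 3 ^ 1 * 5 ^ 0 * (p.2 ^ 2 * (p.1 ^ 2 + 10 * p.2 ^ 2)) =
          biquad 22 125 p.1 p.2 - (p.1 ^ 4 + 10 * p.1 ^ 2 * p.2 ^ 2 + 5 * p.2 ^ 4) := by
        unfold biquad; ring
      rw [e]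
      exact dvd_sub hC h
    have h'' := (hlz.dvd_or_dvd ((hlz.dvd_or_dvd h').resolve_left (hnd 2 1 0))).resolve_left
      fun h => hb (hlz.dvd_of_dvd_pow h)
    have h4 : (l : ℤ) ∣ 2 ^ 0 * 3 ^ 0 * 5 ^ 1 * p.2 ^ 4 := by
      have e : 2 ^ 0 * 3 ^ 0 * 5 ^ 1 * p.2 ^ 4 =
          (p.1 ^ 4 + 10 * p.1 ^ 2 * p.2 ^ 2 + 5 * p.2 ^ 4) -
          (p.1 ^ 2 + 10 * p.2 ^ 2) * p.1 ^ 2 := by ring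
      rw [e]
      exact dvd_sub h (h''.mul_right _)
    exact (hlz.dvd_or_dvd h4).elim (hnd 0 0 1) fun h => hb (hlz.dvd_of_dvd_pow h)
  · intro hf hg
    have hp : (l : ℤ) ∣ p.1 ^ 4 + 10 * p.1 ^ 2 * p.2 ^ 2 + 5 * p.2 ^ 4 :=
      (hlz.dvd_or_dvd hf).resolve_left fun h => hnd 0 1 0 (by simpa using h)
    have hq : (l : ℤ) ∣ p.1 ^ 4 + 4 * p.1 ^ 2 * p.2 ^ 2 - p.2 ^ 4 :=
      (hlz.dvd_or_dvd hg).resolve_left fun h => hnd 1 0 0 (by simpa using h)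
    have hb : (l : ℤ) ∣ p.2 := by
      by_contra hb
      have h' : (l : ℤ) ∣ 2 ^ 1 * 3 ^ 1 * 5 ^ 0 * (p.2 ^ 2 * (p.1 ^ 2 + p.2 ^ 2)) := by
        have e : 2 ^ 1 * 3 ^ 1 * 5 ^ 0 * (p.2 ^ 2 * (p.1 ^ 2 + p.2 ^ 2)) =
            (p.1 ^ 4 + 10 * p.1 ^ 2 * p.2 ^ 2 + 5 * p.2 ^ 4) -
            (p.1 ^ 4 + 4 * p.1 ^ 2 * p.2 ^ 2 - p.2 ^ 4) := by ring
        rw [e]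
        exact dvd_sub hp hq
      have h'' := (hlz.dvd_or_dvd ((hlz.dvd_or_dvd h').resolve_left (hnd 1 1 0))).resolve_left
        fun h => hb (hlz.dvd_of_dvd_pow h)
      have h4 : (l : ℤ) ∣ 2 ^ 2 * 3 ^ 0 * 5 ^ 0 * p.2 ^ 4 := by
        have e : 2 ^ 2 * 3 ^ 0 * 5 ^ 0 * p.2 ^ 4 = (p.1 ^ 2 + p.2 ^ 2) * (p.1 ^ 2 + 9 * p.2 ^ 2) -
            (p.1 ^ 4 + 10 * p.1 ^ 2 * p.2 ^ 2 + 5 * p.2 ^ 4) := by ring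
        rw [e]
        exact dvd_sub (h''.mul_right _) hp
      exact (hlz.dvd_or_dvd h4).elim (hnd 2 0 0) fun h => hb (hlz.dvd_of_dvd_pow h)
    refine ⟨?_, hb⟩
    have : (l : ℤ) ∣ p.1 ^ 4 := by
      have e : p.1 ^ 4 = (p.1 ^ 4 + 10 * p.1 ^ 2 * p.2 ^ 2 + 5 * p.2 ^ 4) -
          p.2 * (10 * p.1 ^ 2 * p.2 + 5 * p.2 ^ 3) := by ring
      rw [e]
      exact dvd_sub hp (hb.mul_right _)
    exact hlz.dvd_of_dvd_pow this

/-- No fourth power of a prime divides 3, so the point `(1, 0)` shows that no local density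
vanishes, even at the bad primes. -/
theorem one_zero_mem_familyClasses {A B : MvPolynomial (Fin 2) ℤ} (hA : val A (1 : ℤ) 0 = -3)
    {l : ℕ} (hl : l.Prime) : residue (l ^ 6) (1, 0) ∈ familyClasses A B l := by
  have hlz := Nat.prime_iff_prime_int.1 hl
  rw [residue_mem_familyClasses]
  refine ⟨Or.inl fun h => hlz.not_isUnit (isUnit_of_dvd_one h), Or.inl fun h => ?_⟩
  simp only [hA, dvd_neg] at h
  have h1 := Int.le_of_dvd (by norm_num) h
  have h2 : (2 : ℤ) ≤ l := by exact_mod_cast hl.two_le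
  have h3 : (2 : ℤ) ^ 4 ≤ (l : ℤ) ^ 4 := by gcongr
  omega

theorem isBiquadSieve₁ : IsBiquadSieve 36 432 (primesUpTo 3) (familyClasses A₁ B₁) where
  not_dvd l hl h := by
    rw [mem_primesUpTo, not_le] at hl
    -- `2 · 432 · (36² - 4 · 432) = -2⁹ · 3⁶`.
    refine prime_not_dvd_ofNat l.2 9 6 0 (by omega) (by omega) (Or.inr rfl) ?_
    rw [← dvd_neg]
    norm_num at h ⊢
    exact h
  bad_iff l hl p := by
    rw [mem_primesUpTo, not_le] at hl
    exact bad_iff₁ l.2 (by omega) (by omega) p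
  nonempty l := ⟨_, one_zero_mem_familyClasses (by rw [val_A₁]; norm_num [biquad]) l.2⟩

theorem isBiquadSieve₂ : IsBiquadSieve 22 125 (primesUpTo 5) (familyClasses A₂ B₂) where
  not_dvd l hl h := by
    rw [mem_primesUpTo, not_le] at hl
    -- `2 · 125 · (22² - 4 · 125) = -2⁵ · 5³`.
    refine prime_not_dvd_ofNat l.2 5 0 3 (by omega) (by omega) (Or.inl (by omega)) ?_
    rw [← dvd_neg]
    norm_num at h ⊢
    exact h
  bad_iff l hl p := by
    rw [mem_primesUpTo, not_le] at hl
    exact bad_iff₂ l.2 (by omega) (by omega) (by omega) p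
  nonempty l := ⟨_, one_zero_mem_familyClasses (by rw [val_A₂]; norm_num [biquad]) l.2⟩

theorem density_of_mem_iff_not_dvd {D : ∀ l : ℕ, Set (ZMod (l ^ 6) × ZMod (l ^ 6))} {l : ℕ}
    (hl : l.Prime) (h : ∀ p, residue (l ^ 6) p ∈ D l ↔ ¬ (l : ℤ) ∣ p.1) :
    density D l = 1 - 1 / l := by
  have hD : D l = {a : ZMod (l ^ 6) | ¬ (l : ZMod (l ^ 6)) ∣ a} ×ˢ Set.univ := by
    ext ⟨a, b⟩
    obtain ⟨a, rfl⟩ := ZMod.intCast_surjective a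
    obtain ⟨b, rfl⟩ := ZMod.intCast_surjective b
    have := h (a, b)
    simp only [residue] at this
    rw [this, Set.mem_prod, Set.mem_ofPred_eq, dvd_intCast_zmod (by norm_num)]
    simp
  have hle : l ^ 5 ≤ l ^ 6 := Nat.pow_le_pow_right hl.pos (by norm_num)
  have hl0 : (l : ℝ) ≠ 0 := by exact_mod_cast hl.ne_zero
  rw [density, hD, Set.ncard_prod, ncard_not_multiples hl, Set.ncard_univ, Nat.card_zmod]
  push_cast [Nat.cast_sub hle]
  field_simp

/-- For even `a` the form `C` is divisible by 16, so both divisibilities hold; for odd `a` the value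
`A` is odd. -/
theorem localDensity₁_two : localDensity A₁ B₁ 2 = 1 / 2 := by
  rw [localDensity_eq, density_of_mem_iff_not_dvd Nat.prime_two]
  · norm_num
  rintro ⟨a, b⟩
  rw [residue_mem_familyClasses, val_A₁, val_B₁]
  simp only [Nat.cast_ofNat]
  constructor
  · rintro ⟨_, h⟩ ⟨c, rfl⟩
    rcases h with h | h
    · exact h ⟨-3 * ((2 * c) ^ 2 + 12 * b ^ 2) * (c ^ 4 + 9 * c ^ 2 * b ^ 2 + 27 * b ^ 4), by
        unfold biquad; ring⟩
    · exact h ⟨16 * c * (c ^ 4 + 9 * c ^ 2 * b ^ 2 + 27 * b ^ 4) ^ 2, by unfold biquad; ring⟩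
  · intro ha
    refine ⟨Or.inl ha, Or.inl fun h => ha ?_⟩
    have h1 : (2 : ℤ) ∣ a ^ 6 := by
      have e : a ^ 6 = -3 * (a ^ 2 + 12 * b ^ 2) * biquad 36 432 a b +
          2 * (2 * a ^ 6 + 72 * a ^ 4 * b ^ 2 + 1296 * a ^ 2 * b ^ 4 + 7776 * b ^ 6) := by
        unfold biquad; ring
      rw [e]
      exact dvd_add ((dvd_pow_self 2 four_ne_zero).trans h) (dvd_mul_right _ _)
    exact Int.prime_two.dvd_of_dvd_pow h1

/-- For `3 ∣ a` the form `C` is divisible by 27, which makes `3⁵ ∣ A` and `3⁶ ∣ B`. For `3 ∤ a` it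
is `B` that is prime to 3, since `A` always carries a factor 3. -/
theorem localDensity₁_three : localDensity A₁ B₁ 3 = 2 / 3 := by
  rw [localDensity_eq, density_of_mem_iff_not_dvd Nat.prime_three]
  · norm_num
  rintro ⟨a, b⟩
  rw [residue_mem_familyClasses, val_A₁, val_B₁]
  simp only [Nat.cast_ofNat]
  constructor
  · rintro ⟨_, h⟩ ⟨c, rfl⟩
    rcases h with h | h
    · exact h ⟨-3 * (3 * c ^ 2 + 4 * b ^ 2) * (3 * c ^ 4 + 12 * c ^ 2 * b ^ 2 + 16 * b ^ 4), by
        unfold biquad; ring⟩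
    · exact h ⟨6 * c * (3 * c ^ 4 + 12 * c ^ 2 * b ^ 2 + 16 * b ^ 4) ^ 2, by unfold biquad; ring⟩
  · intro ha
    refine ⟨Or.inl ha, Or.inr fun h => ha ?_⟩
    have h1 : (3 : ℤ) ∣ a ^ 9 := by
      have e : a ^ 9 = 3 * (a ^ 9 + (2 * a) * (12 * a ^ 2 * b ^ 2 + 144 * b ^ 4) *
          (biquad 36 432 a b + a ^ 4)) - 2 * a * biquad 36 432 a b ^ 2 := by
        unfold biquad; ring
      rw [e]
      exact dvd_sub (dvd_mul_right _ _) ((dvd_pow_self 3 (by norm_num)).trans h)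
    exact Int.prime_three.dvd_of_dvd_pow h1

theorem rootCount_eq {F : MvPolynomial (Fin 2) ℤ} {m n : ℤ} {l : ℕ}
    (h : ∀ t : ZMod l, val F t 1 = biquad (m : ZMod l) n t 1) :
    rootCount F l = {t : ZMod l | biquad (m : ZMod l) n t 1 = 0}.ncard := by
  simp only [rootCount, h]

theorem localDensity₁_eq {l : ℕ} (hl : l.Prime) (h2 : l ≠ 2) (h3 : l ≠ 3) :
    localDensity A₁ B₁ l = 1 - 1 / (l : ℝ) ^ 2 -
      (rootCount C₁ l : ℝ) * ((l : ℝ) - 1) / (l : ℝ) ^ 5 := by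
  rw [rootCount_eq (m := 36) (n := 432) fun t => by rw [val_C₁]; norm_num, localDensity_eq]
  refine density_eq_of_bad_iff hl (isBiquadSieve₁.not_dvd ⟨l, hl⟩ ?_) _ (bad_iff₁ hl h2 h3)
  intro h
  have h : l ≤ 3 := mem_primesUpTo.1 h
  have := hl.two_le
  interval_cases l <;> omega

theorem localDensity₂_eq {l : ℕ} (hl : l.Prime) (h2 : l ≠ 2) (h3 : l ≠ 3) (h5 : l ≠ 5) :
    localDensity A₂ B₂ l = 1 - 1 / (l : ℝ) ^ 2 -
      (rootCount C₂ l : ℝ) * ((l : ℝ) - 1) / (l : ℝ) ^ 5 := by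
  rw [rootCount_eq (m := 22) (n := 125) fun t => by rw [val_C₂]; norm_num, localDensity_eq]
  refine density_eq_of_bad_iff hl (isBiquadSieve₂.not_dvd ⟨l, hl⟩ ?_) _ (bad_iff₂ hl h2 h3 h5)
  intro h
  have h : l ≤ 5 := mem_primesUpTo.1 h
  have := hl.two_le
  interval_cases l <;> first | omega | exact absurd hl (by norm_num)

theorem hasEulerAsymptotic₁ : HasEulerAsymptotic A₁ B₁ (1 / 9) := by
  have := isHeightPair₁.hasEulerAsymptotic (by norm_num) (by norm_num) isBiquadSieve₁
    (E := ∅) Set.finite_empty ?_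
  · convert this using 1; norm_num
  · intro p hp _ h
    rw [discriminant₁] at h
    have h1 := biquad_pos (m := 36) (n := 432) (u := p.1) (by norm_num) (by norm_num) hp.ne'
    have : (186624 * p.2 ^ 6 * biquad 36 432 p.1 p.2 ^ 3) ≠ 0 := by positivity
    exact absurd (by linarith) this

theorem hasEulerAsymptotic₂ : HasEulerAsymptotic A₂ B₂ (1 / 12) := by
  have := isHeightPair₂.hasEulerAsymptotic (by norm_num) (by norm_num) isBiquadSieve₂
    -- The discriminant contains `u²`; on `a = 0` coprimality and `b > 0` leave a single pair.
    (E := {(0, 1)}) (Set.finite_singleton _) ?_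
  · convert this using 1; norm_num
  · rintro ⟨a, b⟩ hp hg h
    simp only at hp hg
    rw [discriminant₂] at h
    have h1 := biquad_pos (m := 22) (n := 125) (u := a) (by norm_num) (by norm_num) hp.ne'
    have ha : a = 0 := by
      by_contra ha
      have : (186624 * a ^ 2 * b ^ 10 * biquad 22 125 a b ^ 3) ≠ 0 := by positivity
      exact absurd (by linarith) this
    subst ha
    rw [Int.gcd_zero_left] at hg
    have : b = 1 := by omega
    rw [this]; rfl


/-! ### A criterion for unexplained entanglements -/

theorem red_comp {n m k : ℕ} (h : m ∣ n) (h' : k ∣ m)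
    (g : Matrix.GeneralLinearGroup (Fin 2) (ZMod n)) :
    red h' (red h g) = red (h'.trans h) g := by
  unfold red
  rw [Subsingleton.elim (ZMod.castHom (h'.trans h) (ZMod k))
    ((ZMod.castHom h' (ZMod k)).comp (ZMod.castHom h (ZMod m))), Matrix.GeneralLinearGroup.map_comp]
  rfl

theorem kerRed_le {c m k : ℕ} (Γ : Subgroup (Matrix.GeneralLinearGroup (Fin 2) (ZMod c)))
    (h : m ∣ c) (h' : k ∣ m) : kerRed Γ h ≤ kerRed Γ (h'.trans h) := by
  intro g hg
  have hg' : red h (g : Matrix.GeneralLinearGroup (Fin 2) (ZMod c)) = 1 := hg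
  change red _ (g : Matrix.GeneralLinearGroup (Fin 2) (ZMod c)) = 1
  rw [← red_comp h h', hg', map_one]

theorem red_self {n : ℕ} (h : n ∣ n) : red h = MonoidHom.id _ := by
  unfold red
  rw [Subsingleton.elim (ZMod.castHom h (ZMod n)) (RingHom.id _), Matrix.GeneralLinearGroup.map_id]

theorem lcmImage_eq {a b : ℕ} (G : Subgroup (Matrix.GeneralLinearGroup (Fin 2) (ZMod (Nat.lcm a b))))
    (ha : a ∣ Nat.lcm a b) (hb : b ∣ Nat.lcm a b) : lcmImage G ha hb = G := by
  unfold lcmImage levelImage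
  rw [red_self, Subgroup.map_id]

/-- If `a ∣ b`, then `gcd(a, b) = a` and `N_d = N_a` is already contained in `⟨N_a, N_b⟩`. -/
theorem Represents.not_dvd {n : ℕ} {G : Subgroup (Matrix.GeneralLinearGroup (Fin 2) (ZMod n))}
    {a b : ℕ} {T : Type} [Group T] (h : Represents G a b T) : ¬ a ∣ b := by
  obtain ⟨ha, hb, _, hlt, _⟩ := h
  intro hab
  refine hlt.not_ge (le_trans ?_ (le_sup_left (a := kerRed (lcmImage G ha hb) (Nat.dvd_lcm_left a b))))
  exact kerRed_le _ _ (Nat.dvd_gcd dvd_rfl hab)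

section CharacterKernels

variable {Γ : Type*} [Group Γ] {a b : ℕ}
  (ρ : Γ →* Matrix.GeneralLinearGroup (Fin 2) (ZMod (Nat.lcm a b))) (ψ : Γ →* ℤˣ)

/-- The inclusion of `ker ψ` comes from `σ = (σ^m σ⁻¹)⁻¹ σ^m`, whose factors lie in `N_a` and `N_b`.
No knowledge of the full Galois image is needed. -/
theorem sup_kerRed_eq (ha : ∀ σ, red (Nat.dvd_lcm_left a b) (ρ σ) = 1 → ψ σ = 1)
    (hb : ∀ σ, red (Nat.dvd_lcm_right a b) (ρ σ) = 1 → ψ σ = 1)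
    (hpow : ∀ σ, ψ σ = 1 → ∃ m : ℕ, red (Nat.dvd_lcm_right a b) (ρ (σ ^ m)) = 1 ∧
      red (Nat.dvd_lcm_left a b) (ρ (σ ^ m * σ⁻¹)) = 1) :
    kerRed ρ.range (Nat.dvd_lcm_left a b) ⊔ kerRed ρ.range (Nat.dvd_lcm_right a b) =
      ψ.ker.map ρ.rangeRestrict := by
  apply le_antisymm
  · refine sup_le ?_ ?_
    · rintro ⟨_, σ, rfl⟩ h
      exact ⟨σ, ha σ h, rfl⟩
    · rintro ⟨_, σ, rfl⟩ h
      exact ⟨σ, hb σ h, rfl⟩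
  · rintro _ ⟨σ, hσ, rfl⟩
    obtain ⟨m, h1, h2⟩ := hpow σ hσ
    have e : σ = (σ ^ m * σ⁻¹)⁻¹ * σ ^ m := by group
    rw [e, map_mul, map_inv]
    refine mul_mem (inv_mem (Subgroup.mem_sup_left ?_)) (Subgroup.mem_sup_right ?_)
    · exact h2
    · exact h1

/-- As `gcd(a, b) = 1`, `N_d` is the whole group, and the quotient by `⟨N_a, N_b⟩ = ker ψ` has order
two. The hypothesis `hdiv` leaves `(a, b)` as the only possible pair, so maximality and uniqueness
are automatic; `hdet` makes the index of the determinants 1. -/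
theorem isUnexplained_of_character (hlt : a < b) (hgcd : Nat.gcd a b = 1)
    (hdiv : ∀ a' b' : ℕ, a' ∣ Nat.lcm a b → b' ∣ Nat.lcm a b → a' < b' → ¬ a' ∣ b' →
      a' = a ∧ b' = b)
    (ha : ∀ σ, red (Nat.dvd_lcm_left a b) (ρ σ) = 1 → ψ σ = 1)
    (hb : ∀ σ, red (Nat.dvd_lcm_right a b) (ρ σ) = 1 → ψ σ = 1)
    (hpow : ∀ σ, ψ σ = 1 → ∃ m : ℕ, red (Nat.dvd_lcm_right a b) (ρ (σ ^ m)) = 1 ∧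
      red (Nat.dvd_lcm_left a b) (ρ (σ ^ m * σ⁻¹)) = 1)
    (hne : ∃ σ, ψ σ ≠ 1)
    (hdet : ∃ σ, ψ σ = 1 ∧ ∀ x, x ∈ Subgroup.zpowers (Matrix.GeneralLinearGroup.det (ρ σ))) :
    IsUnexplained ρ.range a b (Multiplicative (ZMod 2)) := by
  have hψ : ψ.ker.index = 2 := by
    have hsurj : Function.Surjective ψ := by
      obtain ⟨σ, hσ⟩ := hne
      have hσ' := (Int.units_eq_one_or (ψ σ)).resolve_left hσ
      intro x
      rcases Int.units_eq_one_or x with rfl | rfl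
      · exact ⟨1, map_one _⟩
      · exact ⟨σ, hσ'⟩
    rw [Subgroup.index_ker, MonoidHom.range_eq_top.2 hsurj, Nat.card_congr Subgroup.topEquiv.toEquiv]
    simp
  have hkey : ∀ H : Subgroup (Matrix.GeneralLinearGroup (Fin 2) (ZMod (Nat.lcm a b))),
      H = ρ.range → (kerRed H (Nat.dvd_lcm_left a b) ⊔ kerRed H (Nat.dvd_lcm_right a b)).index = 2 ∧
      ((kerRed H (Nat.dvd_lcm_left a b) ⊔ kerRed H (Nat.dvd_lcm_right a b)).map
        (Matrix.GeneralLinearGroup.det.comp H.subtype)).index = 1 := by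
    rintro H rfl
    rw [sup_kerRed_eq ρ ψ ha hb hpow]
    constructor
    · rw [Subgroup.index_map, MonoidHom.range_eq_top.2 ρ.rangeRestrict_surjective,
        Subgroup.index_top, mul_one, sup_eq_left.2, hψ]
      intro σ hσ
      rw [MonoidHom.ker_rangeRestrict, MonoidHom.mem_ker] at hσ
      exact ha σ (by rw [hσ, map_one])
    · rw [Subgroup.index_eq_one, eq_top_iff]
      intro x _
      obtain ⟨σ, hσ, hx⟩ := hdet
      obtain ⟨k, rfl⟩ := hx x
      exact zpow_mem (Subgroup.mem_map_of_mem _ (Subgroup.mem_map_of_mem _ hσ)) k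
  have hA := Nat.dvd_lcm_left a b
  have hB := Nat.dvd_lcm_right a b
  obtain ⟨hidx, hdetidx⟩ := hkey _ (lcmImage_eq ρ.range hA hB)
  have hgcdKer : gcdKer ρ.range hA hB = ⊤ := by
    have : Subsingleton (ZMod (Nat.gcd a b)) := by rw [hgcd]; infer_instance
    rw [eq_top_iff]
    intro g _
    change red _ _ = 1
    exact Units.ext (Subsingleton.elim _ _)
  have hrel : (joinKer ρ.range hA hB).relIndex (gcdKer ρ.range hA hB) = 2 := by
    rw [hgcdKer, Subgroup.relIndex_top_right]
    exact hidx
  have hrep : Represents ρ.range a b (Multiplicative (ZMod 2)) := by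
    refine ⟨hA, hB, hlt, ?_, ?_⟩
    · rw [hgcdKer, lt_top_iff_ne_top]
      intro h
      have h' : (joinKer ρ.range hA hB).index = 2 := hidx
      rw [h, Subgroup.index_top] at h'
      omega
    · have : Fact (Nat.Prime 2) := ⟨Nat.prime_two⟩
      refine ⟨mulEquivOfPrimeCardEq (p := 2) hrel ?_⟩
      simp
  have huniq : ∀ (a' b' : ℕ) (T' : Type) [Group T'], Represents ρ.range a' b' T' →
      a' = a ∧ b' = b ∧ Nonempty (T' ≃* Multiplicative (ZMod 2)) := by
    intro a' b' T' _ h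
    have h' := h
    obtain ⟨ha', hb', hlt', _, ⟨f⟩⟩ := h'
    obtain ⟨rfl, rfl⟩ := hdiv a' b' ha' hb' hlt' h.not_dvd
    obtain ⟨_, _, _, _, ⟨f'⟩⟩ := hrep
    exact ⟨rfl, rfl, ⟨f.symm.trans f'⟩⟩
  refine ⟨⟨⟨hrep, fun a' b' T' _ h _ => ?_⟩, fun a' b' T' _ h => huniq a' b' T' h.1, rfl⟩,
    hA, hB, ?_⟩
  · obtain ⟨rfl, rfl, hT⟩ := huniq a' b' T' h
    exact Or.inl ⟨hT, Or.inl ⟨dvd_rfl, dvd_rfl⟩⟩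
  · have h1 : (joinKer ρ.range hA hB).index = 2 := hidx
    have h2 : ((joinKer ρ.range hA hB).map (Matrix.GeneralLinearGroup.det.comp
      (lcmImage ρ.range hA hB).subtype)).index = 1 := hdetidx
    rw [h1, h2]
    norm_num

end CharacterKernels


/-! ### Bases of torsion subgroups and the representation on them -/

section TorsionBasis

variable {M : Type*} [AddCommGroup M]

/-- `P`, `Q` form a basis of the `m`-torsion of `M` over `ℤ/mℤ`. -/
structure IsTorsionBasis (m : ℕ) (P Q : M) : Prop where
  left : (m : ℤ) • P = 0
  right : (m : ℤ) • Q = 0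
  span : ∀ R : M, (m : ℤ) • R = 0 → ∃ i j : ℤ, R = i • P + j • Q
  indep : ∀ i j : ℤ, i • P + j • Q = 0 → (m : ℤ) ∣ i ∧ (m : ℤ) ∣ j

theorem IsTorsionBasis.add {a b : ℕ} (hab : a.Coprime b) {P Q P' Q' : M}
    (h : IsTorsionBasis a P Q) (h' : IsTorsionBasis b P' Q') :
    IsTorsionBasis (a * b) (P + P') (Q + Q') := by
  have hab' : IsCoprime (a : ℤ) b := Nat.isCoprime_iff_coprime.2 hab
  have kill : ∀ (n : ℕ) (R : M) (k : ℤ), (n : ℤ) • R = 0 → (k * n) • R = 0 := by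
    intro n R k hR; rw [mul_smul, hR, smul_zero]
  constructor
  · push_cast
    rw [smul_add, mul_comm, kill _ _ _ h.left, mul_comm, kill _ _ _ h'.left, add_zero]
  · push_cast
    rw [smul_add, mul_comm, kill _ _ _ h.right, mul_comm, kill _ _ _ h'.right, add_zero]
  · intro R hR
    obtain ⟨u, w, huw⟩ := hab'
    obtain ⟨i, j, hij⟩ := h.span ((w * b) • R) (by
      rw [← mul_smul, show (a : ℤ) * (w * b) = w * ((a * b : ℕ) : ℤ) by push_cast; ring, mul_smul,
        hR, smul_zero])
    obtain ⟨i', j', hij'⟩ := h'.span ((u * a) • R) (by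
      rw [← mul_smul, show (b : ℤ) * (u * a) = u * ((a * b : ℕ) : ℤ) by push_cast; ring, mul_smul,
        hR, smul_zero])
    -- The coefficient is congruent to `x` modulo `a` and to `y` modulo `b`, because `ua + wb = 1`.
    have key : ∀ x y : ℤ, ∀ S S' : M, (a : ℤ) • S = 0 → (b : ℤ) • S' = 0 →
        (x * (w * b) + y * (u * a)) • (S + S') = x • S + y • S' := by
      intro x y S S' hS hS'
      have e1 : x * (w * b) + y * (u * a) = x + ((y - x) * u) * a := by linear_combination x * huw
      have e2 : x * (w * b) + y * (u * a) = y + ((x - y) * w) * b := by linear_combination y * huw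
      rw [smul_add]
      nth_rewrite 1 [e1]
      rw [e2, add_smul, add_smul, kill _ _ _ hS, kill _ _ _ hS', add_zero, add_zero]
    refine ⟨i * (w * b) + i' * (u * a), j * (w * b) + j' * (u * a), ?_⟩
    rw [key _ _ _ _ h.left h'.left, key _ _ _ _ h.right h'.right]
    calc R = (u * a + w * b : ℤ) • R := by rw [huw, one_smul]
      _ = (i' • P' + j' • Q') + (i • P + j • Q) := by rw [add_smul, hij, hij']
      _ = _ := by abel
  · intro i j hij
    have e1 : (i * b) • P + (j * b) • Q = 0 := by
      have := congrArg (fun R => (b : ℤ) • R) hij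
      simp only [smul_add, smul_zero, ← mul_smul, mul_comm (b : ℤ), kill _ _ _ h'.left,
        kill _ _ _ h'.right, add_zero] at this
      exact this
    have e2 : (i * a) • P' + (j * a) • Q' = 0 := by
      have := congrArg (fun R => (a : ℤ) • R) hij
      simp only [smul_add, smul_zero, ← mul_smul, mul_comm (a : ℤ), kill _ _ _ h.left,
        kill _ _ _ h.right, zero_add] at this
      exact this
    obtain ⟨f1, f2⟩ := h.indep _ _ e1
    obtain ⟨f3, f4⟩ := h'.indep _ _ e2
    push_cast
    exact ⟨hab'.mul_dvd (hab'.dvd_of_dvd_mul_right f1) (hab'.symm.dvd_of_dvd_mul_right f3),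
      hab'.mul_dvd (hab'.dvd_of_dvd_mul_right f2) (hab'.symm.dvd_of_dvd_mul_right f4)⟩

/-- Independent `P` and `Q` have `p²` distinct combinations, so an upper bound on the `p`-torsion
suffices to make them span; the structure of `E[p]` need not be known beforehand. -/
theorem isTorsionBasis_of_prime {p : ℕ} (hp : p.Prime) {P Q : M} (hP : (p : ℤ) • P = 0)
    (hQ : (p : ℤ) • Q = 0) (hP0 : P ≠ 0) (hPQ : ∀ i : ℤ, Q ≠ i • P)
    (hfin : {R : M | (p : ℤ) • R = 0}.Finite) (hcard : {R : M | (p : ℤ) • R = 0}.ncard ≤ p ^ 2) :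
    IsTorsionBasis p P Q := by
  have hpz := Nat.prime_iff_prime_int.1 hp
  have hind : ∀ i j : ℤ, i • P + j • Q = 0 → (p : ℤ) ∣ i ∧ (p : ℤ) ∣ j := by
    intro i j hij
    have hj : (p : ℤ) ∣ j := by
      by_contra hj
      obtain ⟨u, w, huw⟩ := (hpz.irreducible.coprime_iff_not_dvd).2 hj
      refine hPQ (-(w * i)) ?_
      calc Q = (u * p + w * j : ℤ) • Q := by rw [huw, one_smul]
        _ = w • (i • P + j • Q) + (-(w * i)) • P := by
          rw [add_smul, mul_smul u, hQ, smul_zero, smul_add, ← mul_smul, ← mul_smul, neg_smul]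
          abel
        _ = _ := by rw [hij, smul_zero, zero_add]
    refine ⟨?_, hj⟩
    obtain ⟨k, rfl⟩ := hj
    rw [mul_comm, mul_smul, hQ, smul_zero, add_zero] at hij
    by_contra hi
    obtain ⟨u, w, huw⟩ := (hpz.irreducible.coprime_iff_not_dvd).2 hi
    apply hP0
    calc P = (u * p + w * i : ℤ) • P := by rw [huw, one_smul]
      _ = 0 := by rw [add_smul, mul_smul, mul_smul, hP, hij, smul_zero, smul_zero, add_zero]
  refine ⟨hP, hQ, ?_, hind⟩
  let f : ℕ × ℕ → M := fun q => (q.1 : ℤ) • P + (q.2 : ℤ) • Q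
  let S : Finset (ℕ × ℕ) := Finset.range p ×ˢ Finset.range p
  have hinj : Set.InjOn f S := by
    rintro ⟨i, j⟩ hij ⟨i', j'⟩ hij' h
    simp only [S, Finset.coe_product, Finset.coe_range, Set.mem_prod, Set.mem_Iio] at hij hij'
    have h0 : ((i : ℤ) - i') • P + ((j : ℤ) - j') • Q = 0 := by
      have h1 : (i : ℤ) • P + (j : ℤ) • Q = (i' : ℤ) • P + (j' : ℤ) • Q := h
      rw [← sub_eq_zero] at h1
      rw [sub_smul, sub_smul, ← h1]
      abel
    obtain ⟨h1, h2⟩ := hind _ _ h0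
    have e1 := Int.eq_zero_of_abs_lt_dvd h1 (by rw [abs_lt]; constructor <;> omega)
    have e2 := Int.eq_zero_of_abs_lt_dvd h2 (by rw [abs_lt]; constructor <;> omega)
    ext <;> simp only <;> omega
  have hsub : f '' S ⊆ {R : M | (p : ℤ) • R = 0} := by
    rintro _ ⟨q, _, rfl⟩
    change (p : ℤ) • ((q.1 : ℤ) • P + (q.2 : ℤ) • Q) = 0
    rw [smul_add, smul_comm, hP, smul_comm, hQ, smul_zero, smul_zero, add_zero]
  have heq : f '' S = {R : M | (p : ℤ) • R = 0} := by
    refine Set.eq_of_subset_of_ncard_le hsub ?_ hfin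
    rw [hinj.ncard_image, Set.ncard_coe_finset, Finset.card_product, Finset.card_range,
      ← pow_two]
    exact hcard
  intro R hR
  have : R ∈ f '' S := heq ▸ hR
  obtain ⟨q, _, rfl⟩ := this
  exact ⟨q.1, q.2, rfl⟩

theorem IsTorsionBasis.exists_addEquiv {n : ℕ} {P Q : M} (h : IsTorsionBasis n P Q) :
    ∃ e : (Fin 2 → ZMod n) ≃+ AddSubgroup.torsionBy M (n : ℤ),
      ∀ i j : ℤ, (e ![(i : ZMod n), (j : ZMod n)] : M) = i • P + j • Q := by
  let f : ∀ R : M, (n : ℤ) • R = 0 → (ZMod n →+ M) := fun R hR =>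
    ZMod.lift n ⟨zmultiplesHom M R, hR⟩
  have hf : ∀ (R : M) (hR : (n : ℤ) • R = 0) (i : ℤ), f R hR (i : ZMod n) = i • R := by
    intro R hR i
    simp [f]
  let g : (Fin 2 → ZMod n) →+ M :=
    (f P h.left).comp (Pi.evalAddMonoidHom _ 0) + (f Q h.right).comp (Pi.evalAddMonoidHom _ 1)
  have hg : ∀ i j : ℤ, g ![(i : ZMod n), (j : ZMod n)] = i • P + j • Q := by
    intro i j
    simp [g, hf]
  have hv : ∀ v : Fin 2 → ZMod n, ∃ i j : ℤ, v = ![(i : ZMod n), (j : ZMod n)] := by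
    intro v
    obtain ⟨i, hi⟩ := ZMod.intCast_surjective (v 0)
    obtain ⟨j, hj⟩ := ZMod.intCast_surjective (v 1)
    refine ⟨i, j, ?_⟩
    ext k; fin_cases k
    · exact hi.symm
    · exact hj.symm
  have hmem : ∀ v, g v ∈ AddSubgroup.torsionBy M (n : ℤ) := by
    intro v
    obtain ⟨i, j, rfl⟩ := hv v
    rw [hg]
    change (n : ℤ) • (i • P + j • Q) = 0
    rw [smul_add, smul_comm, h.left, smul_comm, h.right, smul_zero, smul_zero, add_zero]
  have hbij : Function.Bijective (g.codRestrict _ hmem) := by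
    constructor
    · rw [injective_iff_map_eq_zero]
      intro v hv0
      obtain ⟨i, j, rfl⟩ := hv v
      have h0 : g ![(i : ZMod n), (j : ZMod n)] = 0 := congrArg Subtype.val hv0
      rw [hg] at h0
      obtain ⟨h1, h2⟩ := h.indep i j h0
      rw [(ZMod.intCast_zmod_eq_zero_iff_dvd i n).2 h1, (ZMod.intCast_zmod_eq_zero_iff_dvd j n).2 h2]
      ext k; fin_cases k <;> rfl
    · rintro ⟨R, hR⟩
      obtain ⟨i, j, rfl⟩ := h.span R hR
      exact ⟨![(i : ZMod n), (j : ZMod n)], Subtype.ext (hg i j)⟩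
  exact ⟨AddEquiv.ofBijective _ hbij, hg⟩

end TorsionBasis

/-! ### The matrix representation on torsion and its reductions. -/

section Representation

variable {M : Type*} [AddCommGroup M] {Γ : Type*} [Group Γ] (act : Γ →* AddMonoid.End M) {n : ℕ}
  (e : (Fin 2 → ZMod n) ≃+ AddSubgroup.torsionBy M (n : ℤ))

theorem exists_matrix_of_endomorphism (φ : M →+ M) :
    ∃ A : Matrix (Fin 2) (Fin 2) (ZMod n), ∀ v, φ (e v : M) = (e (A.mulVec v) : M) := by
  have hmem : ∀ v, φ (e v : M) ∈ AddSubgroup.torsionBy M (n : ℤ) := by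
    intro v
    have h : (n : ℤ) • (e v : M) = 0 := (e v).2
    change (n : ℤ) • φ (e v : M) = 0
    rw [← map_zsmul, h, map_zero]
  let ψ : (Fin 2 → ZMod n) →+ (Fin 2 → ZMod n) :=
    e.symm.toAddMonoidHom.comp
      ((φ.comp ((AddSubgroup.subtype _).comp e.toAddMonoidHom)).codRestrict _ hmem)
  let L : (Fin 2 → ZMod n) →ₗ[ZMod n] (Fin 2 → ZMod n) := ψ.toZModLinearMap n
  refine ⟨LinearMap.toMatrix' L, fun v => ?_⟩
  rw [LinearMap.toMatrix'_mulVec]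
  change _ = ((e (e.symm ⟨φ (e v : M), hmem v⟩) : AddSubgroup.torsionBy M (n : ℤ)) : M)
  rw [AddEquiv.apply_symm_apply]

theorem matrix_eq_of_forall_torsion {A B : Matrix (Fin 2) (Fin 2) (ZMod n)}
    (h : ∀ v, (e (A.mulVec v) : M) = (e (B.mulVec v) : M)) : A = B := by
  apply Matrix.mulVec_injective
  funext v
  exact e.injective (Subtype.ext (h v))

/-- The matrix of the action of `σ` on the torsion, in the coordinates `e`. -/
def actMatrix (σ : Γ) : Matrix (Fin 2) (Fin 2) (ZMod n) :=
  (exists_matrix_of_endomorphism e (act σ)).choose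

theorem act_torsion (σ : Γ) (v : Fin 2 → ZMod n) :
    act σ (e v : M) = (e ((actMatrix act e σ).mulVec v) : M) :=
  (exists_matrix_of_endomorphism e (act σ)).choose_spec v

/-- The representation on the torsion, in the coordinates `e`. -/
def torsionRep : Γ →* Matrix.GeneralLinearGroup (Fin 2) (ZMod n) :=
  MonoidHom.toHomUnits
    { toFun := actMatrix act e
      map_one' := by
        refine matrix_eq_of_forall_torsion e fun v => ?_
        rw [← act_torsion, map_one, Matrix.one_mulVec]
        rfl
      map_mul' := fun σ τ => by
        refine matrix_eq_of_forall_torsion e fun v => ?_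
        rw [← act_torsion, map_mul, ← Matrix.mulVec_mulVec, ← act_torsion, ← act_torsion]
        rfl }

theorem torsionRep_val (σ : Γ) :
    (torsionRep act e σ : Matrix (Fin 2) (Fin 2) (ZMod n)) = actMatrix act e σ := rfl

theorem red_apply {m : ℕ} (h : m ∣ n) (g : Matrix.GeneralLinearGroup (Fin 2) (ZMod n))
    (i j : Fin 2) : (red h g : Matrix (Fin 2) (Fin 2) (ZMod m)) i j =
      ZMod.castHom h (ZMod m) ((g : Matrix (Fin 2) (Fin 2) (ZMod n)) i j) := rfl

theorem castHom_eq_zero_iff {a b : ℕ} (hab : a * b = n) (hb : b ≠ 0) (h : a ∣ n) (x : ZMod n) :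
    ZMod.castHom h (ZMod a) x = 0 ↔ (b : ZMod n) * x = 0 := by
  obtain ⟨x, rfl⟩ := ZMod.intCast_surjective x
  rw [map_intCast, ZMod.intCast_zmod_eq_zero_iff_dvd, ← Int.cast_natCast b, ← Int.cast_mul,
    ZMod.intCast_zmod_eq_zero_iff_dvd, ← hab]
  push_cast
  rw [mul_comm]
  exact (mul_dvd_mul_iff_left (by exact_mod_cast hb)).symm

theorem red_eq_one_iff {a b : ℕ} (hab : a * b = n) (hb : b ≠ 0) (h : a ∣ n)
    (g : Matrix.GeneralLinearGroup (Fin 2) (ZMod n)) :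
    red h g = 1 ↔ (b : ZMod n) • ((g : Matrix (Fin 2) (Fin 2) (ZMod n)) - 1) = 0 := by
  rw [Units.ext_iff, ← Matrix.ext_iff, ← Matrix.ext_iff]
  refine forall_congr' fun i => forall_congr' fun j => ?_
  rw [red_apply, Matrix.smul_apply, Matrix.sub_apply, Matrix.zero_apply, smul_eq_mul,
    ← castHom_eq_zero_iff hab hb h, map_sub, sub_eq_zero]
  have : ZMod.castHom h (ZMod a) ((1 : Matrix (Fin 2) (Fin 2) (ZMod n)) i j) =
      ((1 : Matrix.GeneralLinearGroup (Fin 2) (ZMod a)) : Matrix (Fin 2) (Fin 2) (ZMod a)) i j := by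
    rw [Units.val_one, Matrix.one_apply, Matrix.one_apply]
    split_ifs
    · exact map_one _
    · exact map_zero _
  rw [this]

/-- For `n = ab` the `a`-torsion of `(ℤ/n)²` is `b(ℤ/n)²`, and a matrix is trivial modulo `a`
exactly when `b` kills its difference from 1. This identifies `N_a` with the pointwise stabilizer of
the `a`-torsion. -/
theorem red_torsionRep_eq_one_iff {a b : ℕ} (hab : a * b = n) (ha : a ≠ 0) (hb : b ≠ 0)
    (h : a ∣ n) (σ : Γ) : red h (torsionRep act e σ) = 1 ↔ ∀ R : M, (a : ℤ) • R = 0 → act σ R = R := by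
  rw [red_eq_one_iff hab hb, torsionRep_val]
  have hsub : ∀ v, act σ (e v : M) - (e v : M) = (e ((actMatrix act e σ - 1).mulVec v) : M) := by
    intro v
    rw [act_torsion, Matrix.sub_mulVec, Matrix.one_mulVec, map_sub]
    rfl
  have hmulb : ∀ v, (e ((b : ZMod n) • v) : M) = (b : ℤ) • (e v : M) := by
    intro v
    have : (b : ZMod n) • v = b • v := by
      ext i; simp
    rw [this, map_nsmul, natCast_zsmul]
    rfl
  constructor
  · intro h0 R hR
    have hRn : (n : ℤ) • R = 0 := by
      rw [← hab, Nat.cast_mul, mul_comm, mul_smul, hR, smul_zero]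
    obtain ⟨v, hv⟩ := e.surjective ⟨R, hRn⟩
    have hvR : (e v : M) = R := congrArg Subtype.val hv
    have hav : a • v = 0 := by
      apply e.injective
      rw [map_nsmul, map_zero]
      apply Subtype.ext
      change a • (e v : M) = 0
      rw [hvR, ← natCast_zsmul]; exact hR
    have hvi : ∀ i, ∃ w : ZMod n, v i = (b : ZMod n) * w := by
      intro i
      obtain ⟨x, hx⟩ := ZMod.intCast_surjective (v i)
      have h1 := congrFun hav i
      rw [Pi.smul_apply, ← hx, Pi.zero_apply, nsmul_eq_mul, ← Int.cast_natCast a, ← Int.cast_mul,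
        ZMod.intCast_zmod_eq_zero_iff_dvd, ← hab] at h1
      push_cast at h1
      obtain ⟨y, rfl⟩ := (mul_dvd_mul_iff_left (by exact_mod_cast ha)).1 h1
      exact ⟨y, by rw [← hx]; push_cast; ring⟩
    choose w hw using hvi
    have hvw : v = (b : ZMod n) • w := funext hw
    have := hsub v
    rw [hvw, Matrix.mulVec_smul, ← Matrix.smul_mulVec, h0, Matrix.zero_mulVec, map_zero, ← hvw,
      hvR] at this
    exact sub_eq_zero.1 this
  · intro h0
    refine matrix_eq_of_forall_torsion e fun v => ?_
    rw [Matrix.smul_mulVec, ← Matrix.mulVec_smul, ← hsub, Matrix.zero_mulVec, map_zero, hmulb, h0,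
      sub_self]
    · rfl
    · rw [← mul_smul, ← Nat.cast_mul, hab]
      exact (e v).2

theorem mem_range_torsionRep_iff (g : Matrix.GeneralLinearGroup (Fin 2) (ZMod n)) :
    g ∈ (torsionRep act e).range ↔ ∃ σ : Γ, ∀ v : Fin 2 → ZMod n,
      act σ (e v : M) = (e (Matrix.mulVec (g : Matrix (Fin 2) (Fin 2) (ZMod n)) v) : M) := by
  constructor
  · rintro ⟨σ, rfl⟩
    exact ⟨σ, act_torsion act e σ⟩
  · rintro ⟨σ, hσ⟩
    refine ⟨σ, Units.ext (matrix_eq_of_forall_torsion e fun v => ?_)⟩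
    rw [torsionRep_val, ← act_torsion, hσ]

/-- The points `bP`, `bQ` represent the basis of the `a`-torsion; a triangular action on them
determines the matrix modulo `a`, with diagonal `x`, `z`. -/
theorem det_torsionRep_of_triangular {a b : ℕ} (hab : a * b = n) (hb : b ≠ 0) (h : a ∣ n)
    {P Q : M} (he : ∀ i j : ℤ, (e ![(i : ZMod n), (j : ZMod n)] : M) = i • P + j • Q) (σ : Γ)
    {x y z : ℤ} (hP : act σ ((b : ℤ) • P) = x • (b : ℤ) • P)
    (hQ : act σ ((b : ℤ) • Q) = y • (b : ℤ) • P + z • (b : ℤ) • Q) :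
    ZMod.castHom h (ZMod a) (Matrix.GeneralLinearGroup.det (torsionRep act e σ) : ZMod n) =
      x * z := by
  set A := actMatrix act e σ with hA
  have e1 : (b : ℤ) • P = (e ![((b : ℤ) : ZMod n), ((0 : ℤ) : ZMod n)] : M) := by rw [he]; simp
  have e2 : (b : ℤ) • Q = (e ![((0 : ℤ) : ZMod n), ((b : ℤ) : ZMod n)] : M) := by rw [he]; simp
  have c1 : x • (b : ℤ) • P = (e ![((x * b : ℤ) : ZMod n), ((0 : ℤ) : ZMod n)] : M) := by
    rw [he]; simp [mul_smul]
  have c2 : y • (b : ℤ) • P + z • (b : ℤ) • Q =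
      (e ![((y * b : ℤ) : ZMod n), ((z * b : ℤ) : ZMod n)] : M) := by
    rw [he]; simp [mul_smul]
  rw [c1, e1, act_torsion] at hP
  rw [c2, e2, act_torsion] at hQ
  have hP' := e.injective (Subtype.ext hP)
  have hQ' := e.injective (Subtype.ext hQ)
  have p0 := congrFun hP' 0
  have p1 := congrFun hP' 1
  have q0 := congrFun hQ' 0
  have q1 := congrFun hQ' 1
  simp only [Matrix.mulVec, dotProduct, Fin.sum_univ_two, Matrix.cons_val_zero,
    Matrix.cons_val_one, ← hA] at p0 p1 q0 q1
  push_cast at p0 p1 q0 q1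
  have hcast := castHom_eq_zero_iff hab hb h
  have r00 : ZMod.castHom h (ZMod a) (A 0 0) = x := by
    have := (hcast (A 0 0 - x)).2 (by linear_combination p0)
    rw [map_sub, map_intCast, sub_eq_zero] at this; exact this
  have r10 : ZMod.castHom h (ZMod a) (A 1 0) = 0 := (hcast (A 1 0)).2 (by linear_combination p1)
  have r11 : ZMod.castHom h (ZMod a) (A 1 1) = z := by
    have := (hcast (A 1 1 - z)).2 (by linear_combination q1)
    rw [map_sub, map_intCast, sub_eq_zero] at this; exact this
  have hdet : (Matrix.GeneralLinearGroup.det (torsionRep act e σ) : ZMod n) = A.det := rfl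
  rw [hdet, Matrix.det_fin_two, map_sub, map_mul, map_mul, r00, r10, r11, mul_zero, sub_zero]

end Representation


/-! ### Points of short Weierstrass curves -/

section ShortWeierstrass

open WeierstrassCurve.Affine

variable {F : Type*} [Field F] {W : WeierstrassCurve.Affine F} {A B : F}

/-- The abscissa of a point, with the value `0` at the point at infinity. -/
def xCoord : W.Point → F
  | .zero => 0
  | .some x _ _ => x

/-- The ordinate of a point, with the value `0` at the point at infinity. -/
def yCoord : W.Point → F
  | .zero => 0
  | .some _ y _ => y

/-- `W` is the elliptic curve `y² = x³ + A x + B`. -/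
structure IsShort (W : WeierstrassCurve.Affine F) (A B : F) : Prop where
  eq : W = ⟨0, 0, 0, A, B⟩
  disc : 4 * A ^ 3 + 27 * B ^ 2 ≠ 0

theorem exists_eq_some {R : W.Point} (hR : R ≠ 0) : ∃ x y h, R = .some x y h := by
  cases R with
  | zero => exact absurd rfl hR
  | some x y h => exact ⟨x, y, h, rfl⟩

theorem xCoord_neg (R : W.Point) : xCoord (-R) = xCoord R := by
  cases R <;> rfl

theorem eq_or_eq_neg_of_xCoord {R S : W.Point} (hR : R ≠ 0) (hS : S ≠ 0)
    (h : xCoord R = xCoord S) : R = S ∨ R = -S := by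
  obtain ⟨x, y, hxy, rfl⟩ := exists_eq_some hR
  obtain ⟨x', y', hxy', rfl⟩ := exists_eq_some hS
  exact Point.X_eq_iff.1 h

section GroupLaw

variable (hW : IsShort W A B)
include hW

theorem IsShort.negY_eq (x y : F) : W.negY x y = -y := by
  rw [hW.eq]; simp [negY]

theorem IsShort.addX_eq (x x' l : F) : W.addX x x' l = l ^ 2 - x - x' := by
  rw [hW.eq]; simp [addX]

theorem IsShort.addY_eq (x x' y l : F) : W.addY x x' y l = -(l * (l ^ 2 - x - x' - x) + y) := by
  rw [hW.eq]; simp [addY, negY, negAddY, addX]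

theorem IsShort.yCoord_neg (R : W.Point) : yCoord (-R) = -yCoord R := by
  cases R with
  | zero => change (0 : F) = -0; simp
  | some x y h => exact hW.negY_eq x y

theorem IsShort.nonsingular_iff [CharZero F] (x y : F) :
    W.Nonsingular x y ↔ y ^ 2 = x ^ 3 + A * x + B := by
  have hΔ : W.Δ ≠ 0 := by
    have : W.Δ = -16 * (4 * A ^ 3 + 27 * B ^ 2) := by
      rw [hW.eq]
      simp [WeierstrassCurve.Δ, WeierstrassCurve.b₂, WeierstrassCurve.b₄, WeierstrassCurve.b₆,
        WeierstrassCurve.b₈]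
      ring
    rw [this]
    exact mul_ne_zero (by norm_num) hW.disc
  rw [← equation_iff_nonsingular_of_Δ_ne_zero hΔ, equation_iff, hW.eq]
  simp

theorem IsShort.equation [CharZero F] {R : W.Point} (hR : R ≠ 0) :
    yCoord R ^ 2 = xCoord R ^ 3 + A * xCoord R + B := by
  obtain ⟨x, y, h, rfl⟩ := exists_eq_some hR
  exact (hW.nonsingular_iff x y).1 h

theorem IsShort.exists_point [CharZero F] {x y : F} (h : y ^ 2 = x ^ 3 + A * x + B) :
    ∃ R : W.Point, R ≠ 0 ∧ xCoord R = x ∧ yCoord R = y :=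
  ⟨.some x y ((hW.nonsingular_iff x y).2 h), Point.some_ne_zero _, rfl, rfl⟩

theorem IsShort.exists_point_of_xCoord [CharZero F] [IsAlgClosed F] (x : F) :
    ∃ R : W.Point, R ≠ 0 ∧ xCoord R = x := by
  obtain ⟨y, hy⟩ := IsAlgClosed.exists_pow_nat_eq (x ^ 3 + A * x + B) two_pos
  obtain ⟨R, h1, h2, _⟩ := hW.exists_point hy
  exact ⟨R, h1, h2⟩

/-- The vertical derivative and the horizontal one do not vanish together. -/
theorem IsShort.slope_ne_zero [CharZero F] {x : F} (h : x ^ 3 + A * x + B = 0) :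
    3 * x ^ 2 + A ≠ 0 := by
  intro h'
  apply hW.disc
  have hA : A = -3 * x ^ 2 := by linear_combination h'
  subst hA
  have hB : B = 2 * x ^ 3 := by linear_combination h
  subst hB
  ring

variable [DecidableEq F]

theorem IsShort.add_of_ne {R S : W.Point} (hR : R ≠ 0) (hS : S ≠ 0) (h : xCoord R ≠ xCoord S) :
    R + S ≠ 0 ∧
    xCoord (R + S) = ((yCoord R - yCoord S) / (xCoord R - xCoord S)) ^ 2 - xCoord R - xCoord S ∧
    yCoord (R + S) = -((yCoord R - yCoord S) / (xCoord R - xCoord S) *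
      (xCoord (R + S) - xCoord R) + yCoord R) := by
  obtain ⟨x, y, hxy, rfl⟩ := exists_eq_some hR
  obtain ⟨x', y', hxy', rfl⟩ := exists_eq_some hS
  have h' : x ≠ x' := h
  rw [Point.add_of_X_ne h']
  refine ⟨Point.some_ne_zero _, ?_, ?_⟩
  · change W.addX _ _ _ = _
    rw [hW.addX_eq, slope_of_X_ne h']
    rfl
  · change W.addY _ _ _ _ = -(_ * (W.addX _ _ _ - _) + _)
    rw [hW.addX_eq, hW.addY_eq, slope_of_X_ne h']
    rfl

theorem IsShort.add_self_eq_zero_iff [CharZero F] {R : W.Point} (hR : R ≠ 0) :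
    R + R = 0 ↔ yCoord R = 0 := by
  rw [add_eq_zero_iff_eq_neg]
  obtain ⟨x, y, hxy, rfl⟩ := exists_eq_some hR
  change _ ↔ y = 0
  rw [Point.neg_some, Point.some.injEq]
  simp only [hW.negY_eq, true_and]
  exact self_eq_neg

theorem IsShort.double [CharZero F] {R : W.Point} (hR : R ≠ 0) (h : yCoord R ≠ 0) :
    R + R ≠ 0 ∧
    xCoord (R + R) = ((3 * xCoord R ^ 2 + A) / (2 * yCoord R)) ^ 2 - 2 * xCoord R ∧
    yCoord (R + R) = -((3 * xCoord R ^ 2 + A) / (2 * yCoord R) *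
      (xCoord (R + R) - xCoord R) + yCoord R) := by
  obtain ⟨x, y, hxy, rfl⟩ := exists_eq_some hR
  have h0 : y ≠ 0 := h
  have h' : y ≠ W.negY x y := by
    rw [hW.negY_eq]; exact fun e => h0 (self_eq_neg.1 e)
  have hs : W.slope x x y y = (3 * x ^ 2 + A) / (2 * y) := by
    rw [slope_of_Y_ne rfl h', hW.negY_eq, hW.eq]
    simp
    ring
  rw [Point.add_self_of_Y_ne h']
  refine ⟨Point.some_ne_zero _, ?_, ?_⟩
  · change W.addX _ _ _ = ((3 * x ^ 2 + A) / (2 * y)) ^ 2 - 2 * x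
    rw [hW.addX_eq, hs]
    ring
  · change W.addY _ _ _ _ = -((3 * x ^ 2 + A) / (2 * y) * (W.addX _ _ _ - x) + y)
    rw [hW.addX_eq, hW.addY_eq, hs]

/-- The products of ordinates cancel in the sum, leaving a rational function of the two abscissas.
Sums over cosets of a cyclic group thereby become functions of one abscissa. -/
theorem IsShort.xCoord_add_add_xCoord_sub [CharZero F] {R S : W.Point} (hR : R ≠ 0) (hS : S ≠ 0)
    (h : xCoord R ≠ xCoord S) : xCoord (R + S) + xCoord (R - S) =
      (2 * (xCoord R + xCoord S) * (xCoord R * xCoord S + A) + 4 * B) /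
        (xCoord R - xCoord S) ^ 2 := by
  have hS' : -S ≠ 0 := neg_ne_zero.2 hS
  have h1 := (hW.add_of_ne hR hS h).2.1
  have h2 := (hW.add_of_ne hR hS' (by rwa [xCoord_neg])).2.1
  rw [xCoord_neg, hW.yCoord_neg] at h2
  rw [sub_eq_add_neg R S, h1, h2]
  have e1 := hW.equation hR
  have e2 := hW.equation hS
  have h0 := sub_ne_zero.2 h
  field_simp
  linear_combination 2 * e1 + 2 * e2

end GroupLaw

end ShortWeierstrass

/-! ### Torsion of order two, three and five -/

section SmallTorsion

variable {F : Type*} [Field F] {W : WeierstrassCurve.Affine F} {A B : F}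

/-- The third division polynomial of `y² = x³ + A x + B`. -/
def psi₃ (A B x : F) : F := 3 * x ^ 4 + 6 * A * x ^ 2 + 12 * B * x - A ^ 2

/-- The fifth division polynomial of `y² = x³ + A x + B`, up to sign. -/
def psi₅ (A B x : F) : F :=
  (4 * (x ^ 3 + A * x + B)) ^ 4 -
    2 * (3 * x ^ 2 + A) * psi₃ A B x * (4 * (x ^ 3 + A * x + B)) ^ 2 + psi₃ A B x ^ 3

-- Each abscissa belongs to at most two points, and infinity adds one. With degrees 4 and 12 this
-- gives exactly `3²` and `5²`.
open Classical in
theorem ncard_le_of_xCoord_root {T : Set W.Point} {p : Polynomial F} {d : ℕ} (hp : p.coeff d ≠ 0)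
    (hd : p.natDegree ≤ d) (hT : ∀ R ∈ T, R ≠ 0 → p.eval (xCoord R) = 0) :
    T.Finite ∧ T.ncard ≤ 2 * d + 1 := by
  have hp0 : p ≠ 0 := fun h => hp (by rw [h, Polynomial.coeff_zero])
  let f : F → W.Point := fun x =>
    if h : ∃ R : W.Point, R ≠ 0 ∧ xCoord R = x then h.choose else 0
  have hf : ∀ R : W.Point, R ≠ 0 → R = f (xCoord R) ∨ R = -f (xCoord R) := by
    intro R hR
    have h : ∃ S : W.Point, S ≠ 0 ∧ xCoord S = xCoord R := ⟨R, hR, rfl⟩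
    have hfR : f (xCoord R) = h.choose := dif_pos h
    rw [hfR]
    exact eq_or_eq_neg_of_xCoord hR h.choose_spec.1 h.choose_spec.2.symm
  let U : Finset W.Point := insert 0 (p.roots.toFinset.biUnion fun x => {f x, -f x})
  have hTU : T ⊆ U := by
    intro R hR
    rw [Finset.mem_coe, Finset.mem_insert]
    by_cases h0 : R = 0
    · exact Or.inl h0
    · refine Or.inr (Finset.mem_biUnion.2 ⟨xCoord R, ?_, ?_⟩)
      · rw [Multiset.mem_toFinset, Polynomial.mem_roots hp0]
        exact hT R hR h0
      · rw [Finset.mem_insert, Finset.mem_singleton]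
        exact hf R h0
  refine ⟨U.finite_toSet.subset hTU, ?_⟩
  calc T.ncard ≤ (U : Set W.Point).ncard := Set.ncard_le_ncard hTU U.finite_toSet
    _ = U.card := Set.ncard_coe_finset U
    _ ≤ (p.roots.toFinset.biUnion fun x => {f x, -f x}).card + 1 := Finset.card_insert_le _ _
    _ ≤ p.roots.toFinset.card * 2 + 1 := by
        gcongr
        exact Finset.card_biUnion_le_card_mul _ _ _ fun x _ => Finset.card_le_two
    _ ≤ 2 * d + 1 := by
        have := (Multiset.toFinset_card_le p.roots).trans (p.card_roots'.trans hd)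
        omega

variable [DecidableEq F] [CharZero F] (hW : IsShort W A B)
include hW

theorem IsShort.two_zsmul_eq_zero_iff {R : W.Point} (hR : R ≠ 0) :
    (2 : ℤ) • R = 0 ↔ yCoord R = 0 := by
  rw [two_zsmul, hW.add_self_eq_zero_iff hR]

/-- `3R = 0` means `2R = -R`, that is, `R` and `2R` share their abscissa, since `2R = R` is
impossible. If `y = 0`, then `3R = R ≠ 0` and the polynomial equals `-(3x² + A)²`, which is not
zero. -/
theorem IsShort.three_zsmul_eq_zero_iff {R : W.Point} (hR : R ≠ 0) :
    (3 : ℤ) • R = 0 ↔ psi₃ A B (xCoord R) = 0 := by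
  have e3 : (3 : ℤ) • R = R + R + R := by
    rw [show (3 : ℤ) = 1 + 1 + 1 by norm_num, add_zsmul, add_zsmul, one_zsmul]
  have heq := hW.equation hR
  rw [e3]
  by_cases hy : yCoord R = 0
  · rw [(hW.add_self_eq_zero_iff hR).2 hy, zero_add]
    refine iff_of_false hR fun h => ?_
    rw [hy, eq_comm, zero_pow two_ne_zero] at heq
    refine hW.slope_ne_zero heq (pow_eq_zero_iff two_ne_zero |>.1 ?_)
    unfold psi₃ at h
    linear_combination -h + 12 * (xCoord R) * heq
  · obtain ⟨h1, h2, -⟩ := hW.double hR hy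
    have key : R + R + R = 0 ↔ xCoord (R + R) = xCoord R := by
      constructor
      · intro h
        rw [add_eq_zero_iff_eq_neg] at h
        rw [h, xCoord_neg]
      · intro h
        rcases eq_or_eq_neg_of_xCoord h1 hR h with h | h
        · exact absurd (add_eq_left.1 h) hR
        · rw [h, neg_add_cancel]
    rw [key, h2, div_pow, sub_eq_iff_eq_add, div_eq_iff (pow_ne_zero 2 (mul_ne_zero two_ne_zero hy))]
    unfold psi₃
    constructor
    · intro h; linear_combination -h - 12 * xCoord R * heq
    · intro h; linear_combination -h - 12 * xCoord R * heq

/-- Generically `5R = 0` means that `3R` and `2R` share their abscissa, with `3R = 2R + R` computed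
by the chord formula. The points with `2R = 0` or `3R = 0`, where this formula breaks down, are
checked separately. -/
theorem IsShort.five_zsmul_eq_zero_iff {R : W.Point} (hR : R ≠ 0) :
    (5 : ℤ) • R = 0 ↔ psi₅ A B (xCoord R) = 0 := by
  have e5 : (5 : ℤ) • R = (R + R + R) + (R + R) := by
    rw [show (5 : ℤ) = 1 + 1 + 1 + (1 + 1) by norm_num]
    simp only [add_zsmul, one_zsmul]
  have heq := hW.equation hR
  rw [e5]
  by_cases hy : yCoord R = 0
  · rw [(hW.add_self_eq_zero_iff hR).2 hy, zero_add, add_zero]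
    refine iff_of_false hR fun h => ?_
    rw [hy, eq_comm, zero_pow two_ne_zero] at heq
    have hψ : psi₃ A B (xCoord R) = -(3 * xCoord R ^ 2 + A) ^ 2 := by
      unfold psi₃; linear_combination 12 * (xCoord R) * heq
    rw [psi₅, heq, hψ] at h
    refine hW.slope_ne_zero heq (pow_eq_zero_iff (n := 6) (by norm_num) |>.1 ?_)
    linear_combination -h
  · obtain ⟨h1, h2, h3⟩ := hW.double hR hy
    have hY : 4 * (xCoord R ^ 3 + A * xCoord R + B) = (2 * yCoord R) ^ 2 := by
      linear_combination -4 * heq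
    have hY0 : 2 * yCoord R ≠ 0 := mul_ne_zero two_ne_zero hy
    by_cases hψ : psi₃ A B (xCoord R) = 0
    · have := (hW.three_zsmul_eq_zero_iff hR).2 hψ
      rw [show (3 : ℤ) = 1 + 1 + 1 by norm_num, add_zsmul, add_zsmul, one_zsmul] at this
      rw [this, zero_add]
      refine iff_of_false h1 fun h => ?_
      rw [psi₅, hψ, hY] at h
      apply hY0
      refine pow_eq_zero_iff (n := 8) (by norm_num) |>.1 ?_
      linear_combination h
    · have hx : xCoord (R + R) - xCoord R = -psi₃ A B (xCoord R) / (2 * yCoord R) ^ 2 := by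
        rw [h2, div_pow, eq_div_iff (pow_ne_zero 2 hY0), sub_mul, sub_mul,
          div_mul_cancel₀ _ (pow_ne_zero 2 hY0), psi₃]
        linear_combination -12 * xCoord R * heq
      have hne : xCoord (R + R) ≠ xCoord R := by
        rw [← sub_ne_zero, hx]
        exact div_ne_zero (neg_ne_zero.2 hψ) (pow_ne_zero 2 hY0)
      obtain ⟨k1, k2, -⟩ := hW.add_of_ne h1 hR hne
      have key : (R + R + R) + (R + R) = 0 ↔ xCoord (R + R + R) = xCoord (R + R) := by
        constructor
        · intro h
          rw [add_eq_zero_iff_eq_neg] at h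
          rw [h, xCoord_neg]
        · intro h
          rcases eq_or_eq_neg_of_xCoord k1 h1 h with h | h
          · exact absurd (add_eq_left.1 h) hR
          · rw [h, neg_add_cancel]
      have hx' : xCoord (R + R) = xCoord R - psi₃ A B (xCoord R) / (2 * yCoord R) ^ 2 := by
        linear_combination hx
      rw [key, k2, h3, hx]
      have hlam : ((3 * xCoord R ^ 2 + A) / (2 * yCoord R)) ^ 2 =
          3 * xCoord R - psi₃ A B (xCoord R) / (2 * yCoord R) ^ 2 := by
        linear_combination hx' - h2
      have hμ : (-((3 * xCoord R ^ 2 + A) / (2 * yCoord R) *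
          (-psi₃ A B (xCoord R) / (2 * yCoord R) ^ 2) + yCoord R) - yCoord R) /
          (-psi₃ A B (xCoord R) / (2 * yCoord R) ^ 2) =
          -((3 * xCoord R ^ 2 + A) / (2 * yCoord R)) +
            (2 * yCoord R) ^ 3 / psi₃ A B (xCoord R) := by
        field_simp
        ring
      rw [hμ, hx', psi₅, hY, ← sub_eq_zero]
      have : (-((3 * xCoord R ^ 2 + A) / (2 * yCoord R)) +
            (2 * yCoord R) ^ 3 / psi₃ A B (xCoord R)) ^ 2 -
            (xCoord R - psi₃ A B (xCoord R) / (2 * yCoord R) ^ 2) - xCoord R -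
            (xCoord R - psi₃ A B (xCoord R) / (2 * yCoord R) ^ 2) =
          (((2 * yCoord R) ^ 2) ^ 4 - 2 * (3 * xCoord R ^ 2 + A) * psi₃ A B (xCoord R) *
            ((2 * yCoord R) ^ 2) ^ 2 + psi₃ A B (xCoord R) ^ 3) /
            (psi₃ A B (xCoord R) ^ 2 * (2 * yCoord R) ^ 2) := by
        -- After the square of the tangent slope is replaced through `hlam`, the slope survives only
        -- multiplied by an odd power of `2y`, so the result depends on `y²` alone.
        have e : (-((3 * xCoord R ^ 2 + A) / (2 * yCoord R)) +
            (2 * yCoord R) ^ 3 / psi₃ A B (xCoord R)) ^ 2 =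
            3 * xCoord R - psi₃ A B (xCoord R) / (2 * yCoord R) ^ 2 -
            2 * ((3 * xCoord R ^ 2 + A) / (2 * yCoord R)) * ((2 * yCoord R) ^ 3 / psi₃ A B (xCoord R)) +
            ((2 * yCoord R) ^ 3 / psi₃ A B (xCoord R)) ^ 2 := by
          rw [← hlam]; ring
        rw [e]
        field_simp
        ring
      rw [this, div_eq_zero_iff]
      exact or_iff_left (mul_ne_zero (pow_ne_zero 2 hψ) (pow_ne_zero 2 hY0))

open Polynomial in
theorem IsShort.ncard_three_torsion :
    {R : W.Point | ((3 : ℕ) : ℤ) • R = 0}.Finite ∧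
      {R : W.Point | ((3 : ℕ) : ℤ) • R = 0}.ncard ≤ 3 ^ 2 := by
  let p : F[X] := 3 * X ^ 4 + C (6 * A) * X ^ 2 + C (12 * B) * X - C (A ^ 2)
  have hc : p.coeff 4 = 3 := by
    simp only [p]; compute_degree!
  have hd : p.natDegree ≤ 4 := by
    simp only [p]; compute_degree!
  refine ncard_le_of_xCoord_root (p := p) (d := 4) (by rw [hc]; norm_num) hd ?_
  intro R hR h0
  have := (hW.three_zsmul_eq_zero_iff h0).1 hR
  rw [psi₃] at this
  simp only [p, eval_sub, eval_add, eval_mul, eval_pow, eval_X, eval_C, eval_ofNat]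
  exact this

open Polynomial in
theorem IsShort.ncard_five_torsion :
    {R : W.Point | ((5 : ℕ) : ℤ) • R = 0}.Finite ∧
      {R : W.Point | ((5 : ℕ) : ℤ) • R = 0}.ncard ≤ 5 ^ 2 := by
  let p : F[X] := 3 * X ^ 4 + C (6 * A) * X ^ 2 + C (12 * B) * X - C (A ^ 2)
  let q : F[X] := 4 * (X ^ 3 + C A * X + C B)
  let s : F[X] := q ^ 4 - 2 * (3 * X ^ 2 + C A) * p * q ^ 2 + p ^ 3
  have hc : s.coeff 12 = -5 := by
    simp only [s, p, q]; compute_degree!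
  have hd : s.natDegree ≤ 12 := by
    simp only [s, p, q]; compute_degree!
  refine ncard_le_of_xCoord_root (p := s) (d := 12) (by rw [hc]; norm_num) hd ?_
  intro R hR h0
  have := (hW.five_zsmul_eq_zero_iff h0).1 hR
  rw [psi₅, psi₃] at this
  simp only [s, p, q, eval_sub, eval_add, eval_mul, eval_pow, eval_X, eval_C, eval_ofNat]
  exact this

end SmallTorsion


/-! ### The Galois action -/

section Galois

open Classical

/-- The absolute Galois group of `ℚ`. -/
abbrev AbsGal : Type := AlgebraicClosure ℚ ≃ₐ[ℚ] AlgebraicClosure ℚ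

/-- The action of the absolute Galois group on the geometric points. -/
def galAct (E : WeierstrassCurve ℚ) : AbsGal →* AddMonoid.End (GeomPoint E) where
  toFun σ := WeierstrassCurve.Affine.Point.map (W' := E) σ.toAlgHom
  map_one' := by
    ext R
    cases R <;> rfl
  map_mul' σ τ := by
    ext R
    cases R <;> rfl

theorem xCoord_galAct {E : WeierstrassCurve ℚ} (σ : AbsGal) (R : GeomPoint E) :
    xCoord (galAct E σ R) = σ (xCoord R) := by
  cases R with
  | zero => exact (map_zero σ).symm
  | some x y h => rfl

theorem galAct_inv_apply {E : WeierstrassCurve ℚ} (σ : AbsGal) (R : GeomPoint E) :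
    galAct E σ⁻¹ (galAct E σ R) = R := by
  change (galAct E σ⁻¹ * galAct E σ) R = R
  rw [← map_mul, inv_mul_cancel, map_one]
  rfl

theorem galAct_injective {E : WeierstrassCurve ℚ} (σ : AbsGal) :
    Function.Injective (galAct E σ) :=
  Function.LeftInverse.injective (galAct_inv_apply σ)

theorem galAct_ne_zero {E : WeierstrassCurve ℚ} (σ : AbsGal) {R : GeomPoint E} (hR : R ≠ 0) :
    galAct E σ R ≠ 0 :=
  fun h => hR (galAct_injective σ (h.trans (map_zero _).symm))

theorem galAct_mul_apply {E : WeierstrassCurve ℚ} (σ τ : AbsGal) (R : GeomPoint E) :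
    galAct E (σ * τ) R = galAct E σ (galAct E τ R) := by
  rw [map_mul]; rfl

theorem galAct_pow_fixed {E : WeierstrassCurve ℚ} {σ : AbsGal} {R : GeomPoint E}
    (h : galAct E σ R = R) (k : ℕ) : galAct E (σ ^ k) R = R := by
  induction k with
  | zero => rw [pow_zero, map_one]; rfl
  | succ k ih => rw [pow_succ, galAct_mul_apply, h, ih]

theorem eq_or_eq_neg_of_galAct_xCoord {E : WeierstrassCurve ℚ} {σ : AbsGal} {R : GeomPoint E}
    (hR : R ≠ 0) (h : σ (xCoord R) = xCoord R) : galAct E σ R = R ∨ galAct E σ R = -R :=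
  eq_or_eq_neg_of_xCoord (galAct_ne_zero σ hR) hR (by rw [xCoord_galAct, h])

theorem isShort_shortCurve {A B : ℤ} (h : 4 * A ^ 3 + 27 * B ^ 2 ≠ 0) :
    IsShort ((shortCurve A B).baseChange (AlgebraicClosure ℚ)).toAffine (A : AlgebraicClosure ℚ)
      (B : AlgebraicClosure ℚ) where
  eq := by
    ext <;> simp [shortCurve, WeierstrassCurve.baseChange]
  disc := by exact_mod_cast h

/-! ### Square roots and automorphisms -/

theorem apply_sqrt {x : AlgebraicClosure ℚ} {C : ℤ} (hx : x ^ 2 = C) (σ : AbsGal) :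
    σ x = x ∨ σ x = -x := by
  rw [← sq_eq_sq_iff_eq_or_eq_neg, ← map_pow, hx, map_intCast]

instance isGalois_algebraicClosure : IsGalois ℚ (AlgebraicClosure ℚ) := by
  have : Algebra.IsAlgebraic ℚ (AlgebraicClosure ℚ) := AlgebraicClosure.isAlgebraic ℚ
  have : IsAlgClosure ℚ (AlgebraicClosure ℚ) := ⟨inferInstance, inferInstance⟩
  exact IsAlgClosure.isGalois ℚ _

theorem exists_apply_eq_neg {x : AlgebraicClosure ℚ} {C : ℤ} (hx : x ^ 2 = C)
    (hC : ¬ IsSquare C) : ∃ σ : AbsGal, σ x = -x := by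
  by_contra! h
  have hfix : ∀ σ : AbsGal, σ x = x := fun σ => (apply_sqrt hx σ).resolve_right (h σ)
  obtain ⟨q, hq⟩ := IntermediateField.mem_bot.1 ((InfiniteGalois.mem_bot_iff_fixed x).2 hfix)
  apply hC
  rw [← Rat.isSquare_intCast_iff]
  refine ⟨q, (algebraMap ℚ (AlgebraicClosure ℚ)).injective ?_⟩
  rw [map_mul, hq, ← pow_two, hx, map_intCast]

/-- Take `σ` negating `t` and `τ` negating `ct`; one of `σ`, `τ`, `στ` fixes `c` and negates `t`. -/
theorem exists_fixed_and_apply_eq_neg {c t : AlgebraicClosure ℚ} {C T : ℤ} (hc : c ^ 2 = C)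
    (ht : t ^ 2 = T) (hT : ¬ IsSquare T) (hCT : ¬ IsSquare (C * T)) :
    ∃ σ : AbsGal, σ c = c ∧ σ t = -t := by
  have hC0 : C ≠ 0 := by rintro rfl; exact hCT ⟨0, by simp⟩
  have hT0 : T ≠ 0 := by rintro rfl; exact hCT ⟨0, by simp⟩
  have hc0 : c ≠ 0 := by
    rintro rfl; rw [zero_pow two_ne_zero, eq_comm, Int.cast_eq_zero] at hc; exact hC0 hc
  have ht0 : t ≠ 0 := by
    rintro rfl; rw [zero_pow two_ne_zero, eq_comm, Int.cast_eq_zero] at ht; exact hT0 ht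
  obtain ⟨σ, hσ⟩ := exists_apply_eq_neg ht hT
  obtain ⟨τ, hτ⟩ := exists_apply_eq_neg (x := c * t) (C := C * T)
    (by rw [mul_pow, hc, ht]; push_cast; rfl) hCT
  rw [map_mul] at hτ
  have hct := mul_ne_zero hc0 ht0
  rcases apply_sqrt hc σ with h | h
  · exact ⟨σ, h, hσ⟩
  rcases apply_sqrt hc τ with h' | h' <;> rcases apply_sqrt ht τ with h'' | h'' <;>
    rw [h', h''] at hτ
  · exact absurd (self_eq_neg.1 hτ) hct
  · exact ⟨τ, h', h''⟩
  · refine ⟨σ * τ, ?_, ?_⟩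
    · rw [AlgEquiv.mul_apply, h', map_neg, h, neg_neg]
    · rw [AlgEquiv.mul_apply, h'', hσ]
  · rw [neg_mul_neg] at hτ
    exact absurd (self_eq_neg.1 hτ) hct

theorem exists_sign_character {c : AlgebraicClosure ℚ} {C : ℤ} (hc : c ^ 2 = C)
    (hC : C ≠ 0) : ∃ ψ : AbsGal →* ℤˣ, ∀ σ, ψ σ = 1 ↔ σ c = c := by
  have hc0 : c ≠ 0 := by
    rintro rfl; rw [zero_pow two_ne_zero, eq_comm, Int.cast_eq_zero] at hc; exact hC hc
  have hne : -c ≠ c := fun h => hc0 (neg_eq_self.1 h)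
  refine ⟨{ toFun := fun σ => if σ c = c then 1 else -1, map_one' := by simp, map_mul' := ?_ }, ?_⟩
  · intro σ τ
    rcases apply_sqrt hc σ with h | h <;> rcases apply_sqrt hc τ with h' | h' <;>
      simp [h, h', hne]
  · intro σ
    change (if σ c = c then (1 : ℤˣ) else -1) = 1 ↔ _
    split_ifs with h
    · simp [h]
    · simp only [h, iff_false]; decide

end Galois

/-! ### The two-torsion -/

section TwoTorsion

variable {F : Type*} [Field F] [CharZero F] [IsAlgClosed F] {A B : F}

theorem exists_cubic_roots (A B : F) : ∃ x y z : F, x + y + z = 0 ∧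
    A = x * y + x * z + y * z ∧ B = -(x * y * z) := by
  obtain ⟨x, hx⟩ := IsAlgClosed.exists_root
    (Polynomial.X ^ 3 + Polynomial.C A * Polynomial.X + Polynomial.C B) (by
      have : (Polynomial.X ^ 3 + Polynomial.C A * Polynomial.X + Polynomial.C B).degree = 3 := by
        compute_degree!
      rw [this]; decide)
  simp only [Polynomial.IsRoot, Polynomial.eval_add, Polynomial.eval_mul, Polynomial.eval_pow,
    Polynomial.eval_X, Polynomial.eval_C] at hx
  obtain ⟨d, hd⟩ := IsAlgClosed.exists_pow_nat_eq (x ^ 2 - 4 * (A + x ^ 2)) two_pos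
  refine ⟨x, (-x + d) / 2, (-x - d) / 2, by ring, ?_, ?_⟩
  · linear_combination (1 / 4 : F) * hd
  · linear_combination hx + (-x / 4 : F) * hd

theorem neg_disc_eq_sq {F : Type*} [Field F] {x y z : F} (h : x + y + z = 0) :
    -(4 * (x * y + x * z + y * z) ^ 3 + 27 * (-(x * y * z)) ^ 2) =
      ((x - y) * (x - z) * (y - z)) ^ 2 := by
  obtain rfl : z = -x - y := by linear_combination h
  ring

open Classical in
theorem IsShort.exists_two_torsionBasis {W : WeierstrassCurve.Affine F} (hW : IsShort W A B) :
    ∃ x y z : F, x ≠ y ∧ x ≠ z ∧ y ≠ z ∧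
      ((x - y) * (x - z) * (y - z)) ^ 2 = -(4 * A ^ 3 + 27 * B ^ 2) ∧
      (∀ t : F, t ^ 3 + A * t + B = 0 ↔ t = x ∨ t = y ∨ t = z) ∧
      ∃ P Q : W.Point, IsTorsionBasis 2 P Q := by
  obtain ⟨x, y, z, h, hA, hB⟩ := exists_cubic_roots A B
  have hsq := neg_disc_eq_sq h
  rw [← hA, ← hB] at hsq
  have h0 : (x - y) * (x - z) * (y - z) ≠ 0 := by
    intro h0
    rw [h0] at hsq
    exact hW.disc (by linear_combination -hsq)
  have hxy : x - y ≠ 0 := left_ne_zero_of_mul (left_ne_zero_of_mul h0)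
  have hxz : x - z ≠ 0 := right_ne_zero_of_mul (left_ne_zero_of_mul h0)
  have hyz : y - z ≠ 0 := right_ne_zero_of_mul h0
  have hroot : ∀ t : F, t ^ 3 + A * t + B = 0 ↔ t = x ∨ t = y ∨ t = z := by
    intro t
    have : t ^ 3 + A * t + B = (t - x) * ((t - y) * (t - z)) := by
      rw [hA, hB]; linear_combination t ^ 2 * h
    rw [this, mul_eq_zero, mul_eq_zero, sub_eq_zero, sub_eq_zero, sub_eq_zero]
  have hpt : ∀ t : F, t = x ∨ t = y ∨ t = z →
      ∃ R : W.Point, R ≠ 0 ∧ xCoord R = t ∧ yCoord R = 0 := fun t ht =>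
    hW.exists_point (by rw [(hroot t).2 ht]; ring)
  obtain ⟨P, hP0, hPx, hPy⟩ := hpt x (by simp)
  obtain ⟨Q, hQ0, hQx, hQy⟩ := hpt y (by simp)
  obtain ⟨S, hS0, hSx, hSy⟩ := hpt z (by simp)
  have hP2 : (2 : ℤ) • P = 0 := (hW.two_zsmul_eq_zero_iff hP0).2 hPy
  have hQ2 : (2 : ℤ) • Q = 0 := (hW.two_zsmul_eq_zero_iff hQ0).2 hQy
  have hsub : {R : W.Point | ((2 : ℕ) : ℤ) • R = 0} ⊆ ({0, P, Q, S} : Finset W.Point) := by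
    intro R hR
    have hR' : (2 : ℤ) • R = 0 := hR
    by_cases hR0 : R = 0
    · simp [hR0]
    have hy := (hW.two_zsmul_eq_zero_iff hR0).1 hR'
    have heq := hW.equation hR0
    rw [hy, zero_pow two_ne_zero, eq_comm, hroot] at heq
    have same : ∀ T : W.Point, T ≠ 0 → yCoord T = 0 → xCoord R = xCoord T → R = T := by
      intro T hT hTy hx
      rcases eq_or_eq_neg_of_xCoord hR0 hT hx with h | h
      · exact h
      · rw [h, neg_eq_iff_add_eq_zero]
        exact (hW.add_self_eq_zero_iff hT).2 hTy
    rcases heq with e | e | e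
    · simp [same P hP0 hPy (e.trans hPx.symm)]
    · simp [same Q hQ0 hQy (e.trans hQx.symm)]
    · simp [same S hS0 hSy (e.trans hSx.symm)]
  refine ⟨x, y, z, sub_ne_zero.1 hxy, sub_ne_zero.1 hxz, sub_ne_zero.1 hyz, hsq.symm, hroot, P, Q,
    isTorsionBasis_of_prime Nat.prime_two hP2 hQ2 hP0 ?_ ((Finset.finite_toSet _).subset hsub) ?_⟩
  · intro i hi
    rcases Int.even_or_odd' i with ⟨k, rfl | rfl⟩
    · rw [mul_comm, mul_smul, hP2, smul_zero] at hi
      exact hQ0 hi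
    · rw [add_smul, mul_comm, mul_smul, hP2, smul_zero, zero_add, one_smul] at hi
      rw [hi, hPx] at hQx
      exact hxy (sub_eq_zero.2 hQx)
  · refine (Set.ncard_le_ncard hsub (Finset.finite_toSet _)).trans ?_
    rw [Set.ncard_coe_finset]
    exact Finset.card_le_four

/-- A permutation of three roots that fixes the square root of the discriminant is even, hence of
order dividing 3. -/
theorem cube_fixed_of_discriminant_fixed {F : Type*} [Field F] [CharZero F] {x y z : F}
    (hxy : x ≠ y) (hxz : x ≠ z) (hyz : y ≠ z) (σ : F ≃+* F)
    (hσ : ∀ t, t = x ∨ t = y ∨ t = z → σ t = x ∨ σ t = y ∨ σ t = z)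
    (hδ : σ ((x - y) * (x - z) * (y - z)) = (x - y) * (x - z) * (y - z)) (t : F)
    (ht : t = x ∨ t = y ∨ t = z) : σ (σ (σ t)) = t := by
  have h0 : (x - y) * (x - z) * (y - z) ≠ 0 :=
    mul_ne_zero (mul_ne_zero (sub_ne_zero.2 hxy) (sub_ne_zero.2 hxz)) (sub_ne_zero.2 hyz)
  have hno : ¬ (x - y) * (x - z) * (y - z) = -((x - y) * (x - z) * (y - z)) :=
    fun h => h0 (self_eq_neg.1 h)
  simp only [map_mul, map_sub] at hδ
  have i1 : σ x ≠ σ y := fun h => hxy (σ.injective h)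
  have i2 : σ x ≠ σ z := fun h => hxz (σ.injective h)
  have i3 : σ y ≠ σ z := fun h => hyz (σ.injective h)
  rcases hσ x (by simp) with h1 | h1 | h1 <;> rcases hσ y (by simp) with h2 | h2 | h2 <;>
    rcases hσ z (by simp) with h3 | h3 | h3 <;> rw [h1, h2, h3] at hδ <;>
    rw [h1, h2] at i1 <;> rw [h1, h3] at i2 <;> rw [h2, h3] at i3 <;>
    first
    | exact absurd rfl i1
    | exact absurd rfl i2
    | exact absurd rfl i3
    | exact absurd (by linear_combination -hδ) hno
    | (rcases ht with rfl | rfl | rfl <;> simp only [h1, h2, h3])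

end TwoTorsion

/-! ### A criterion for an unexplained entanglement -/

section Criterion

open Classical

variable {A B C s : ℤ} {c : AlgebraicClosure ℚ}

theorem isSquare_discriminant_root (hdisc : -(4 * A ^ 3 + 27 * B ^ 2) = s ^ 2 * C ^ 3)
    (hc : c ^ 2 = C) {d : AlgebraicClosure ℚ}
    (hd : d ^ 2 = -(4 * (A : AlgebraicClosure ℚ) ^ 3 + 27 * (B : AlgebraicClosure ℚ) ^ 2)) :
    d = s * c ^ 3 ∨ d = -(s * c ^ 3) := by
  rw [← sq_eq_sq_iff_eq_or_eq_neg, hd]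
  have : (-(4 * (A : AlgebraicClosure ℚ) ^ 3 + 27 * (B : AlgebraicClosure ℚ) ^ 2)) =
      s ^ 2 * (C : AlgebraicClosure ℚ) ^ 3 := by exact_mod_cast hdisc
  rw [this, ← hc]
  ring

/-- Since `sc³ = sC · c`, the root of the discriminant is a nonzero integer multiple of `c` up to
sign. -/
theorem discriminant_root_fixed_iff (hs : s ≠ 0) (hC : C ≠ 0) (hc : c ^ 2 = C)
    {d : AlgebraicClosure ℚ} (hd : d = s * c ^ 3 ∨ d = -(s * c ^ 3)) (σ : AbsGal) :
    σ d = d ↔ σ c = c := by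
  have hk : (s : AlgebraicClosure ℚ) * C ≠ 0 :=
    mul_ne_zero (Int.cast_ne_zero.2 hs) (Int.cast_ne_zero.2 hC)
  have e : (s : AlgebraicClosure ℚ) * c ^ 3 = s * C * c := by rw [← hc]; ring
  rw [e] at hd
  rcases hd with rfl | rfl
  · rw [map_mul, map_mul, map_intCast, map_intCast, mul_right_inj' hk]
  · rw [map_neg, map_mul, map_mul, map_intCast, map_intCast, neg_inj, mul_right_inj' hk]

/-- The shared quadratic field is `ℚ(c)`: `hdisc` places it in the 2-torsion field, `hfix` in the
`p`-torsion field. The exponent `3k + 1` kills the action on `E[p]` by `hpow`, while `σ^(3k)` is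
trivial on `E[2]` for `σ` fixing `c`. The last hypotheses provide one such `σ`, triangular on
`E[p]`, whose determinant generates the units modulo `2p`. -/
theorem hasUnexplained_of_torsion {p k : ℕ} (hp : p ≠ 0) (hp2 : 2 < p) (hcop : Nat.Coprime 2 p)
    (hdiv : ∀ a' b' : ℕ, a' ∣ Nat.lcm 2 p → b' ∣ Nat.lcm 2 p → a' < b' → ¬ a' ∣ b' →
      a' = 2 ∧ b' = p)
    (hs : s ≠ 0) (hC : ¬ IsSquare C) (hc : c ^ 2 = C)
    (hdisc : -(4 * A ^ 3 + 27 * B ^ 2) = s ^ 2 * C ^ 3)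
    (hfix : ∀ σ : AbsGal, (∀ R : GeomPoint (shortCurve A B), (p : ℤ) • R = 0 →
      galAct (shortCurve A B) σ R = R) → σ c = c)
    (hpow : ∀ σ : AbsGal, σ c = c → ∀ R : GeomPoint (shortCurve A B), (p : ℤ) • R = 0 →
      galAct (shortCurve A B) (σ ^ (3 * k + 1)) R = R)
    {P Q : GeomPoint (shortCurve A B)} (hPQ : IsTorsionBasis p P Q) {σ : AbsGal} (hσ : σ c = c)
    {x y z : ℤ} (hP : galAct (shortCurve A B) σ P = x • P)
    (hQ : galAct (shortCurve A B) σ Q = y • P + z • Q)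
    (hgen : ∀ u w : (ZMod (Nat.lcm 2 p))ˣ,
      ZMod.castHom (Nat.dvd_lcm_right 2 p) (ZMod p) (u : ZMod (Nat.lcm 2 p)) = x * z →
      w ∈ Subgroup.zpowers u) :
    HasUnexplained (shortCurve A B) 2 p (Multiplicative (ZMod 2)) := by
  have hC0 : C ≠ 0 := by rintro rfl; exact hC ⟨0, by simp⟩
  have hW : IsShort ((shortCurve A B).baseChange (AlgebraicClosure ℚ)).toAffine _ _ :=
    isShort_shortCurve (A := A) (B := B) (by
      intro h
      rw [h, neg_zero, eq_comm] at hdisc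
      exact mul_ne_zero (pow_ne_zero 2 hs) (pow_ne_zero 3 hC0) hdisc)
  obtain ⟨e₁, e₂, e₃, h12, h13, h23, hd, hroot, P₂, Q₂, hPQ₂⟩ := hW.exists_two_torsionBasis
  have hd' := isSquare_discriminant_root hdisc hc hd
  obtain ⟨ψ, hψ⟩ := exists_sign_character hc hC0
  have hlcm : 2 * p = Nat.lcm 2 p := (hcop.lcm_eq_mul).symm
  have hbasis := hPQ₂.add hcop hPQ
  rw [hlcm] at hbasis
  obtain ⟨e, he⟩ := hbasis.exists_addEquiv
  have two_iff : ∀ {R : GeomPoint (shortCurve A B)}, R ≠ 0 → (((2 : ℕ) : ℤ) • R = 0 ↔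
      yCoord R = 0) := fun hR => hW.two_zsmul_eq_zero_iff hR
  have hroot' : ∀ {R : GeomPoint (shortCurve A B)}, R ≠ 0 → ((2 : ℕ) : ℤ) • R = 0 →
      xCoord R = e₁ ∨ xCoord R = e₂ ∨ xCoord R = e₃ := by
    intro R hR h2
    rw [← hroot, ← hW.equation hR, (two_iff hR).1 h2, zero_pow two_ne_zero]
  have hpt : ∀ t, t = e₁ ∨ t = e₂ ∨ t = e₃ → ∃ R : GeomPoint (shortCurve A B), R ≠ 0 ∧
      ((2 : ℕ) : ℤ) • R = 0 ∧ xCoord R = t := by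
    intro t ht
    obtain ⟨R, hR, hx, hy⟩ := hW.exists_point (x := t) (y := 0) (by rw [(hroot t).2 ht]; ring)
    exact ⟨R, hR, (two_iff hR).2 hy, hx⟩
  have hperm : ∀ τ : AbsGal, ∀ t, t = e₁ ∨ t = e₂ ∨ t = e₃ → τ t = e₁ ∨ τ t = e₂ ∨ τ t = e₃ := by
    intro τ t ht
    rw [← hroot] at ht ⊢
    have := congrArg τ ht
    simpa only [map_add, map_mul, map_pow, map_intCast, map_zero] using this
  have htwo : ∀ τ : AbsGal, (∀ R : GeomPoint (shortCurve A B), ((2 : ℕ) : ℤ) • R = 0 →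
      galAct (shortCurve A B) τ R = R) → τ c = c := by
    intro τ hτ
    rw [← discriminant_root_fixed_iff hs hC0 hc hd']
    have : ∀ t, t = e₁ ∨ t = e₂ ∨ t = e₃ → τ t = t := by
      intro t ht
      obtain ⟨R, hR, h2, rfl⟩ := hpt t ht
      rw [← xCoord_galAct, hτ R h2]
    simp only [map_mul, map_sub, this e₁ (by simp), this e₂ (by simp), this e₃ (by simp)]
  have hcube : ∀ τ : AbsGal, τ c = c → ∀ R : GeomPoint (shortCurve A B),
      ((2 : ℕ) : ℤ) • R = 0 → galAct (shortCurve A B) (τ ^ 3) R = R := by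
    intro τ hτ R h2
    by_cases hR : R = 0
    · rw [hR, map_zero]
    have hx : (τ ^ 3) (xCoord R) = xCoord R :=
      cube_fixed_of_discriminant_fixed h12 h13 h23 τ.toRingEquiv (hperm τ)
        ((discriminant_root_fixed_iff hs hC0 hc hd' τ).2 hτ) _ (hroot' hR h2)
    rcases eq_or_eq_neg_of_galAct_xCoord hR hx with h | h
    · exact h
    · rw [h, neg_eq_iff_add_eq_zero, hW.add_self_eq_zero_iff hR]
      exact (two_iff hR).1 h2
  refine ⟨(torsionRep (galAct (shortCurve A B)) e).range, ⟨e, mem_range_torsionRep_iff _ _⟩,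
    isUnexplained_of_character _ ψ hp2 hcop hdiv ?_ ?_ ?_ ?_ ?_⟩
  · intro τ hτ
    rw [red_torsionRep_eq_one_iff _ e hlcm two_ne_zero hp] at hτ
    exact (hψ τ).2 (htwo τ hτ)
  · intro τ hτ
    rw [red_torsionRep_eq_one_iff _ e ((mul_comm _ _).trans hlcm) hp two_ne_zero] at hτ
    exact (hψ τ).2 (hfix τ hτ)
  · intro τ hτ
    refine ⟨3 * k + 1, ?_, ?_⟩
    · rw [red_torsionRep_eq_one_iff _ e ((mul_comm _ _).trans hlcm) hp two_ne_zero]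
      exact hpow τ ((hψ τ).1 hτ)
    · rw [red_torsionRep_eq_one_iff _ e hlcm two_ne_zero hp]
      intro R hR
      rw [pow_succ, mul_inv_cancel_right, pow_mul]
      exact galAct_pow_fixed (hcube τ ((hψ τ).1 hτ) R hR) k
  · obtain ⟨τ, hτ⟩ := exists_apply_eq_neg hc hC
    refine ⟨τ, fun h => ?_⟩
    rw [hψ, hτ, neg_eq_self] at h
    rw [h, zero_pow two_ne_zero, eq_comm, Int.cast_eq_zero] at hc
    exact hC0 hc
  · refine ⟨σ, (hψ σ).2 hσ, fun w => hgen _ w ?_⟩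
    have h2 : ∀ S T : GeomPoint (shortCurve A B), ((2 : ℕ) : ℤ) • S = 0 →
        ((2 : ℕ) : ℤ) • (S + T) = ((2 : ℕ) : ℤ) • T := fun S T h => by
      rw [zsmul_add, h, zero_add]
    refine det_torsionRep_of_triangular _ e ((mul_comm _ _).trans hlcm) two_ne_zero _ he σ
      (y := y) ?_ ?_
    · rw [h2 _ _ hPQ₂.left, map_zsmul, hP, smul_comm]
    · rw [h2 _ _ hPQ₂.left, h2 _ _ hPQ₂.right, map_zsmul, hQ, smul_add, smul_comm,
        smul_comm _ z]

end Criterion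


/-! ### The first family: entanglement of the two- and the three-torsion -/

section ThreeTorsion

open Classical

theorem zsmul_eq_of_three_zsmul {M : Type*} [AddCommGroup M] {P : M} (hP : (3 : ℤ) • P = 0)
    (i : ℤ) : i • P = 0 ∨ i • P = P ∨ i • P = -P := by
  have h3 : ∀ k r : ℤ, (3 * k + r) • P = r • P := fun k r => by
    rw [add_zsmul, mul_comm, mul_zsmul, hP, zsmul_zero, zero_add]
  have hi : i = 3 * (i / 3) ∨ i = 3 * (i / 3) + 1 ∨ i = 3 * (i / 3 + 1) - 1 := by omega
  rcases hi with h | h | h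
  · left; rw [h, ← add_zero (3 * (i / 3)), h3, zero_zsmul]
  · right; left; rw [h, h3, one_zsmul]
  · right; right; rw [h, sub_eq_add_neg, h3, neg_zsmul, one_zsmul]

theorem mem_zpowers_of_cast_eq_neg_one {n : ℕ} (hn : n = 6) (h : 3 ∣ n) (u w : (ZMod n)ˣ)
    (hu : ZMod.castHom h (ZMod 3) (u : ZMod n) = -1) : w ∈ Subgroup.zpowers u := by
  subst hn
  have key : ∀ u w : (ZMod 6)ˣ, ZMod.castHom h (ZMod 3) (u : ZMod 6) = -1 → w = 1 ∨ w = u := by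
    decide +revert
  rcases key u w hu with rfl | rfl
  · exact one_mem _
  · exact Subgroup.mem_zpowers _

variable {A B : ℤ}

/-- Fixing two abscissas, `σ` acts on the corresponding independent points by signs. Equal signs
would make it `±1` on `E[3]` and fix every abscissa, against `x''`; so the determinant is `-1`. -/
theorem exists_three_torsionBasis_of_xCoord (hd : 4 * A ^ 3 + 27 * B ^ 2 ≠ 0)
    {σ : AbsGal} {x x' x'' : AlgebraicClosure ℚ} (h : psi₃ (A : AlgebraicClosure ℚ) B x = 0)
    (h' : psi₃ (A : AlgebraicClosure ℚ) B x' = 0) (h'' : psi₃ (A : AlgebraicClosure ℚ) B x'' = 0)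
    (hne : x ≠ x') (hx : σ x = x) (hx' : σ x' = x') (hx'' : σ x'' ≠ x'') :
    ∃ P Q : GeomPoint (shortCurve A B), IsTorsionBasis 3 P Q ∧ ∃ i j : ℤ, i * j = -1 ∧
      galAct (shortCurve A B) σ P = i • P ∧ galAct (shortCurve A B) σ Q = j • Q := by
  have hW := isShort_shortCurve hd
  obtain ⟨P, hP0, rfl⟩ := hW.exists_point_of_xCoord x
  obtain ⟨Q, hQ0, rfl⟩ := hW.exists_point_of_xCoord x'
  obtain ⟨R, hR0, rfl⟩ := hW.exists_point_of_xCoord x''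
  rw [← hW.three_zsmul_eq_zero_iff hP0] at h
  rw [← hW.three_zsmul_eq_zero_iff hQ0] at h'
  rw [← hW.three_zsmul_eq_zero_iff hR0] at h''
  have hb : IsTorsionBasis 3 P Q := by
    refine isTorsionBasis_of_prime Nat.prime_three h h' hP0 ?_ hW.ncard_three_torsion.1
      hW.ncard_three_torsion.2
    intro i hi
    rcases zsmul_eq_of_three_zsmul h i with e | e | e <;> rw [e] at hi
    · exact hQ0 hi
    · exact hne (congrArg xCoord hi).symm
    · exact hne ((congrArg xCoord hi).trans (xCoord_neg P)).symm
  have sign : ∀ S : GeomPoint (shortCurve A B), S ≠ 0 → σ (xCoord S) = xCoord S →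
      ∃ i : ℤ, (i = 1 ∨ i = -1) ∧ galAct (shortCurve A B) σ S = i • S := by
    intro S hS hx
    rcases eq_or_eq_neg_of_galAct_xCoord hS hx with e | e
    · exact ⟨1, Or.inl rfl, by rw [e, one_zsmul]⟩
    · exact ⟨-1, Or.inr rfl, by rw [e, neg_zsmul, one_zsmul]⟩
  obtain ⟨i, hi, hiP⟩ := sign P hP0 hx
  obtain ⟨j, hj, hjQ⟩ := sign Q hQ0 hx'
  refine ⟨P, Q, hb, i, j, ?_, hiP, hjQ⟩
  have hij : i ≠ j := by
    rintro rfl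
    apply hx''
    obtain ⟨k, l, hkl⟩ := hb.span R h''
    have : galAct (shortCurve A B) σ R = i • R := by
      rw [hkl, map_add, map_zsmul, map_zsmul, hiP, hjQ, zsmul_add, zsmul_comm, zsmul_comm Q]
    rw [← xCoord_galAct, this]
    rcases hi with rfl | rfl
    · rw [one_zsmul]
    · rw [neg_zsmul, one_zsmul, xCoord_neg]
  rcases hi with rfl | rfl <;> rcases hj with rfl | rfl <;> simp_all

end ThreeTorsion

/-! ### The three-torsion of the first family over `ℚ(√C)`. -/

section FirstFamily

open Classical

/-- Over `ℚ(c)` the third division polynomial splits into two quadratics, with root sums `-2uc` and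
`2uc`; this is how `c` enters the 3-torsion field. -/
theorem psi₃_eq_mul {F : Type*} [Field F] {u v c r r' A B : F}
    (hc : c ^ 2 = u ^ 4 + 36 * u ^ 2 * v ^ 2 + 432 * v ^ 4)
    (hr : r ^ 2 = 2 * (u ^ 2 + 18 * v ^ 2 + c)) (hr' : r' ^ 2 = 2 * (u ^ 2 + 18 * v ^ 2 - c))
    (hA : A = -3 * (u ^ 2 + 12 * v ^ 2) * c ^ 2) (hB : B = 2 * u * (c ^ 2) ^ 2) (x : F) :
    psi₃ A B x = 3 * (((x - (-(u * c) + c * r)) * (x - (-(u * c) - c * r))) *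
      ((x - (u * c + c * r')) * (x - (u * c - c * r')))) := by
  have e1 : (x - (-(u * c) + c * r)) * (x - (-(u * c) - c * r)) =
      x ^ 2 + 2 * u * c * x - c ^ 2 * (u ^ 2 + 36 * v ^ 2) - 2 * c ^ 3 := by
    linear_combination -c ^ 2 * hr
  have e2 : (x - (u * c + c * r')) * (x - (u * c - c * r')) =
      x ^ 2 - 2 * u * c * x - c ^ 2 * (u ^ 2 + 36 * v ^ 2) + 2 * c ^ 3 := by
    linear_combination -c ^ 2 * hr'
  rw [e1, e2, hA, hB, psi₃]
  linear_combination 12 * c ^ 4 * hc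

/-- The product `rr'` is `±12v²√-3`, so an automorphism fixing `c` and negating `√-3` changes the
sign of exactly one of `r`, `r'`: it fixes two abscissas and moves the other two. Any `τ` fixing `c`
has `τ²` fixing all abscissas, hence `τ⁴ = 1` on `E[3]`. -/
theorem hasUnexplained_first_family {a b : ℤ} (ha : a ≠ 0) (hb : b ≠ 0)
    (hC : ¬ IsSquare (biquad 36 432 a b)) :
    HasUnexplained (shortCurve (val A₁ a b) (val B₁ a b)) 2 3 (Multiplicative (ZMod 2)) := by
  rw [val_A₁, val_B₁]
  set C := biquad 36 432 a b with hCdef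
  set A := -3 * (a ^ 2 + 12 * b ^ 2) * C with hAdef
  set B := 2 * a * C ^ 2 with hBdef
  have hCpos : 0 < C := biquad_pos (by norm_num) (by norm_num) hb
  have hdisc : -(4 * A ^ 3 + 27 * B ^ 2) = (432 * b ^ 3) ^ 2 * C ^ 3 := by
    rw [hAdef, hBdef, hCdef, biquad]; ring
  have hs : 432 * b ^ 3 ≠ 0 := mul_ne_zero (by norm_num) (pow_ne_zero 3 hb)
  have hd : 4 * A ^ 3 + 27 * B ^ 2 ≠ 0 := by
    intro h
    rw [h, neg_zero, eq_comm] at hdisc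
    exact mul_ne_zero (pow_ne_zero 2 hs) (pow_ne_zero 3 hCpos.ne') hdisc
  have hW := isShort_shortCurve hd
  obtain ⟨c, hc⟩ := IsAlgClosed.exists_pow_nat_eq (C : AlgebraicClosure ℚ) two_pos
  set u : AlgebraicClosure ℚ := (a : AlgebraicClosure ℚ) with hu
  set v : AlgebraicClosure ℚ := (b : AlgebraicClosure ℚ) with hv
  obtain ⟨r, hr⟩ := IsAlgClosed.exists_pow_nat_eq (2 * (u ^ 2 + 18 * v ^ 2 + c)) two_pos
  obtain ⟨r', hr'⟩ := IsAlgClosed.exists_pow_nat_eq (2 * (u ^ 2 + 18 * v ^ 2 - c)) two_pos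
  have hu0 : u ≠ 0 := Int.cast_ne_zero.2 ha
  have hv0 : v ≠ 0 := Int.cast_ne_zero.2 hb
  have hσu : ∀ σ : AbsGal, σ u = u := fun σ => map_intCast σ a
  have hσv : ∀ σ : AbsGal, σ v = v := fun σ => map_intCast σ b
  have hc' : c ^ 2 = u ^ 4 + 36 * u ^ 2 * v ^ 2 + 432 * v ^ 4 := by
    rw [hc, hCdef, biquad, hu, hv]; push_cast; ring
  have hc0 : c ≠ 0 := by
    rintro rfl
    rw [zero_pow two_ne_zero, eq_comm, Int.cast_eq_zero] at hc
    exact hCpos.ne' hc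
  have hA : (A : AlgebraicClosure ℚ) = -3 * (u ^ 2 + 12 * v ^ 2) * c ^ 2 := by
    rw [hAdef, hc]; push_cast; rfl
  have hB : (B : AlgebraicClosure ℚ) = 2 * u * (c ^ 2) ^ 2 := by
    rw [hBdef, hc]; push_cast; rfl
  have hfac := psi₃_eq_mul hc' hr hr' hA hB
  have hrr : (r * r') ^ 2 = -3 * (12 * v ^ 2) ^ 2 := by
    rw [mul_pow, hr, hr']; linear_combination -4 * hc'
  have hrr0 : r * r' ≠ 0 := by
    intro h
    rw [h, zero_pow two_ne_zero, eq_comm] at hrr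
    exact mul_ne_zero (by norm_num) (pow_ne_zero 2 (mul_ne_zero (by norm_num) (pow_ne_zero 2 hv0)))
      hrr
  have hr0 : r ≠ 0 := left_ne_zero_of_mul hrr0
  have hr0' : r' ≠ 0 := right_ne_zero_of_mul hrr0
  have hσr : ∀ σ : AbsGal, σ c = c → σ r = r ∨ σ r = -r := fun σ hσ => by
    rw [← sq_eq_sq_iff_eq_or_eq_neg, ← map_pow, hr]
    simp only [map_mul, map_add, map_pow, hσ, hσu, hσv, map_ofNat]
  have hσr' : ∀ σ : AbsGal, σ c = c → σ r' = r' ∨ σ r' = -r' := fun σ hσ => by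
    rw [← sq_eq_sq_iff_eq_or_eq_neg, ← map_pow, hr']
    simp only [map_mul, map_add, map_sub, map_pow, hσ, hσu, hσv, map_ofNat]
  have root₁ : psi₃ (A : AlgebraicClosure ℚ) B (-(u * c) + c * r) = 0 := by rw [hfac]; ring
  have root₂ : psi₃ (A : AlgebraicClosure ℚ) B (-(u * c) - c * r) = 0 := by rw [hfac]; ring
  have root₃ : psi₃ (A : AlgebraicClosure ℚ) B (u * c + c * r') = 0 := by rw [hfac]; ring
  have root₄ : psi₃ (A : AlgebraicClosure ℚ) B (u * c - c * r') = 0 := by rw [hfac]; ring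
  have two_ne : ∀ t : AlgebraicClosure ℚ, t ≠ 0 → 2 * (c * t) ≠ 0 := fun t ht =>
    mul_ne_zero two_ne_zero (mul_ne_zero hc0 ht)
  have hroot : ∀ x, psi₃ (A : AlgebraicClosure ℚ) B x = 0 → x = -(u * c) + c * r ∨
      x = -(u * c) - c * r ∨ x = u * c + c * r' ∨ x = u * c - c * r' := by
    intro x hx
    rw [hfac, mul_eq_zero, mul_eq_zero, mul_eq_zero, mul_eq_zero, sub_eq_zero, sub_eq_zero,
      sub_eq_zero, sub_eq_zero] at hx
    rcases hx with h | (h | h) | (h | h)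
    · exact absurd h three_ne_zero
    all_goals simp [h]
  obtain ⟨σ, hσ, hσt⟩ := exists_fixed_and_apply_eq_neg hc
    (t := r * r' / (12 * v ^ 2)) (T := -3)
    (by rw [div_pow, hrr, mul_div_cancel_right₀ _ (pow_ne_zero 2 (mul_ne_zero (by norm_num)
          (pow_ne_zero 2 hv0)))]; norm_num)
    -- Both `-3` and `-3C` are negative, hence not squares.
    (fun h => absurd h.nonneg (by norm_num)) (fun h => absurd h.nonneg (by linarith))
  have hflip : σ r * σ r' = -(r * r') := by
    have h12 : (12 * v ^ 2) ≠ 0 := mul_ne_zero (by norm_num) (pow_ne_zero 2 hv0)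
    have e : σ (12 * v ^ 2) = 12 * v ^ 2 := by simp only [map_mul, map_pow, hσv, map_ofNat]
    rw [map_div₀, e, ← neg_div, div_left_inj' h12, map_mul] at hσt
    exact hσt
  have hbasis : ∃ P Q : GeomPoint (shortCurve A B), IsTorsionBasis 3 P Q ∧ ∃ i j : ℤ,
      i * j = -1 ∧ galAct (shortCurve A B) σ P = i • P ∧ galAct (shortCurve A B) σ Q = j • Q := by
    rcases hσr σ hσ with h | h
    · have h' : σ r' = -r' := by
        rw [h, ← mul_neg] at hflip
        exact mul_left_cancel₀ hr0 hflip
      refine exists_three_torsionBasis_of_xCoord hd root₁ root₂ root₃ ?_ ?_ ?_ ?_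
      · exact fun e => two_ne r hr0 (by linear_combination e)
      · simp only [map_add, map_neg, map_mul, hσu, hσ, h]
      · simp only [map_sub, map_neg, map_mul, hσu, hσ, h]
      · simp only [map_add, map_mul, hσu, hσ, h']
        exact fun e => two_ne r' hr0' (by linear_combination -e)
    · have h' : σ r' = r' := by
        rw [h, neg_mul, neg_inj] at hflip
        exact mul_left_cancel₀ hr0 hflip
      refine exists_three_torsionBasis_of_xCoord hd root₃ root₄ root₁ ?_ ?_ ?_ ?_
      · exact fun e => two_ne r' hr0' (by linear_combination e)
      · simp only [map_add, map_mul, hσu, hσ, h']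
      · simp only [map_sub, map_mul, hσu, hσ, h']
      · simp only [map_add, map_neg, map_mul, hσu, hσ, h]
        exact fun e => two_ne r hr0 (by linear_combination -e)
  obtain ⟨P, Q, hPQ, i, j, hij, hP, hQ⟩ := hbasis
  refine hasUnexplained_of_torsion (p := 3) (k := 1) (s := 432 * b ^ 3) (y := 0) three_ne_zero
    (by norm_num) (by norm_num) ?_ hs hC hc hdisc ?_ ?_ hPQ hσ hP
    (by rw [zero_zsmul, zero_add]; exact hQ) ?_
  · intro a' b' h1 h2
    have h1' := Nat.le_of_dvd (by norm_num) h1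
    have h2' := Nat.le_of_dvd (by norm_num) h2
    have e : Nat.lcm 2 3 = 6 := by norm_num
    rw [e] at h1 h2 h1' h2'
    interval_cases a' <;> interval_cases b' <;> revert h1 h2 <;> decide
  · intro τ hτ
    have fix : ∀ x, psi₃ (A : AlgebraicClosure ℚ) B x = 0 → τ x = x := by
      intro x hx
      obtain ⟨R, hR, rfl⟩ := hW.exists_point_of_xCoord x
      rw [← hW.three_zsmul_eq_zero_iff hR] at hx
      rw [← xCoord_galAct, hτ R hx]
    have e1 := fix _ root₁
    have e2 := fix _ root₂
    simp only [map_add, map_sub, map_neg, map_mul, hσu] at e1 e2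
    -- The first two roots sum to `-2uc`, and `u ≠ 0`, so fixing them fixes `c`.
    have : 2 * u * (τ c - c) = 0 := by linear_combination -e1 - e2
    exact sub_eq_zero.1 ((mul_eq_zero.1 this).resolve_left (mul_ne_zero two_ne_zero hu0))
  · intro τ hτ R hR
    by_cases hR0 : R = 0
    · rw [hR0, map_zero]
    have hψ := (hW.three_zsmul_eq_zero_iff hR0).1 hR
    have e : (τ ^ 2) (xCoord R) = xCoord R := by
      rw [pow_two, AlgEquiv.mul_apply]
      rcases hσr τ hτ with h | h <;> rcases hσr' τ hτ with h' | h' <;>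
        rcases hroot _ hψ with e | e | e | e <;> rw [e] <;>
        simp only [map_add, map_sub, map_neg, map_mul, hσu, hτ, h, h', neg_neg]
    rw [show 3 * 1 + 1 = 2 + 2 by norm_num, pow_add, galAct_mul_apply]
    rcases eq_or_eq_neg_of_galAct_xCoord hR0 e with h | h
    · rw [h, h]
    · rw [h, map_neg, h, neg_neg]
  · intro w w' hw
    refine mem_zpowers_of_cast_eq_neg_one (by norm_num) _ w w' (hw.trans ?_)
    rw [← Int.cast_mul, hij]
    norm_num

end FirstFamily


/-! ### The second family: entanglement of the two- and the five-torsion -/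

section FiveTorsion

theorem zsmul_eq_of_five_zsmul {M : Type*} [AddCommGroup M] {P : M} (hP : (5 : ℤ) • P = 0)
    (i : ℤ) : i • P = 0 ∨ i • P = P ∨ i • P = -P ∨ i • P = P + P ∨ i • P = -(P + P) := by
  have h5 : ∀ k r : ℤ, (5 * k + r) • P = r • P := fun k r => by
    rw [add_zsmul, mul_comm, mul_zsmul, hP, zsmul_zero, zero_add]
  have hi : i = 5 * (i / 5) + 0 ∨ i = 5 * (i / 5) + 1 ∨ i = 5 * (i / 5 + 1) + -1 ∨
      i = 5 * (i / 5) + 2 ∨ i = 5 * (i / 5 + 1) + -2 := by omega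
  rcases hi with h | h | h | h | h <;> rw [h, h5]
  · left; rw [zero_zsmul]
  · right; left; rw [one_zsmul]
  · right; right; left; rw [neg_zsmul, one_zsmul]
  · right; right; right; left; rw [two_zsmul]
  · right; right; right; right; rw [neg_zsmul, two_zsmul]

/-- The units modulo 10 are cyclic of order 4 and reduce isomorphically to those modulo 5, where the
elements of square `-1` are the generators. -/
theorem mem_zpowers_of_cast_sq_eq_neg_one {n : ℕ} (hn : n = 10) (h : 5 ∣ n) (u w : (ZMod n)ˣ)
    (hu : ZMod.castHom h (ZMod 5) (u : ZMod n) ^ 2 = -1) : w ∈ Subgroup.zpowers u := by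
  subst hn
  have key : ∀ u w : (ZMod 10)ˣ, ZMod.castHom h (ZMod 5) (u : ZMod 10) ^ 2 = -1 →
      w = 1 ∨ w = u ∨ w = u ^ 2 ∨ w = u ^ 3 := by
    decide +revert
  rcases key u w hu with rfl | rfl | rfl | rfl
  · exact one_mem _
  · exact Subgroup.mem_zpowers _
  · exact Subgroup.npow_mem_zpowers _ _
  · exact Subgroup.npow_mem_zpowers _ _

/-- An endomorphism of `M` that acts on a basis of the five-torsion by an invertible triangular
matrix with first diagonal entry `±1` has order dividing `40` on the five-torsion. -/
theorem iterate_forty_of_triangular {M : Type*} [AddCommGroup M] {P Q : M}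
    (h : IsTorsionBasis 5 P Q) (φ : M →+ M) {x y z : ℤ} (hx : x = 1 ∨ x = -1)
    (hz : ¬ (5 : ℤ) ∣ z) (hP : φ P = x • P) (hQ : φ Q = y • P + z • Q) {R : M}
    (hR : (5 : ℤ) • R = 0) : φ^[40] R = R := by
  have hxx : x * x = 1 := by rcases hx with rfl | rfl <;> norm_num
  have h5 : ∀ (S : M) (r : ℤ), (5 : ℤ) • S = 0 → (5 : ℤ) ∣ r → r • S = 0 := by
    rintro S r hS ⟨k, rfl⟩
    rw [mul_comm, mul_zsmul, hS, zsmul_zero]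
  have hP2 : φ (φ P) = P := by rw [hP, map_zsmul, hP, ← mul_zsmul, hxx, one_zsmul]
  have hQ2 : φ (φ Q) = (x * y + z * y) • P + (z * z) • Q := by
    rw [hQ, map_add, map_zsmul, map_zsmul, hP, hQ, zsmul_add, ← mul_zsmul, ← mul_zsmul,
      ← mul_zsmul, add_zsmul, mul_comm y x, add_assoc]
  generalize x * y + z * y = y' at hQ2
  have hQ4 : φ (φ (φ (φ Q))) = (y' + z * z * y') • P + Q := by
    rw [hQ2, map_add, map_add, map_zsmul, map_zsmul, map_zsmul, map_zsmul, hP2, hQ2, zsmul_add,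
      ← mul_zsmul, ← mul_zsmul, add_zsmul, ← add_assoc]
    congr 1
    have : (z * z * (z * z) - 1) • Q = 0 := by
      refine h5 Q _ h.right ?_
      have hz' : z % 5 = 1 ∨ z % 5 = 2 ∨ z % 5 = 3 ∨ z % 5 = 4 := by omega
      rw [Int.dvd_iff_emod_eq_zero]
      rcases hz' with e | e | e | e <;> simp [Int.sub_emod, Int.mul_emod, e]
    rw [sub_zsmul, one_zsmul, ← sub_eq_add_neg, sub_eq_zero] at this
    exact this
  generalize y' + z * z * y' = y'' at hQ4
  have hφ4 : ∀ n : ℕ, φ^[4 * n] P = P ∧ φ^[4 * n] Q = (n * y'') • P + Q := by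
    intro n
    induction n with
    | zero => simp
    | succ n ih =>
      rw [show 4 * (n + 1) = 4 + 4 * n by ring, Function.iterate_add_apply,
        Function.iterate_add_apply, ih.1, ih.2]
      simp only [Function.iterate_succ_apply', Function.iterate_zero_apply, map_add, map_zsmul,
        hP2, hQ4, true_and]
      rw [← add_assoc, ← add_zsmul]
      push_cast
      ring_nf
  obtain ⟨i, j, rfl⟩ := h.span R hR
  have hadd : ∀ n : ℕ, φ^[n] (i • P + j • Q) = i • φ^[n] P + j • φ^[n] Q := by
    intro n
    induction n with
    | zero => simp
    | succ n ih => simp only [Function.iterate_succ_apply', ih, map_add, map_zsmul]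
  -- The fourth iterate is unipotent, `Q ↦ Q + y''P`. Five iterations of it would suffice, but the
  -- total exponent has to be 1 modulo 3, and `40 = 3 · 13 + 1`.
  obtain ⟨e1, e2⟩ := hφ4 10
  rw [hadd, show 40 = 4 * 10 by norm_num, e1, e2, h5 P (((10 : ℕ) : ℤ) * y'') h.left ⟨2 * y'', by push_cast; ring⟩,
    zero_add]

end FiveTorsion

/-! ### Sums of abscissas over cosets of a subgroup of order five. -/

section OrbitSum

variable {F : Type*} [Field F] [DecidableEq F] {W : WeierstrassCurve.Affine F}

/-- The sum of the abscissas of the translates of `R` by the multiples of a point `P` of order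
five. -/
def orbitSum (P R : W.Point) : F :=
  xCoord R + (xCoord (R + P) + xCoord (R - P)) + (xCoord (R + (P + P)) + xCoord (R - (P + P)))

/-- Up to an additive constant the sum is Vélu's abscissa on the quotient by `⟨P⟩`; so it is
unchanged by negation and by translation by `P`. It serves to detect whether `σQ` is `±Q` modulo
`⟨P⟩`. -/
theorem orbitSum_neg (P R : W.Point) : orbitSum P (-R) = orbitSum P R := by
  have h : ∀ S, xCoord (-R + S) = xCoord (R - S) := fun S => by
    rw [← xCoord_neg, neg_add, neg_neg, sub_eq_add_neg]
  have h' : ∀ S, xCoord (-R - S) = xCoord (R + S) := fun S => by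
    rw [← xCoord_neg, neg_sub', neg_neg, sub_neg_eq_add]
  rw [orbitSum, orbitSum, h, h, h', h', xCoord_neg]
  ring

theorem orbitSum_add_self {P : W.Point} (hP : (5 : ℤ) • P = 0) (R : W.Point) :
    orbitSum P (R + P) = orbitSum P R := by
  have e5 : P + P + P + P + P = 0 := by
    rw [← hP, show (5 : ℤ) = 1 + 1 + 1 + 1 + 1 by norm_num]
    simp only [add_zsmul, one_zsmul]
  have e1 : R + P + P = R + (P + P) := add_assoc _ _ _
  have e2 : R + P - P = R := add_sub_cancel_right _ _
  have e3 : R + P + (P + P) = R - (P + P) := by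
    rw [eq_sub_iff_add_eq]
    calc R + P + (P + P) + (P + P) = R + (P + P + P + P + P) := by abel
      _ = R := by rw [e5, add_zero]
  have e4 : R + P - (P + P) = R - P := by abel
  rw [orbitSum, orbitSum, e1, e2, e3, e4]
  ring

theorem orbitSum_add_zsmul {P : W.Point} (hP : (5 : ℤ) • P = 0) (R : W.Point) (i : ℤ) :
    orbitSum P (R + i • P) = orbitSum P R := by
  induction i using Int.induction_on with
  | zero => rw [zero_zsmul, add_zero]
  | succ i ih => rw [add_zsmul, one_zsmul, ← add_assoc, orbitSum_add_self hP, ih]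
  | pred i ih =>
    rw [← orbitSum_add_self hP, sub_zsmul, one_zsmul, ← ih]
    congr 1
    abel

open Classical in
theorem orbitSum_galAct {E : WeierstrassCurve ℚ} (σ : AbsGal) {P : GeomPoint E}
    (hP : galAct E σ P = P ∨ galAct E σ P = -P) (R : GeomPoint E) :
    orbitSum P (galAct E σ R) = σ (orbitSum P R) := by
  have key : orbitSum (galAct E σ P) (galAct E σ R) = σ (orbitSum P R) := by
    simp only [orbitSum, map_add, ← xCoord_galAct, map_sub]
  rw [← key]
  rcases hP with h | h <;> rw [h]
  rw [orbitSum, orbitSum, ← neg_add, sub_neg_eq_add, sub_neg_eq_add, ← sub_eq_add_neg,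
    ← sub_eq_add_neg]
  ring

end OrbitSum

/-! ### The five-torsion of the second family over `ℚ(√C)`. -/

section SecondFamily

variable {F : Type*} [Field F] [CharZero F]

-- The quadratic `f` has the abscissas of `±P` and `±2P` as roots, and `n/f²` is the orbit sum as a
-- function of `x`. The remaining 5-torsion is thus cut out by two values of the orbit sum, `-C ±
-- (6/√5)s√C`.
set_option maxHeartbeats 4000000 in
theorem psi₅_eq_mul {s w C A B π : F} (hC : C = s ^ 2 + 22 * s * w + 125 * w ^ 2)
    (hA : A = -3 * (s ^ 2 + 10 * s * w + 5 * w ^ 2) * C)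
    (hB : B = 2 * (s ^ 2 + 4 * s * w - w ^ 2) * C ^ 2)
    (hπ : π = C ^ 2 - 36 * w ^ 2 * C) (x f n : F) (hf : f = x ^ 2 - 2 * C * x + π)
    (hn : n = x * f ^ 2 + (2 * x ^ 2 + 2 * A) * (2 * C * x ^ 2 - 4 * π * x + 2 * π * C) +
      (2 * x * A + 4 * B) * (2 * x ^ 2 - 4 * C * x + 4 * C ^ 2 - 2 * π) +
      2 * x * ((4 * C ^ 2 - 2 * π) * x ^ 2 - 4 * π * C * x + 2 * π ^ 2)) :
    psi₅ A B x = -5 * f * ((n + C * f ^ 2) ^ 2 - 36 / 5 * s ^ 2 * C * f ^ 4) := by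
  rw [psi₅, psi₃, hn, hf, hπ, hB, hA, hC]
  ring

variable [DecidableEq F] {W : WeierstrassCurve.Affine F} {A B s w c : F}

/-- Doubling replaces `c` by `-c` in the abscissa `c² + 6wc`. The ordinate is nonzero because `C =
(s + 11w)² + 4w²`, so that `c ≠ -(s + 11w)`. -/
theorem IsShort.xCoord_double_of_second_family (hW : IsShort W A B)
    (hc : c ^ 2 = s ^ 2 + 22 * s * w + 125 * w ^ 2)
    (hA : A = -3 * (s ^ 2 + 10 * s * w + 5 * w ^ 2) * c ^ 2)
    (hB : B = 2 * (s ^ 2 + 4 * s * w - w ^ 2) * (c ^ 2) ^ 2) (hc0 : c ≠ 0) (hw : w ≠ 0)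
    {P : W.Point} (hP0 : P ≠ 0) (hP : xCoord P = c ^ 2 + 6 * w * c) :
    yCoord P ≠ 0 ∧ P + P ≠ 0 ∧ xCoord (P + P) = c ^ 2 - 6 * w * c := by
  have hck : c + (s + 11 * w) ≠ 0 := by
    intro h
    have : 4 * w ^ 2 = 0 := by linear_combination (c - (s + 11 * w)) * h - hc
    exact hw (pow_eq_zero_iff two_ne_zero |>.1 ((mul_eq_zero.1 this).resolve_left (by norm_num)))
  have hy : yCoord P ^ 2 = 216 * c ^ 3 * w ^ 2 * (c + (s + 11 * w)) := by
    rw [hW.equation hP0, hP, hA, hB]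
    linear_combination (18 * w * c ^ 3 + c ^ 4) * hc
  have hm : 3 * xCoord P ^ 2 + A = 36 * c ^ 2 * w * (c + 2 * w + (s + 11 * w)) := by
    rw [hP, hA]; linear_combination 3 * c ^ 2 * hc
  have hy0 : yCoord P ≠ 0 := by
    intro h
    rw [h, zero_pow two_ne_zero, eq_comm] at hy
    exact mul_ne_zero (mul_ne_zero (mul_ne_zero (by norm_num) (pow_ne_zero 3 hc0))
      (pow_ne_zero 2 hw)) hck hy
  obtain ⟨h1, h2, -⟩ := hW.double hP0 hy0
  refine ⟨hy0, h1, ?_⟩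
  rw [h2, div_pow, hm, mul_pow 2, hy, hP, sub_eq_iff_eq_add, div_eq_iff]
  · linear_combination -1296 * c ^ 4 * w ^ 2 * hc
  · exact mul_ne_zero (by norm_num) (mul_ne_zero (mul_ne_zero (mul_ne_zero (by norm_num)
      (pow_ne_zero 3 hc0)) (pow_ne_zero 2 hw)) hck)

end SecondFamily


section SecondFamilyPoints

variable {F : Type*} [Field F] [CharZero F] [DecidableEq F] {W : WeierstrassCurve.Affine F}
  {A B s w c t : F}

/-- Applying the doubling formula twice gives `4P` the abscissa of `P`. If `4P = P`, then `2P = -P`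
would have that abscissa too, against `12wc ≠ 0`; hence `4P = -P`. -/
theorem IsShort.five_zsmul_of_second_family (hW : IsShort W A B)
    (hc : c ^ 2 = s ^ 2 + 22 * s * w + 125 * w ^ 2)
    (hA : A = -3 * (s ^ 2 + 10 * s * w + 5 * w ^ 2) * c ^ 2)
    (hB : B = 2 * (s ^ 2 + 4 * s * w - w ^ 2) * (c ^ 2) ^ 2) (hc0 : c ≠ 0) (hw : w ≠ 0)
    {P : W.Point} (hP0 : P ≠ 0) (hP : xCoord P = c ^ 2 + 6 * w * c) : (5 : ℤ) • P = 0 := by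
  obtain ⟨-, h1, h2⟩ := hW.xCoord_double_of_second_family hc hA hB hc0 hw hP0 hP
  have hcc : (-c) ^ 2 = c ^ 2 := neg_sq c
  obtain ⟨-, -, h4⟩ := hW.xCoord_double_of_second_family (c := -c) (hcc.trans hc)
    (by rw [hcc]; exact hA) (by rw [hcc]; exact hB) (neg_ne_zero.2 hc0) hw h1 (by rw [h2]; ring)
  have h4' : xCoord (P + P + (P + P)) = xCoord P := by rw [h4, hP]; ring
  have e5 : (5 : ℤ) • P = P + P + (P + P) + P := by
    rw [show (5 : ℤ) = 1 + 1 + (1 + 1) + 1 by norm_num]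
    simp only [add_zsmul, one_zsmul]
  have h40 : P + P + (P + P) ≠ 0 := by
    intro h
    have : P + P = -(P + P) := eq_neg_of_add_eq_zero_left h
    rw [hW.add_self_eq_zero_iff h1] at h
    exact (hW.xCoord_double_of_second_family (c := -c) (hcc.trans hc)
      (by rw [hcc]; exact hA) (by rw [hcc]; exact hB) (neg_ne_zero.2 hc0) hw h1
      (by rw [h2]; ring)).1 h
  rcases eq_or_eq_neg_of_xCoord h40 hP0 h4' with h | h
  · exfalso
    have h3 : P + P = -P := by
      rw [eq_neg_iff_add_eq_zero]
      have : P + P + P + P = 0 + P := by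
        rw [zero_add, add_assoc (P + P), h]
      exact add_right_cancel this
    rw [h3, xCoord_neg, hP] at h2
    have : (12 * w) * c = 0 := by linear_combination h2
    exact mul_ne_zero (mul_ne_zero (by norm_num) hw) hc0 this
  · rw [e5, h, neg_add_cancel]

-- The numerator of `orbitSum - S` has a root over the algebraically closed field, and the
-- factorization of the fifth division polynomial makes the point above it a 5-torsion point outside
-- `⟨P⟩`.
open Polynomial in
theorem IsShort.exists_orbitSum_eq [IsAlgClosed F] (hW : IsShort W A B)
    (hc : c ^ 2 = s ^ 2 + 22 * s * w + 125 * w ^ 2)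
    (hA : A = -3 * (s ^ 2 + 10 * s * w + 5 * w ^ 2) * c ^ 2)
    (hB : B = 2 * (s ^ 2 + 4 * s * w - w ^ 2) * (c ^ 2) ^ 2) (hc0 : c ≠ 0) (hw : w ≠ 0)
    (ht : t ^ 2 = 5) {P : W.Point} (hP0 : P ≠ 0) (hP : xCoord P = c ^ 2 + 6 * w * c) :
    ∃ Q : W.Point, Q ≠ 0 ∧ xCoord Q ≠ xCoord P ∧ xCoord Q ≠ xCoord (P + P) ∧
      (5 : ℤ) • Q = 0 ∧ orbitSum P Q = -c ^ 2 + 6 * t / 5 * s * c := by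
  obtain ⟨hy1, h1, h2⟩ := hW.xCoord_double_of_second_family hc hA hB hc0 hw hP0 hP
  have hcc : (-c) ^ 2 = c ^ 2 := neg_sq c
  have hy2 := (hW.xCoord_double_of_second_family (c := -c) (hcc.trans hc)
    (by rw [hcc]; exact hA) (by rw [hcc]; exact hB) (neg_ne_zero.2 hc0) hw h1 (by rw [h2]; ring)).1
  have heq1 := hW.equation hP0
  have heq2 := hW.equation h1
  set r₁ := xCoord P with hr₁
  set r₂ := xCoord (P + P) with hr₂
  set S := -c ^ 2 + 6 * t / 5 * s * c with hS
  have hr12 : r₁ - r₂ ≠ 0 := by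
    rw [hP, h2]
    have : c ^ 2 + 6 * w * c - (c ^ 2 - 6 * w * c) = 12 * w * c := by ring
    rw [this]
    exact mul_ne_zero (mul_ne_zero (by norm_num) hw) hc0
  let p : F[X] := X * ((X - C r₁) ^ 2 * (X - C r₂) ^ 2) +
    (2 * (X + C r₁) * (X * C r₁ + C A) + C (4 * B)) * (X - C r₂) ^ 2 +
    (2 * (X + C r₂) * (X * C r₂ + C A) + C (4 * B)) * (X - C r₁) ^ 2 -
    C S * ((X - C r₁) ^ 2 * (X - C r₂) ^ 2)
  have hdeg : p.degree = 5 := by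
    simp only [p]; compute_degree!
  obtain ⟨x, hx⟩ := IsAlgClosed.exists_root p (by rw [hdeg]; decide)
  simp only [p, IsRoot, eval_sub, eval_add, eval_mul, eval_pow, eval_X, eval_C, eval_ofNat] at hx
  -- At the pole `r₁` the numerator reduces to `4y(P)²(r₁ - r₂)²`, which is not zero.
  have hx1 : x ≠ r₁ := by
    rintro rfl
    have : (4 * yCoord P ^ 2) * (xCoord P - r₂) ^ 2 = 0 := by
      rw [heq1]; linear_combination hx
    exact mul_ne_zero (mul_ne_zero (by norm_num) (pow_ne_zero 2 hy1)) (pow_ne_zero 2 hr12) this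
  have hx2 : x ≠ r₂ := by
    rintro rfl
    have : (4 * yCoord (P + P) ^ 2) * (r₁ - xCoord (P + P)) ^ 2 = 0 := by
      rw [heq2]; linear_combination hx
    exact mul_ne_zero (mul_ne_zero (by norm_num) (pow_ne_zero 2 hy2)) (pow_ne_zero 2 hr12) this
  obtain ⟨Q, hQ0, hQ⟩ := hW.exists_point_of_xCoord x
  refine ⟨Q, hQ0, by rwa [hQ], by rwa [hQ], ?_, ?_⟩
  · rw [hW.five_zsmul_eq_zero_iff hQ0, hQ]
    have key := psi₅_eq_mul hc hA hB rfl x _ _ rfl rfl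
    rw [key]
    have hf : x ^ 2 - 2 * c ^ 2 * x + ((c ^ 2) ^ 2 - 36 * w ^ 2 * c ^ 2) =
        (x - r₁) * (x - r₂) := by rw [hP, h2]; ring
    set f := x ^ 2 - 2 * c ^ 2 * x + ((c ^ 2) ^ 2 - 36 * w ^ 2 * c ^ 2) with hfdef
    set n := x * f ^ 2 + (2 * x ^ 2 + 2 * A) * (2 * c ^ 2 * x ^ 2 -
        4 * ((c ^ 2) ^ 2 - 36 * w ^ 2 * c ^ 2) * x +
        2 * ((c ^ 2) ^ 2 - 36 * w ^ 2 * c ^ 2) * c ^ 2) +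
      (2 * x * A + 4 * B) * (2 * x ^ 2 - 4 * c ^ 2 * x + 4 * (c ^ 2) ^ 2 -
        2 * ((c ^ 2) ^ 2 - 36 * w ^ 2 * c ^ 2)) +
      2 * x * ((4 * (c ^ 2) ^ 2 - 2 * ((c ^ 2) ^ 2 - 36 * w ^ 2 * c ^ 2)) * x ^ 2 -
        4 * ((c ^ 2) ^ 2 - 36 * w ^ 2 * c ^ 2) * c ^ 2 * x +
        2 * ((c ^ 2) ^ 2 - 36 * w ^ 2 * c ^ 2) ^ 2) with hn
    have hnS : n = S * f ^ 2 := by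
      rw [← sub_eq_zero, ← hx, hn, hf, hP, h2]
      ring
    rw [hnS, hS]
    linear_combination -5 * f * (36 / 25 * s ^ 2 * c ^ 2 * f ^ 4) * ht
  · have e1 := hW.xCoord_add_add_xCoord_sub hQ0 hP0 (by rwa [hQ])
    have e2 := hW.xCoord_add_add_xCoord_sub hQ0 h1 (by rwa [hQ])
    rw [orbitSum, e1, e2, hQ, ← hr₁, ← hr₂]
    have d1 := sub_ne_zero.2 hx1
    have d2 := sub_ne_zero.2 hx2
    field_simp
    linear_combination hx

end SecondFamilyPoints

section SecondFamilyGalois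

open Classical

/-- An automorphism fixing `c` fixes the abscissa of `P`, hence acts triangularly with first entry
`±1`. If it also negates `√5`, it changes the orbit sum of `Q`, so `σQ` is not `±Q` modulo `⟨P⟩`;
then `z ≡ ±2`, the determinant has square `-1` modulo 5, and it generates. Here `5C` being a
nonsquare is what makes such a `σ` exist. -/
theorem hasUnexplained_second_family {a b : ℤ} (ha : a ≠ 0) (hb : b ≠ 0)
    (hC : ¬ IsSquare (biquad 22 125 a b)) (hC5 : ¬ IsSquare (biquad 22 125 a b * 5)) :
    HasUnexplained (shortCurve (val A₂ a b) (val B₂ a b)) 2 5 (Multiplicative (ZMod 2)) := by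
  rw [val_A₂, val_B₂]
  set C := biquad 22 125 a b with hCdef
  set A := -3 * (a ^ 4 + 10 * a ^ 2 * b ^ 2 + 5 * b ^ 4) * C with hAdef
  set B := 2 * (a ^ 4 + 4 * a ^ 2 * b ^ 2 - b ^ 4) * C ^ 2 with hBdef
  have hCpos : 0 < C := biquad_pos (by norm_num) (by norm_num) hb
  have hdisc : -(4 * A ^ 3 + 27 * B ^ 2) = (432 * a * b ^ 5) ^ 2 * C ^ 3 := by
    rw [hAdef, hBdef, hCdef, biquad]; ring
  have hs : 432 * a * b ^ 5 ≠ 0 := mul_ne_zero (mul_ne_zero (by norm_num) ha) (pow_ne_zero 5 hb)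
  have hd : 4 * A ^ 3 + 27 * B ^ 2 ≠ 0 := by
    intro h
    rw [h, neg_zero, eq_comm] at hdisc
    exact mul_ne_zero (pow_ne_zero 2 hs) (pow_ne_zero 3 hCpos.ne') hdisc
  have hW := isShort_shortCurve hd
  obtain ⟨c, hc⟩ := IsAlgClosed.exists_pow_nat_eq (C : AlgebraicClosure ℚ) two_pos
  obtain ⟨t, ht⟩ := IsAlgClosed.exists_pow_nat_eq (5 : AlgebraicClosure ℚ) two_pos
  set s : AlgebraicClosure ℚ := (a : AlgebraicClosure ℚ) ^ 2 with hsdef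
  set w : AlgebraicClosure ℚ := (b : AlgebraicClosure ℚ) ^ 2 with hwdef
  have hs0 : s ≠ 0 := pow_ne_zero 2 (Int.cast_ne_zero.2 ha)
  have hw0 : w ≠ 0 := pow_ne_zero 2 (Int.cast_ne_zero.2 hb)
  have hσs : ∀ σ : AbsGal, σ s = s := fun σ => by rw [hsdef, map_pow, map_intCast]
  have hσw : ∀ σ : AbsGal, σ w = w := fun σ => by rw [hwdef, map_pow, map_intCast]
  have hc' : c ^ 2 = s ^ 2 + 22 * s * w + 125 * w ^ 2 := by
    rw [hc, hCdef, biquad, hsdef, hwdef]; push_cast; ring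
  have hc0 : c ≠ 0 := by
    rintro rfl
    rw [zero_pow two_ne_zero, eq_comm, Int.cast_eq_zero] at hc
    exact hCpos.ne' hc
  have ht0 : t ≠ 0 := by
    rintro rfl
    norm_num at ht
  have hA : (A : AlgebraicClosure ℚ) = -3 * (s ^ 2 + 10 * s * w + 5 * w ^ 2) * c ^ 2 := by
    rw [hAdef, hc, hsdef, hwdef]; push_cast; ring
  have hB : (B : AlgebraicClosure ℚ) = 2 * (s ^ 2 + 4 * s * w - w ^ 2) * (c ^ 2) ^ 2 := by
    rw [hBdef, hc, hsdef, hwdef]; push_cast; ring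
  obtain ⟨P, hP0, hPx⟩ := hW.exists_point_of_xCoord (c ^ 2 + 6 * w * c)
  have hP5 := hW.five_zsmul_of_second_family hc' hA hB hc0 hw0 hP0 hPx
  obtain ⟨-, hPP0, hPPx⟩ := hW.xCoord_double_of_second_family hc' hA hB hc0 hw0 hP0 hPx
  obtain ⟨Q, hQ0, hQ1, hQ2, hQ5, hQS⟩ := hW.exists_orbitSum_eq hc' hA hB hc0 hw0 ht hP0 hPx
  have hPQ : IsTorsionBasis 5 P Q := by
    refine isTorsionBasis_of_prime Nat.prime_five hP5 hQ5 hP0 ?_ hW.ncard_five_torsion.1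
      hW.ncard_five_torsion.2
    intro i hi
    rcases zsmul_eq_of_five_zsmul hP5 i with e | e | e | e | e <;> rw [e] at hi <;>
      rw [hi] at hQ0 hQ1 hQ2
    · exact hQ0 rfl
    · exact hQ1 rfl
    · exact hQ1 (xCoord_neg P)
    · exact hQ2 rfl
    · exact hQ2 (xCoord_neg (P + P))
  have hact : ∀ σ : AbsGal, σ c = c → galAct (shortCurve A B) σ P = P ∨
      galAct (shortCurve A B) σ P = -P := fun σ hσ =>
    eq_or_eq_neg_of_galAct_xCoord hP0 (by
      rw [hPx]; simp only [map_add, map_mul, map_pow, hσ, hσw, map_ofNat])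
  have hactP : ∀ σ : AbsGal, σ c = c → ∃ x : ℤ, (x = 1 ∨ x = -1) ∧
      galAct (shortCurve A B) σ P = x • P := fun σ hσ => by
    rcases hact σ hσ with e | e
    · exact ⟨1, Or.inl rfl, by rw [e, one_zsmul]⟩
    · exact ⟨-1, Or.inr rfl, by rw [e, neg_zsmul, one_zsmul]⟩
  have hactQ : ∀ σ : AbsGal, σ c = c → ∃ y z : ℤ, ¬ (5 : ℤ) ∣ z ∧
      galAct (shortCurve A B) σ Q = y • P + z • Q := fun σ hσ => by
    obtain ⟨y, z, hyz⟩ := hPQ.span (galAct (shortCurve A B) σ Q) (by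
      change (5 : ℤ) • _ = _
      rw [← map_zsmul, hQ5, map_zero])
    refine ⟨y, z, ?_, hyz⟩
    rintro ⟨k, rfl⟩
    obtain ⟨x, hx, hxP⟩ := hactP σ hσ
    have hxx : x * x = 1 := by rcases hx with rfl | rfl <;> norm_num
    rw [mul_comm, mul_zsmul, hQ5, zsmul_zero, add_zero] at hyz
    have : Q = (y * x) • P := by
      apply galAct_injective σ
      rw [hyz, map_zsmul, hxP, ← mul_zsmul, mul_assoc, hxx, mul_one]
    have h0 : (y * x) • P + (-1 : ℤ) • Q = 0 := by
      rw [← this, neg_zsmul, one_zsmul, add_neg_cancel]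
    exact absurd (hPQ.indep _ _ h0).2 (by norm_num)
  obtain ⟨σ, hσ, hσt⟩ := exists_fixed_and_apply_eq_neg hc (t := t) (T := 5)
    (by rw [ht]; norm_num) (by
      rintro ⟨k, hk⟩
      have h1 : k < 3 := by nlinarith
      have h2 : -3 < k := by nlinarith
      interval_cases k <;> omega) hC5
  obtain ⟨x, hx, hxP⟩ := hactP σ hσ
  obtain ⟨y, z, hz, hzQ⟩ := hactQ σ hσ
  have hzz : (5 : ℤ) ∣ (x * z) ^ 2 + 1 := by
    have horb : orbitSum P (galAct (shortCurve A B) σ Q) ≠ orbitSum P Q := by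
      rw [orbitSum_galAct σ (hact σ hσ), hQS]
      simp only [map_add, map_neg, map_mul, map_div₀, map_pow, map_ofNat, hσ, hσt, hσs]
      intro e
      have : 12 / 5 * t * s * c = 0 := by linear_combination -e
      exact mul_ne_zero (mul_ne_zero (mul_ne_zero (by norm_num) ht0) hs0) hc0 this
    have hQ5' : ∀ k r : ℤ, (5 * k + r) • Q = r • Q := fun k r => by
      rw [add_zsmul, mul_comm, mul_zsmul, hQ5, zsmul_zero, zero_add]
    have hz' : z = 5 * (z / 5) + 1 ∨ z = 5 * (z / 5 + 1) + -1 ∨ z % 5 = 2 ∨ z % 5 = 3 := by omega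
    have hsq : (x * z) ^ 2 = z * z := by rcases hx with rfl | rfl <;> ring
    rw [hsq]
    rcases hz' with e | e | e | e
    · rw [hzQ, e, hQ5', one_zsmul, add_comm, orbitSum_add_zsmul hP5] at horb
      exact absurd rfl horb
    · rw [hzQ, e, hQ5', neg_zsmul, one_zsmul, add_comm, orbitSum_add_zsmul hP5,
        orbitSum_neg] at horb
      exact absurd rfl horb
    · rw [Int.dvd_iff_emod_eq_zero]; simp [Int.add_emod, Int.mul_emod, e]
    · rw [Int.dvd_iff_emod_eq_zero]; simp [Int.add_emod, Int.mul_emod, e]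
  refine hasUnexplained_of_torsion (p := 5) (k := 13) (s := 432 * a * b ^ 5) (by norm_num)
    (by norm_num) (by norm_num) ?_ hs hC hc hdisc ?_ ?_ hPQ hσ hxP hzQ ?_
  · intro a' b' h1 h2
    have h1' := Nat.le_of_dvd (by norm_num) h1
    have h2' := Nat.le_of_dvd (by norm_num) h2
    have e : Nat.lcm 2 5 = 10 := by norm_num
    rw [e] at h1 h2 h1' h2'
    interval_cases a' <;> interval_cases b' <;> revert h1 h2 <;> decide
  · intro τ hτ
    have e1 := xCoord_galAct τ P
    have e2 := xCoord_galAct τ (P + P)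
    rw [hτ _ hP5, hPx] at e1
    rw [hτ (P + P) (by rw [zsmul_add]; exact (congrArg₂ _ hP5 hP5).trans (add_zero _)), hPPx] at e2
    simp only [map_add, map_sub, map_mul, map_pow, hσw, map_ofNat] at e1 e2
    -- The abscissas of `P` and `2P` differ by `12wc`, so `c` lies in the 5-torsion field.
    have : 12 * w * (τ c - c) = 0 := by linear_combination e2 - e1
    exact sub_eq_zero.1 ((mul_eq_zero.1 this).resolve_left (mul_ne_zero (by norm_num) hw0))
  · intro τ hτ R hR
    obtain ⟨x', hx', hP'⟩ := hactP τ hτ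
    obtain ⟨y', z', hz', hQ'⟩ := hactQ τ hτ
    have hit : ∀ (n : ℕ) (S : GeomPoint (shortCurve A B)),
        galAct (shortCurve A B) (τ ^ n) S = (galAct (shortCurve A B) τ)^[n] S := by
      intro n
      induction n with
      | zero => intro S; rw [pow_zero, map_one]; rfl
      | succ n ih => intro S; rw [pow_succ, galAct_mul_apply, ih, Function.iterate_succ_apply]
    rw [hit]
    exact iterate_forty_of_triangular hPQ _ hx' hz' hP' hQ' hR
  · intro u u' hu
    refine mem_zpowers_of_cast_sq_eq_neg_one (by norm_num) (Nat.dvd_lcm_right 2 5) u u' ?_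
    rw [hu, ← Int.cast_mul, ← Int.cast_pow, eq_neg_iff_add_eq_zero]
    have := (ZMod.intCast_zmod_eq_zero_iff_dvd ((x * z) ^ 2 + 1) 5).2 hzz
    push_cast at this ⊢
    exact this

end SecondFamilyGalois


/-! ### Lower bounds for the number of curves with an unexplained entanglement -/

theorem finite_height_le (X : ℝ) : {p : ℤ × ℤ | (height p.1 p.2 : ℝ) ≤ X}.Finite := by
  refine ((Set.finite_Icc (-⌈X⌉) ⌈X⌉).prod (Set.finite_Icc (-⌈X⌉) ⌈X⌉)).subset fun p hp => ?_
  have hX : height p.1 p.2 ≤ ⌈X⌉ := by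
    have : (height p.1 p.2 : ℝ) ≤ ⌈X⌉ := le_trans hp (Int.le_ceil X)
    exact_mod_cast this
  have h1 : 4 * |p.1| ^ 3 ≤ ⌈X⌉ := (le_max_left _ _).trans hX
  have h2 : 27 * p.2 ^ 2 ≤ ⌈X⌉ := (le_max_right _ _).trans hX
  have key : ∀ (x : ℤ) (n : ℕ), n ≠ 0 → |x| ≤ |x| ^ n := fun x n hn =>
    (abs_nonneg x).eq_or_lt.elim (fun h => by rw [← h, zero_pow hn]) fun h => le_self_pow₀ h hn
  have h3 := key p.1 3 (by norm_num)
  have h4 := key p.2 2 (by norm_num)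
  rw [sq_abs] at h4
  refine ⟨abs_le.1 ?_, abs_le.1 ?_⟩
  · linarith [pow_nonneg (abs_nonneg p.1) 3]
  · linarith [sq_nonneg p.2]

theorem eq_of_div_eq_div_of_gcd {p q : ℤ × ℤ} (hp : Int.gcd p.1 p.2 = 1)
    (hq : Int.gcd q.1 q.2 = 1) (hp0 : 0 < p.2) (hq0 : 0 < q.2)
    (h : (p.1 : ℚ) / p.2 = (q.1 : ℚ) / q.2) : p = q := by
  have hn := Rat.div_int_inj hp0 hq0 hp hq h
  exact Prod.ext hn.1 hn.2

-- The sieve yields at least `(L/2)X^(2/k)` pairs. All pairs giving one curve have their ratio `a/b`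
-- among the at most `k` roots of `f`, and a coprime pair with `b > 0` is determined by its ratio;
-- dividing by `k` counts curves.
open Polynomial in
theorem exists_lower_bound {A B : MvPolynomial (Fin 2) ℤ} {k : ℕ} (hAB : IsHeightPair A B k)
    {m n : ℤ} (hm : 0 ≤ m) (hn : 0 < n) {s : Finset Nat.Primes}
    {D : ∀ l : ℕ, Set (ZMod (l ^ 6) × ZMod (l ^ 6))} (hD : IsBiquadSieve m n s D) {a b : ℕ}
    {T : Type} [Group T]
    (hT : ∀ p : ℤ × ℤ, 0 < p.2 → (∀ l : Nat.Primes, residue ((l : ℕ) ^ 6) p ∈ D l) →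
      4 * val A p.1 p.2 ^ 3 + 27 * val B p.1 p.2 ^ 2 ≠ 0 ∧ Int.gcd p.1 p.2 = 1 ∧
      IsMinimal (val A p.1 p.2) (val B p.1 p.2) ∧
      HasUnexplained (shortCurve (val A p.1 p.2) (val B p.1 p.2)) a b T ∧
      ∃ f : ℚ[X], f ≠ 0 ∧ f.natDegree ≤ k ∧ ∀ q : ℤ × ℤ, 0 < q.2 →
        val A q.1 q.2 = val A p.1 p.2 → val B q.1 q.2 = val B p.1 p.2 →
        f.eval ((q.1 : ℚ) / q.2) = 0) :
    ∃ c : ℝ, 0 < c ∧ ∀ᶠ X : ℝ in atTop,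
      c * X ^ (2 / k : ℝ) ≤ (entanglementCount a b T X : ℝ) := by
  have hk : (0 : ℝ) < k := by exact_mod_cast Nat.pos_of_ne_zero hAB.ne_zero
  set L := volume.real (region A B) * ∏' l : Nat.Primes, density D l with hL
  have hL0 : 0 < L := mul_pos hAB.volumeReal_pos hD.multipliable_and_pos.2
  refine ⟨L / 2 / k, by positivity, ?_⟩
  filter_upwards [(hAB.tendsto_sieve hm hn hD).eventually_const_lt (half_lt_self hL0),
    eventually_gt_atTop 0] with X hX hX0
  rw [lt_div_iff₀ (Real.rpow_pos_of_pos hX0 _)] at hX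
  set S := scaledPoints (region A B)
    (fun p => ∀ l : Nat.Primes, residue ((l : ℕ) ^ 6) p ∈ D l) (X ^ (1 / k : ℝ)) with hS
  have hSfin : S.Finite := scaledPoints_finite hAB.bounded _ (Real.rpow_pos_of_pos hX0 _)
  have hmem : ∀ p ∈ S, 0 < p.2 ∧ (∀ l : Nat.Primes, residue ((l : ℕ) ^ 6) p ∈ D l) ∧
      (height (val A p.1 p.2) (val B p.1 p.2) : ℝ) ≤ X := fun p hp =>
    have h := (hAB.mem_region_iff hX0 p).1 hp.2
    ⟨h.1, hp.1, h.2⟩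
  let g : ℤ × ℤ → ℤ × ℤ := fun p => (val A p.1 p.2, val B p.1 p.2)
  have hcard : S.ncard ≤ k * entanglementCount a b T X := by
    rw [Set.ncard_eq_toFinset_card S hSfin]
    refine (Finset.card_le_mul_card_image (f := g) hSfin.toFinset k ?_).trans
      (Nat.mul_le_mul_left k ?_)
    · intro y hy
      obtain ⟨p, hp, rfl⟩ := Finset.mem_image.1 hy
      obtain ⟨hp0, hpD, -⟩ := hmem p (hSfin.mem_toFinset.1 hp)
      obtain ⟨-, -, -, -, f, hf0, hdeg, hroot⟩ := hT p hp0 hpD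
      refine le_trans (Finset.card_le_card_of_injOn (t := f.roots.toFinset)
        (fun q => (q.1 : ℚ) / q.2) ?_ ?_)
        ((Multiset.toFinset_card_le _).trans (f.card_roots'.trans hdeg))
      · intro q hq
        obtain ⟨hqS, hqp⟩ := Finset.mem_filter.1 hq
        rw [Finset.mem_coe, Multiset.mem_toFinset, mem_roots hf0]
        exact hroot q (hmem q (hSfin.mem_toFinset.1 hqS)).1 (congrArg Prod.fst hqp)
          (congrArg Prod.snd hqp)
      · intro q hq q' hq' h
        obtain ⟨h0, hd, -⟩ := hmem q (hSfin.mem_toFinset.1 (Finset.mem_filter.1 hq).1)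
        obtain ⟨h0', hd', -⟩ := hmem q' (hSfin.mem_toFinset.1 (Finset.mem_filter.1 hq').1)
        exact eq_of_div_eq_div_of_gcd (hT q h0 hd).2.1 (hT q' h0' hd').2.1 h0 h0' h
    · rw [entanglementCount, ← Set.ncard_coe_finset]
      refine Set.ncard_le_ncard ?_ ((finite_height_le X).subset fun p hp => hp.2.2.1)
      intro y hy
      obtain ⟨p, hp, rfl⟩ := Finset.mem_image.1 hy
      obtain ⟨hp0, hpD, hpX⟩ := hmem p (hSfin.mem_toFinset.1 hp)
      obtain ⟨h1, -, h2, h3, -⟩ := hT p hp0 hpD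
      exact ⟨h1, h2, hpX, h3⟩
  have hcard' : (S.ncard : ℝ) ≤ k * entanglementCount a b T X := by exact_mod_cast hcard
  rw [div_mul_eq_mul_div, div_le_iff₀ hk, mul_comm _ (k : ℝ)]
  exact hX.le.trans hcard'

theorem not_isSquare_of_zmod {q : ℕ} {x : ℤ} {y : ZMod q} (h : (x : ZMod q) = y)
    (hy : ¬ IsSquare y) : ¬ IsSquare x := fun hx =>
  hy (h ▸ hx.map (Int.castRingHom (ZMod q)))

theorem biquad_cast_of_dvd {q : ℕ} {r p : ℤ × ℤ} (h1 : (q : ℤ) ∣ p.1 - r.1)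
    (h2 : (q : ℤ) ∣ p.2 - r.2) (m n : ℤ) :
    ((biquad m n p.1 p.2 : ℤ) : ZMod q) = ((biquad m n r.1 r.2 : ℤ) : ZMod q) := by
  have e1 := (ZMod.intCast_eq_intCast_iff_dvd_sub r.1 p.1 q).2 h1
  have e2 := (ZMod.intCast_eq_intCast_iff_dvd_sub r.2 p.2 q).2 h2
  unfold biquad
  push_cast
  rw [e1, e2]

open Polynomial in
theorem exists_lower_bound_first_family : ∃ c : ℝ, 0 < c ∧ ∀ᶠ X : ℝ in atTop,
    c * X ^ (1 / 9 : ℝ) ≤ (entanglementCount 2 3 (Multiplicative (ZMod 2)) X : ℝ) := by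
  -- The congruence to `(1, 2)` modulo 5 gives `C ≡ 2`, a nonresidue, and also `a ≠ 0`.
  have hr : residue (5 ^ 6) (1, 2) ∈ familyClasses A₁ B₁ 5 := by
    rw [residue_mem_familyClasses, val_A₁]
    exact ⟨Or.inl (by norm_num), Or.inl (by norm_num [biquad])⟩
  have hD := isBiquadSieve₁.withCongruence Nat.prime_five (1, 2) hr
  have main := exists_lower_bound (a := 2) (b := 3) (T := Multiplicative (ZMod 2)) isHeightPair₁
    (by norm_num) (by norm_num) hD ?_
  · have e : (2 / (18 : ℕ) : ℝ) = 1 / 9 := by norm_num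
    rwa [e] at main
  intro p hp0 hp
  simp only [residue_mem_withCongruence] at hp
  obtain ⟨hgcd, hmin⟩ := (forall_residue_mem_familyClasses A₁ B₁ p).1 fun l => (hp l).1
  obtain ⟨h1, h2⟩ := (hp ⟨5, Nat.prime_five⟩).2 rfl
  have hC : ∀ q : ℤ × ℤ, 0 < q.2 → 0 < biquad (36 : ℤ) 432 q.1 q.2 := fun q hq =>
    biquad_pos (by norm_num) (by norm_num) hq.ne'
  have ha : p.1 ≠ 0 := by
    intro h
    rw [h] at h1
    norm_num at h1
  refine ⟨?_, hgcd, hmin, hasUnexplained_first_family ha hp0.ne' ?_, ?_⟩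
  · rw [discriminant₁]
    exact mul_ne_zero (mul_ne_zero (by norm_num) (pow_ne_zero 6 hp0.ne'))
      (pow_ne_zero 3 (hC p hp0).ne')
  · exact not_isSquare_of_zmod (biquad_cast_of_dvd (r := (1, 2)) h1 h2 36 432) (by decide)
  -- In `A³/(4A³ + 27B²)` the form `C` cancels; up to a constant what remains is `(t² + 12)³` with
  -- `t = u/v`.
  · have hdeg : ((X ^ 2 + 12) ^ 3 - C ((((p.1 : ℚ) / p.2) ^ 2 + 12) ^ 3) : ℚ[X]).degree = 6 := by
      compute_degree!
    refine ⟨_, ne_zero_of_degree_gt (n := 0) (hdeg ▸ by decide),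
      (natDegree_le_of_degree_le hdeg.le).trans (by norm_num), ?_⟩
    intro q hq hA hB
    have hdisc : (4 * val A₁ q.1 q.2 ^ 3 + 27 * val B₁ q.1 q.2 ^ 2) =
        4 * val A₁ p.1 p.2 ^ 3 + 27 * val B₁ p.1 p.2 ^ 2 := by rw [hA, hB]
    rw [discriminant₁, discriminant₁] at hdisc
    rw [val_A₁, val_A₁] at hA
    have hp' : (p.2 : ℚ) ≠ 0 := by exact_mod_cast hp0.ne'
    have hq' : (q.2 : ℚ) ≠ 0 := by exact_mod_cast hq.ne'
    have hCpq := mul_ne_zero (pow_ne_zero 3 (hC p hp0).ne') (pow_ne_zero 3 (hC q hq).ne')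
    have key : (q.1 ^ 2 + 12 * q.2 ^ 2) ^ 3 * p.2 ^ 6 =
        (p.1 ^ 2 + 12 * p.2 ^ 2) ^ 3 * q.2 ^ 6 := by
      apply mul_left_cancel₀ hCpq
      generalize biquad (36 : ℤ) 432 q.1 q.2 = K at *
      generalize biquad (36 : ℤ) 432 p.1 p.2 = K' at *
      have h3 : (q.1 ^ 2 + 12 * q.2 ^ 2) ^ 3 * K ^ 3 = (p.1 ^ 2 + 12 * p.2 ^ 2) ^ 3 * K' ^ 3 := by
        rw [← mul_pow, ← mul_pow]
        congr 1
        linarith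
      have h4 : q.2 ^ 6 * K ^ 3 = p.2 ^ 6 * K' ^ 3 := by linarith
      linear_combination p.2 ^ 6 * K' ^ 3 * h3 - (p.1 ^ 2 + 12 * p.2 ^ 2) ^ 3 * K' ^ 3 * h4
    have key' : ((q.1 : ℚ) ^ 2 + 12 * q.2 ^ 2) ^ 3 * p.2 ^ 6 =
        ((p.1 : ℚ) ^ 2 + 12 * p.2 ^ 2) ^ 3 * q.2 ^ 6 := by exact_mod_cast key
    simp only [eval_sub, eval_add, eval_pow, eval_X, eval_C, eval_ofNat]
    field_simp
    linear_combination key'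

open Polynomial in
theorem exists_lower_bound_second_family : ∃ c : ℝ, 0 < c ∧ ∀ᶠ X : ℝ in atTop,
    c * X ^ (1 / 12 : ℝ) ≤ (entanglementCount 2 5 (Multiplicative (ZMod 2)) X : ℝ) := by
  -- The congruence to `(1, 4)` modulo 11 gives `C ≡ 2`, a nonresidue; 5 is a residue modulo 11, so
  -- `5C` is a nonresidue as well.
  have hr : residue (11 ^ 6) (1, 4) ∈ familyClasses A₂ B₂ 11 := by
    rw [residue_mem_familyClasses, val_B₂]
    exact ⟨Or.inl (by norm_num), Or.inr (by norm_num [biquad])⟩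
  have hD := isBiquadSieve₂.withCongruence Nat.prime_eleven (1, 4) hr
  have main := exists_lower_bound (a := 2) (b := 5) (T := Multiplicative (ZMod 2)) isHeightPair₂
    (by norm_num) (by norm_num) hD ?_
  · have e : (2 / (24 : ℕ) : ℝ) = 1 / 12 := by norm_num
    rwa [e] at main
  intro p hp0 hp
  simp only [residue_mem_withCongruence] at hp
  obtain ⟨hgcd, hmin⟩ := (forall_residue_mem_familyClasses A₂ B₂ p).1 fun l => (hp l).1
  obtain ⟨h1, h2⟩ := (hp ⟨11, Nat.prime_eleven⟩).2 rfl
  have hC : ∀ q : ℤ × ℤ, 0 < q.2 → 0 < biquad (22 : ℤ) 125 q.1 q.2 := fun q hq =>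
    biquad_pos (by norm_num) (by norm_num) hq.ne'
  have ha : p.1 ≠ 0 := by
    intro h
    rw [h] at h1
    norm_num at h1
  have hcast := biquad_cast_of_dvd (r := (1, 4)) h1 h2 22 125
  refine ⟨?_, hgcd, hmin, hasUnexplained_second_family ha hp0.ne' ?_ ?_, ?_⟩
  · rw [discriminant₂]
    exact mul_ne_zero (mul_ne_zero (mul_ne_zero (by norm_num) (pow_ne_zero 2 ha))
      (pow_ne_zero 10 hp0.ne')) (pow_ne_zero 3 (hC p hp0).ne')
  · exact not_isSquare_of_zmod hcast (by decide)
  · exact not_isSquare_of_zmod (by rw [Int.cast_mul, hcast]) (by decide)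
  · have hp' : (p.2 : ℚ) ≠ 0 := by exact_mod_cast hp0.ne'
    have ha' : ((p.1 : ℚ) / p.2) ^ 2 ≠ 0 := pow_ne_zero 2 (div_ne_zero (by exact_mod_cast ha) hp')
    set t := (p.1 : ℚ) / p.2 with ht
    -- Here the invariant `A³/(4A³ + 27B²)` is, up to a constant, `(t⁴ + 10t² + 5)³/t²`; clearing
    -- denominators leaves the leading coefficient `t²`, nonzero because `a ≠ 0`.
    have hdeg : (C (t ^ 2) * (X ^ 4 + 10 * X ^ 2 + 5) ^ 3 -
        C ((t ^ 4 + 10 * t ^ 2 + 5) ^ 3) * X ^ 2 : ℚ[X]).degree = 12 := by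
      compute_degree!
      exact fun h => ha' (by rw [h, zero_pow two_ne_zero])
    refine ⟨_, ne_zero_of_degree_gt (n := 0) (hdeg ▸ by decide),
      (natDegree_le_of_degree_le hdeg.le).trans (by norm_num), ?_⟩
    intro q hq hA hB
    have hdisc : (4 * val A₂ q.1 q.2 ^ 3 + 27 * val B₂ q.1 q.2 ^ 2) =
        4 * val A₂ p.1 p.2 ^ 3 + 27 * val B₂ p.1 p.2 ^ 2 := by rw [hA, hB]
    rw [discriminant₂, discriminant₂] at hdisc
    rw [val_A₂, val_A₂] at hA
    have hq' : (q.2 : ℚ) ≠ 0 := by exact_mod_cast hq.ne'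
    have hCpq := mul_ne_zero (pow_ne_zero 3 (hC p hp0).ne') (pow_ne_zero 3 (hC q hq).ne')
    have key : (q.1 ^ 4 + 10 * q.1 ^ 2 * q.2 ^ 2 + 5 * q.2 ^ 4) ^ 3 * (p.1 ^ 2 * p.2 ^ 10) =
        (p.1 ^ 4 + 10 * p.1 ^ 2 * p.2 ^ 2 + 5 * p.2 ^ 4) ^ 3 * (q.1 ^ 2 * q.2 ^ 10) := by
      apply mul_left_cancel₀ hCpq
      generalize biquad (22 : ℤ) 125 q.1 q.2 = K at *
      generalize biquad (22 : ℤ) 125 p.1 p.2 = K' at *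
      have h3 : (q.1 ^ 4 + 10 * q.1 ^ 2 * q.2 ^ 2 + 5 * q.2 ^ 4) ^ 3 * K ^ 3 =
          (p.1 ^ 4 + 10 * p.1 ^ 2 * p.2 ^ 2 + 5 * p.2 ^ 4) ^ 3 * K' ^ 3 := by
        rw [← mul_pow, ← mul_pow]
        congr 1
        linarith
      have h4 : q.1 ^ 2 * q.2 ^ 10 * K ^ 3 = p.1 ^ 2 * p.2 ^ 10 * K' ^ 3 := by linarith
      linear_combination p.1 ^ 2 * p.2 ^ 10 * K' ^ 3 * h3 -
        (p.1 ^ 4 + 10 * p.1 ^ 2 * p.2 ^ 2 + 5 * p.2 ^ 4) ^ 3 * K' ^ 3 * h4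
    have key' : ((q.1 : ℚ) ^ 4 + 10 * q.1 ^ 2 * q.2 ^ 2 + 5 * q.2 ^ 4) ^ 3 *
        (p.1 ^ 2 * p.2 ^ 10) = ((p.1 : ℚ) ^ 4 + 10 * p.1 ^ 2 * p.2 ^ 2 + 5 * p.2 ^ 4) ^ 3 *
        (q.1 ^ 2 * q.2 ^ 10) := by exact_mod_cast key
    simp only [eval_sub, eval_add, eval_mul, eval_pow, eval_X, eval_C, eval_ofNat, ht]
    field_simp
    linear_combination key'

end Entanglement

end

theorem theoremA :
    (∃ c : ℝ, 0 < c ∧ ∀ᶠ X : ℝ in Filter.atTop,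
      c * X ^ (1 / 9 : ℝ) ≤
        (Entanglement.entanglementCount 2 3 (Multiplicative (ZMod 2)) X : ℝ)) ∧
    (∃ c : ℝ, 0 < c ∧ ∀ᶠ X : ℝ in Filter.atTop,
      c * X ^ (1 / 12 : ℝ) ≤
        (Entanglement.entanglementCount 2 5 (Multiplicative (ZMod 2)) X : ℝ)) ∧
    (Entanglement.HasEulerAsymptotic Entanglement.A₁ Entanglement.B₁ (1 / 9) ∧
      Entanglement.localDensity Entanglement.A₁ Entanglement.B₁ 2 = 1 / 2 ∧
      Entanglement.localDensity Entanglement.A₁ Entanglement.B₁ 3 = 2 / 3 ∧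
      ∀ l : ℕ, l.Prime → l ≠ 2 → l ≠ 3 →
        Entanglement.localDensity Entanglement.A₁ Entanglement.B₁ l =
          1 - 1 / (l : ℝ) ^ 2 -
            (Entanglement.rootCount Entanglement.C₁ l : ℝ) * ((l : ℝ) - 1) / (l : ℝ) ^ 5) ∧
    (Entanglement.HasEulerAsymptotic Entanglement.A₂ Entanglement.B₂ (1 / 12) ∧
      ∀ l : ℕ, l.Prime → l ≠ 2 → l ≠ 3 → l ≠ 5 →
        Entanglement.localDensity Entanglement.A₂ Entanglement.B₂ l =
          1 - 1 / (l : ℝ) ^ 2 -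
            (Entanglement.rootCount Entanglement.C₂ l : ℝ) * ((l : ℝ) - 1) / (l : ℝ) ^ 5) :=
  ⟨Entanglement.exists_lower_bound_first_family, Entanglement.exists_lower_bound_second_family,
    ⟨Entanglement.hasEulerAsymptotic₁, Entanglement.localDensity₁_two,
      Entanglement.localDensity₁_three, fun _ => Entanglement.localDensity₁_eq⟩,
    ⟨Entanglement.hasEulerAsymptotic₂, fun _ => Entanglement.localDensity₂_eq⟩⟩
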